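/- **Setting.** Let $\mathbb{T}^3=(\mathbb{R}/\mathbb{Z})^3$ with Lebesgue measure $dx$. Let $q_1,q_2,q_3>0$ and $A\ge 0$ satisfy $\sum_i q_i=1$, $\sum_i q_i^2=1-A^2$ (a Kasner solution $-dt^2+\mathring g$, $\mathring g=\sum_i t^{2q_i}(dx^i)^2$, $\mathring\phi=A\ln t$), and put $\sigma=(\sum_i q_i^2-\tfrac13)^{1/2}$, $\mathring K=\mathrm{diag}(-q_1,-q_2,-q_3)$, $\hat K=\mathring K+\tfrac13 I$. Repeated indices are summed. The unknowns on $(0,1]\times\mathbb{T}^3$ are $h_{ij}=h_{ji}$ (metric perturbation), $K^i_{\ j}$ (perturbation of $t$ times the mixed second fundamental form), $\varphi$ (scalar field perturbation) and $\nu$ (lapse perturbation). Write $\Gamma_{a\ b}^{\ i}=\tfrac12\mathring g^{ic}(\partial_a h_{cb}+\partial_b h_{ac}-\partial_c h_{ab})$, $R=-\tfrac12\mathring g^{ab}\mathring g^{ef}\partial_e\partial_f h_{ab}+\mathring g^{ef}\partial_a\Gamma_{e\ f}^{\ a}$, $\mathrm{Ric}^i_{\ j}=-\tfrac12\mathring g^{ia}\mathring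 g^{ef}\partial_e\partial_f h_{ja}+\tfrac12\mathring g^{ef}\partial_j\Gamma_{e\ f}^{\ i}+\tfrac12\mathring g^{ia}\mathring g_{jb}\mathring g^{ef}\partial_a\Gamma_{e\ f}^{\ b}$. The Einstein–scalar field equations in the parabolic lapse gauge $\lambda^{-1}(n-1)=t\,\mathrm{tr}\,k+1$ with transported spatial coordinates, linearized around the Kasner solution, are $$K^a_{\ a}=\lambda^{-1}\nu,\qquad t^2R-2\hat K^a_{\ b}K^b_{\ a}-2At\partial_t\varphi+2(A^2-\kappa\lambda^{-1})\nu=0,$$ $$\partial_aK^a_{\ i}=\lambda^{-1}\partial_i\nu-A\partial_i\varphi-\Gamma_{a\ b}^{\ a}\hat K^b_{\ i}+\Gamma_{a\ i}^{\ b}\hat K^a_{\ b},$$ $$\mathring g^{ab}\partial_aK^i_{\ b}=\lambda^{-1}\mathring g^{ia}\partial_a\nu-A\mathring g^{ia}\partial_a\varphi-\mathring g^{ab}\Gamma_{a\ c}^{\ i}\hat K^c_{\ b}+\mathring g^{ab}\Gamma_{a\ b}^{\ c}\hat K^i_{\ c},$$ $$\lambda^{-1}t\partial_t\nu+t^2\mathring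 g^{ab}\partial_a\partial_b\nu-(1-\lambda^{-1})\nu=t^2R,$$ $$\partial_th_{ij}=-2t^{-1}\mathring K^a_{\ j}h_{ia}-2t^{-1}\mathring g_{ia}K^a_{\ j}-2t^{-1}\mathring g_{ia}\mathring K^a_{\ j}\nu,$$ $$\partial_tK^i_{\ j}=-t\mathring g^{ia}\partial_a\partial_j\nu-(1-\lambda^{-1})t^{-1}\mathring K^i_{\ j}\nu+t\,\mathrm{Ric}^i_{\ j},$$ $$-\partial_t(t\partial_t\varphi)+t\mathring g^{ab}\partial_a\partial_b\varphi=-A\partial_t\nu+A(1-\lambda^{-1})t^{-1}\nu.$$ Here $\kappa=\tfrac23$ is the value that the linearization of the Hamiltonian constraint produces; the theorem is also asserted for the system with $\kappa=1$. A solution consists of $h,K,\varphi,\partial_t\varphi,\nu$ that are in $L^2(\mathbb{T}^3)$ for each $t\in(0,1]$, whose pairings with every smooth function on $\mathbb{T}^3$ are differentiable in $t\in(0,1]$ (one-sidedly at $t=1$), and that satisfy the equations for every $t\in(0,1]$ in the sense of distributions on $\mathbb{T}^3$. **Energies and norms.** $|\cdot|_{\mathring g}$ is the pointwise norm of the Kasner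 metric, $|\cdot|_{Frame}$ the Euclidean norm of the components; an $L^2$ norm is $\infty$ when the distribution is not an $L^2$ function. For $\theta>0$ set, at time $t$, $$E_\theta^2=\theta\int\big(|K|_{\mathring g}^2+\tfrac14|t\partial h|_{\mathring g}^2\big)dx+\int\big((t\partial_t\varphi)^2+|t\partial\varphi|_{\mathring g}^2\big)dx+\int\nu^2dx ,$$ the squared almost total energy. Let $E_{(Total);\theta;N}^2$ be the sum, over all spatial multi-indices $I$ with $|I|\le N$, of $E_\theta^2+\int|t\partial\nu|_{\mathring g}^2dx$ evaluated on $(\partial_Ih,\partial_IK,\partial_I\varphi,\partial_I\nu)$. With $\|T\|_{H^M}=\sum_{|I|\le M}\|\,|\partial_IT|_{Frame}\|_{L^2}$ set $$H_N(t)=\|K\|_{H^N}+\|\partial h\|_{H^N}+\|t\partial_t\varphi\|_{H^N}+t^{2/3}\|\partial\varphi\|_{H^N}+\|\nu\|_{H^N}+t^{2/3}\|\nu\|_{H^{N+1}} .$$ **Theorem.** There are absolute constants $\theta_*,C,c,\sigma_0>0$ such that the following holds for all $\lambda\ge3$, all Kasner parameters as above with $\sigma\le\sigma_0$, and every solution.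 (1) If $H_0(1)<\infty$, then for all $t\in(0,1]$ $$E_{\theta_*}^2(t)\le C\,E_{\theta_*}^2(1)-\tfrac16\theta_*\int_t^1 s^{-1}\!\int|s\partial h|_{\mathring g}^2dx\,ds-\tfrac1{12}\int_t^1 s^{-1}\!\int|s\partial\varphi|_{\mathring g}^2dx\,ds-\tfrac1{21}\int_t^1 s^{-1}\!\int|s\partial\nu|_{\mathring g}^2dx\,ds-\tfrac29\int_t^1 s^{-1}\!\int\nu^2dx\,ds+c\sigma\int_t^1 s^{-1}E_{\theta_*}^2(s)\,ds$$ (all integrals being finite), and $E_{\theta_*}(t)\le C\,E_{\theta_*}(1)\,t^{-c\sigma}$. (2) If $N\ge0$ is an integer and $H_N(1)<\infty$, then for all $t\in(0,1]$ both $E_{(Total);\theta_*;N}(t)$ and $H_N(t)$ are bounded by $\frac{C}{\sigma}H_N(1)\,t^{-c\sigma}$ if $\sigma\ne0$, and by $C\,H_N(1)\,(1+|\ln t|)$ if $\sigma=0$. -/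

import Mathlib

open MeasureTheory Set
open scoped ENNReal ContDiff

noncomputable section

namespace ParabolicKasner

/-! ### The flat torus, test functions and distributional derivatives -/

/-- The flat torus `𝕋³ = (ℝ/ℤ)³`. -/
abbrev T3 : Type := UnitAddTorus (Fin 3)

/-- The measure `dx` of the standard Euclidean metric on `𝕋³`. -/
def dx : Measure T3 := Measure.pi fun _ => AddCircle.haarAddCircle

/-- The covering map `ℝ³ → 𝕋³`. -/
def cover (x : Fin 3 → ℝ) : T3 := fun i => (x i : UnitAddCircle)

/-- The coordinate derivative `∂_i ψ` of a function on the torus. -/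
def coordDeriv (i : Fin 3) (ψ : T3 → ℝ) (x : T3) : ℝ :=
  deriv (fun s : ℝ => ψ (x + Pi.single i (s : UnitAddCircle))) 0

/-- Smooth real-valued functions on the torus. -/
def TestFn : Type := {ψ : T3 → ℝ // ContDiff ℝ ∞ (fun x => ψ (cover x))}

theorem coordDeriv_cover (i : Fin 3) (ψ : TestFn) (x : Fin 3 → ℝ) :
    coordDeriv i ψ.1 (cover x) = fderiv ℝ (fun y => ψ.1 (cover y)) x (Pi.single i 1) := by
  have h1 : (fun s : ℝ => ψ.1 (cover x + Pi.single i (s : UnitAddCircle)))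
      = fun s : ℝ => (fun y => ψ.1 (cover y)) (x + s • Pi.single i (1 : ℝ)) := by
    funext s
    have : cover x + Pi.single i (s : UnitAddCircle) = cover (x + s • Pi.single i (1 : ℝ)) := by
      funext j
      by_cases hj : j = i
      · subst hj
        simp [cover]
      · simp [cover, hj]
    simp only [this]
  have hd : DifferentiableAt ℝ (fun y => ψ.1 (cover y)) x :=
    (ψ.2.differentiable (by simp)) x
  unfold coordDeriv
  rw [h1]
  exact hd.lineDeriv_eq_fderiv

/-- The coordinate derivative as an operation on smooth functions. -/
def TestFn.partialD (i : Fin 3) (ψ : TestFn) : TestFn :=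
  ⟨coordDeriv i ψ.1, by
    have h : (fun x => coordDeriv i ψ.1 (cover x))
        = fun x => fderiv ℝ (fun y => ψ.1 (cover y)) x (Pi.single i 1) :=
      funext fun x => coordDeriv_cover i ψ x
    rw [h]
    exact (ψ.2.fderiv_right (m := ∞) (by simp)).clm_apply contDiff_const⟩

/-- Real functionals on the smooth functions. Those that occur below come from `L²` functions by
differentiation and finite linear combination, so they are distributions. -/
abbrev Distr : Type := TestFn → ℝ

/-- The distribution `ψ ↦ ∫ f ψ dx`. -/
def ofFun (f : T3 → ℝ) : Distr := fun ψ => ∫ x, f x * ψ.1 x ∂dx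

/-- The distributional coordinate derivative `∂_i T`. -/
def pD (i : Fin 3) (T : Distr) : Distr := fun ψ => - T (ψ.partialD i)

/-- `∂_I = ∂₁^{I₁} ∂₂^{I₂} ∂₃^{I₃}`. -/
def mD (I : Fin 3 → ℕ) (T : Distr) : Distr :=
  (pD 0)^[I 0] ((pD 1)^[I 1] ((pD 2)^[I 2] T))

/-- The multi-indices of order at most `M`. -/
def multiIdx (M : ℕ) : Finset (Fin 3 → ℕ) :=
  (Fintype.piFinset fun _ => Finset.range (M + 1)).filter fun I => ∑ i, I i ≤ M

/-- `∫ |T|² dx` if `T` is given by a square integrable function, and `∞` otherwise. -/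
def l2sq (T : Distr) : ℝ≥0∞ :=
  ⨅ (f : T3 → ℝ) (_ : MemLp f 2 dx ∧ T = ofFun f), ∫⁻ x, ENNReal.ofReal (f x ^ 2) ∂dx

/-- The norm `∑_{|I| ≤ M} ‖ |∂_I T|_Frame ‖_{L²}` of a tensor field with the components `T`. -/
def sobFrame {ι : Type} [Fintype ι] (M : ℕ) (T : ι → Distr) : ℝ≥0∞ :=
  ∑ I ∈ multiIdx M, (∑ a, l2sq (mD I (T a))) ^ (1 / 2 : ℝ)

/-- A family of distributions is differentiable in time at `t ∈ (0,1]`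
(one-sided at `t = 1`). -/
def TimeDiff (F : ℝ → Distr) (t : ℝ) : Prop :=
  ∀ ψ, DifferentiableWithinAt ℝ (fun s => F s ψ) (Ioc 0 1) t

/-- The time derivative `∂_t F` at `t ∈ (0,1]`. -/
def dt (F : ℝ → Distr) (t : ℝ) : Distr := fun ψ => derivWithin (fun s => F s ψ) (Ioc 0 1) t

/-! ### The Kasner background -/

/-- The exponents `q` and the constant `A` of a Kasner solution
`-dt² + ∑ t^{2 q_i} (dx^i)²`, `φ = A ln t`, with positive exponents. -/
structure IsKasner (q : Fin 3 → ℝ) (A : ℝ) : Prop where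
  pos : ∀ i, 0 < q i
  A_nonneg : 0 ≤ A
  sum_eq : ∑ i, q i = 1
  sum_sq_eq : ∑ i, q i ^ 2 = 1 - A ^ 2

/-- `σ = (∑ q_i² - 1/3)^{1/2}`. -/
def traceFreeParam (q : Fin 3 → ℝ) : ℝ := Real.sqrt (∑ i, q i ^ 2 - 1 / 3)

/-- The spatial Kasner metric. -/
def gK (q : Fin 3 → ℝ) (t : ℝ) : Matrix (Fin 3) (Fin 3) ℝ :=
  Matrix.diagonal fun i => t ^ (2 * q i)

/-- The inverse spatial Kasner metric. -/
def gKinv (q : Fin 3 → ℝ) (t : ℝ) : Matrix (Fin 3) (Fin 3) ℝ :=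
  Matrix.diagonal fun i => t ^ (-(2 * q i))

/-- `t` times the mixed second fundamental form `-(1/2) g^{ia} ∂_t g_{aj}` of the Kasner
solution. -/
def bigK (q : Fin 3 → ℝ) : Matrix (Fin 3) (Fin 3) ℝ := Matrix.diagonal fun i => - q i

/-- The trace-free part of `bigK`. -/
def bigKhat (q : Fin 3 → ℝ) : Matrix (Fin 3) (Fin 3) ℝ := bigK q + (1 / 3 : ℝ) • 1

/-! ### Linearized variables -/

/-- The linearized variables on one time slice, as distributions:
`g i j` is the metric perturbation `g_{ij}`, `K i j` the rescaled perturbation `K^i_j` of the mixed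
second fundamental form, `φ` and `dtφ` the scalar field perturbation and its time derivative, and
`ν` the lapse perturbation. -/
structure Slice where
  g : Fin 3 → Fin 3 → Distr
  K : Fin 3 → Fin 3 → Distr
  φ : Distr
  dtφ : Distr
  ν : Distr

/-- `∂_I` applied to every component. -/
def Slice.mD (I : Fin 3 → ℕ) (S : Slice) : Slice where
  g := fun i j => ParabolicKasner.mD I (S.g i j)
  K := fun i j => ParabolicKasner.mD I (S.K i j)
  φ := ParabolicKasner.mD I S.φ
  dtφ := ParabolicKasner.mD I S.dtφ
  ν := ParabolicKasner.mD I S.ν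

/-- The linearized variables as functions of `(t, x)`. -/
structure Fields where
  g : ℝ → Fin 3 → Fin 3 → T3 → ℝ
  K : ℝ → Fin 3 → Fin 3 → T3 → ℝ
  φ : ℝ → T3 → ℝ
  dtφ : ℝ → T3 → ℝ
  ν : ℝ → T3 → ℝ

/-- The time slice at time `t`. -/
def Fields.slice (u : Fields) (t : ℝ) : Slice where
  g := fun i j => ofFun (u.g t i j)
  K := fun i j => ofFun (u.K t i j)
  φ := ofFun (u.φ t)
  dtφ := ofFun (u.dtφ t)
  ν := ofFun (u.ν t)

/-- The linearized Christoffel symbol `Γ_a^i_b`. -/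
def christ (q : Fin 3 → ℝ) (t : ℝ) (S : Slice) (a i b : Fin 3) : Distr :=
  (1 / 2 : ℝ) • ∑ c, gKinv q t i c • (pD a (S.g c b) + pD b (S.g a c) - pD c (S.g a b))

/-- The linearized scalar curvature. -/
def scalCurv (q : Fin 3 → ℝ) (t : ℝ) (S : Slice) : Distr :=
  -((1 / 2 : ℝ) • ∑ a, ∑ b, ∑ e, ∑ f,
      (gKinv q t a b * gKinv q t e f) • pD e (pD f (S.g a b)))
    + ∑ a, ∑ e, ∑ f, gKinv q t e f • pD a (christ q t S e a f)

/-- The linearized mixed Ricci curvature `Ric^i_j`. -/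
def ricci (q : Fin 3 → ℝ) (t : ℝ) (S : Slice) (i j : Fin 3) : Distr :=
  -((1 / 2 : ℝ) • ∑ a, ∑ e, ∑ f,
      (gKinv q t i a * gKinv q t e f) • pD e (pD f (S.g j a)))
    + (1 / 2 : ℝ) • (∑ e, ∑ f, gKinv q t e f • pD j (christ q t S e i f))
    + (1 / 2 : ℝ) • (∑ a, ∑ b, ∑ e, ∑ f,
        (gKinv q t i a * gK q t j b * gKinv q t e f) • pD a (christ q t S e b f))

/-- The Laplacian `g^{ab} ∂_a ∂_b` of the Kasner metric. -/
def lap (q : Fin 3 → ℝ) (t : ℝ) (T : Distr) : Distr :=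
  ∑ a, ∑ b, gKinv q t a b • pD a (pD b T)

/-- Solutions on `(0,1] × 𝕋³` of the Einstein-scalar field equations in the parabolic lapse gauge
`lam⁻¹ (n - 1) = t tr k + 1` with transported spatial coordinates, linearized around a Kasner
solution. On each slice the unknowns are square integrable functions; the equations hold in the
sense of distributions in space and pointwise in time. The constant `κ` enters the linearized
Hamiltonian constraint only; the linearization of that constraint produces `κ = 2/3`. -/
structure IsLinearizedSolution (lam κ : ℝ) (q : Fin 3 → ℝ) (A : ℝ) (u : Fields) : Prop where
  -- regularity
  memLp_g : ∀ t ∈ Ioc (0 : ℝ) 1, ∀ i j, MemLp (u.g t i j) 2 dx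
  memLp_K : ∀ t ∈ Ioc (0 : ℝ) 1, ∀ i j, MemLp (u.K t i j) 2 dx
  memLp_φ : ∀ t ∈ Ioc (0 : ℝ) 1, MemLp (u.φ t) 2 dx
  memLp_dtφ : ∀ t ∈ Ioc (0 : ℝ) 1, MemLp (u.dtφ t) 2 dx
  memLp_ν : ∀ t ∈ Ioc (0 : ℝ) 1, MemLp (u.ν t) 2 dx
  timeDiff_g : ∀ t ∈ Ioc (0 : ℝ) 1, ∀ i j, TimeDiff (fun s => (u.slice s).g i j) t
  timeDiff_K : ∀ t ∈ Ioc (0 : ℝ) 1, ∀ i j, TimeDiff (fun s => (u.slice s).K i j) t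
  timeDiff_φ : ∀ t ∈ Ioc (0 : ℝ) 1, TimeDiff (fun s => (u.slice s).φ) t
  timeDiff_dtφ : ∀ t ∈ Ioc (0 : ℝ) 1, TimeDiff (fun s => (u.slice s).dtφ) t
  timeDiff_ν : ∀ t ∈ Ioc (0 : ℝ) 1, TimeDiff (fun s => (u.slice s).ν) t
  -- the metric perturbation is symmetric, and `dtφ` is the time derivative of `φ`
  symm : ∀ t ∈ Ioc (0 : ℝ) 1, ∀ i j, u.g t i j =ᵐ[dx] u.g t j i
  dtφ_eq : ∀ t ∈ Ioc (0 : ℝ) 1, dt (fun s => (u.slice s).φ) t = (u.slice t).dtφ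
  -- the gauge condition
  gauge : ∀ t ∈ Ioc (0 : ℝ) 1, ∑ a, (u.slice t).K a a = lam⁻¹ • (u.slice t).ν
  -- the Hamiltonian constraint
  hamiltonian : ∀ t ∈ Ioc (0 : ℝ) 1,
    t ^ 2 • scalCurv q t (u.slice t)
      - (2 : ℝ) • (∑ a, ∑ b, bigKhat q a b • (u.slice t).K b a)
      - (2 * A * t) • (u.slice t).dtφ
      + (2 * (A ^ 2 - κ * lam⁻¹)) • (u.slice t).ν = 0
  -- the momentum constraint, in two forms
  momentum : ∀ t ∈ Ioc (0 : ℝ) 1, ∀ i,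
    ∑ a, pD a ((u.slice t).K a i)
      = lam⁻¹ • pD i (u.slice t).ν - A • pD i (u.slice t).φ
        - ∑ a, ∑ b, bigKhat q b i • christ q t (u.slice t) a a b
        + ∑ a, ∑ b, bigKhat q a b • christ q t (u.slice t) a b i
  momentum' : ∀ t ∈ Ioc (0 : ℝ) 1, ∀ i,
    ∑ a, ∑ b, gKinv q t a b • pD a ((u.slice t).K i b)
      = lam⁻¹ • (∑ a, gKinv q t i a • pD a (u.slice t).ν)
        - A • (∑ a, gKinv q t i a • pD a (u.slice t).φ)
        - ∑ a, ∑ b, ∑ c, (gKinv q t a b * bigKhat q c b) • christ q t (u.slice t) a i c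
        + ∑ a, ∑ b, ∑ c, (gKinv q t a b * bigKhat q i c) • christ q t (u.slice t) a c b
  -- the parabolic lapse equation
  lapse : ∀ t ∈ Ioc (0 : ℝ) 1,
    (lam⁻¹ * t) • dt (fun s => (u.slice s).ν) t + t ^ 2 • lap q t (u.slice t).ν
      - (1 - lam⁻¹) • (u.slice t).ν = t ^ 2 • scalCurv q t (u.slice t)
  -- the evolution equations
  evol_g : ∀ t ∈ Ioc (0 : ℝ) 1, ∀ i j,
    dt (fun s => (u.slice s).g i j) t
      = -((2 * t⁻¹) • ∑ a, bigK q a j • (u.slice t).g i a)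
        - (2 * t⁻¹) • (∑ a, gK q t i a • (u.slice t).K a j)
        - (2 * t⁻¹) • (∑ a, (gK q t i a * bigK q a j) • (u.slice t).ν)
  evol_K : ∀ t ∈ Ioc (0 : ℝ) 1, ∀ i j,
    dt (fun s => (u.slice s).K i j) t
      = -(t • ∑ a, gKinv q t i a • pD a (pD j (u.slice t).ν))
        - ((1 - lam⁻¹) * t⁻¹ * bigK q i j) • (u.slice t).ν
        + t • ricci q t (u.slice t) i j
  -- the wave equation
  wave : ∀ t ∈ Ioc (0 : ℝ) 1,
    -dt (fun s => s • (u.slice s).dtφ) t + t • lap q t (u.slice t).φ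
      = -(A • dt (fun s => (u.slice s).ν) t) + (A * (1 - lam⁻¹) * t⁻¹) • (u.slice t).ν

/-! ### Energies and norms

The Kasner metric is diagonal, so `|·|²` with respect to it is a weighted sum of the squares of the
components. -/

/-- `∫ |K|² dx`, the pointwise norm being that of the Kasner metric. -/
def KSq (q : Fin 3 → ℝ) (t : ℝ) (S : Slice) : ℝ≥0∞ :=
  ∑ a, ∑ b, ENNReal.ofReal (gK q t a a * gKinv q t b b) * l2sq (S.K a b)

/-- `∫ |t ∂g|² dx`, the pointwise norm being that of the Kasner metric. -/
def dgSq (q : Fin 3 → ℝ) (t : ℝ) (S : Slice) : ℝ≥0∞ :=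
  ∑ e, ∑ a, ∑ b, ENNReal.ofReal (gKinv q t e e * gKinv q t a a * gKinv q t b b)
    * l2sq (t • pD e (S.g a b))

/-- `∫ |t ∂f|² dx` for a scalar `f`, the pointwise norm being that of the Kasner metric. -/
def dScalarSq (q : Fin 3 → ℝ) (t : ℝ) (f : Distr) : ℝ≥0∞ :=
  ∑ a, ENNReal.ofReal (gKinv q t a a) * l2sq (t • pD a f)

/-- The squared metric energy. -/
def metricEnergySq (q : Fin 3 → ℝ) (t : ℝ) (S : Slice) : ℝ≥0∞ :=
  KSq q t S + ENNReal.ofReal (1 / 4) * dgSq q t S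

/-- The squared scalar field energy. -/
def scalarEnergySq (q : Fin 3 → ℝ) (t : ℝ) (S : Slice) : ℝ≥0∞ :=
  l2sq (t • S.dtφ) + dScalarSq q t S.φ

/-- The square of the almost total energy. -/
def almostTotalSq (θ : ℝ) (q : Fin 3 → ℝ) (t : ℝ) (S : Slice) : ℝ≥0∞ :=
  ENNReal.ofReal θ * metricEnergySq q t S + scalarEnergySq q t S + l2sq S.ν

/-- The square of the total energy. -/
def totalSq (θ : ℝ) (q : Fin 3 → ℝ) (t : ℝ) (S : Slice) : ℝ≥0∞ :=
  ENNReal.ofReal θ * metricEnergySq q t S + scalarEnergySq q t S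
    + dScalarSq q t S.ν + l2sq S.ν

/-- The almost total energy of the fields `u` at time `t`. -/
def almostTotalEnergy (θ : ℝ) (q : Fin 3 → ℝ) (u : Fields) (t : ℝ) : ℝ≥0∞ :=
  (almostTotalSq θ q t (u.slice t)) ^ (1 / 2 : ℝ)

/-- The total energy of order `M` of the fields `u` at time `t`. -/
def totalEnergy (θ : ℝ) (q : Fin 3 → ℝ) (M : ℕ) (u : Fields) (t : ℝ) : ℝ≥0∞ :=
  (∑ I ∈ multiIdx M, totalSq θ q t ((u.slice t).mD I)) ^ (1 / 2 : ℝ)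

/-- The solution norm of order `M` of the fields `u` at time `t`. -/
def solNorm (M : ℕ) (u : Fields) (t : ℝ) : ℝ≥0∞ :=
  sobFrame M (fun p : Fin 3 × Fin 3 => (u.slice t).K p.1 p.2)
    + sobFrame M (fun p : Fin 3 × Fin 3 × Fin 3 => pD p.1 ((u.slice t).g p.2.1 p.2.2))
    + sobFrame M (fun _ : Unit => t • (u.slice t).dtφ)
    + ENNReal.ofReal (t ^ (2 / 3 : ℝ)) * sobFrame M (fun a : Fin 3 => pD a (u.slice t).φ)
    + ∑ p ∈ Finset.range 2, ENNReal.ofReal (t ^ ((2 / 3 : ℝ) * p))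
        * sobFrame (M + p) (fun _ : Unit => (u.slice t).ν)

/-- The spacetime integral `∫_t^1 s⁻¹ F(s) ds`. -/
def timeInt (t : ℝ) (F : ℝ → ℝ≥0∞) : ℝ≥0∞ :=
  ∫⁻ s in Icc t 1, ENNReal.ofReal s⁻¹ * F s

end ParabolicKasner

end

open MeasureTheory Set
open scoped ENNReal ContDiff

noncomputable section

namespace ParabolicKasner

open UnitAddTorus
open scoped ComplexConjugate

/-! The coefficients of the system depend on `t` alone, so testing against `cos (2π k·x)` and `sin
(2π k·x)` turns a solution into one constrained ODE system per mode `(k, b)`. By Parseval every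
energy is a sum over modes of a function of the mode, and `∂_I` only inserts the weight `symb I k`.
It therefore suffices to estimate a single mode with constants independent of `k` and `lam`.
Summation and Tonelli then give the estimates for the fields, at every order at once.

For one mode, written in the orthonormal frame of the Kasner metric, time is measured by `t ∂_t`,
called the rate. A lower bound on the rate of an energy controls it from `t = 1` down towards the
singularity. In the rate of `|K|² + |ζ|²|H|²/4` the second-order terms cancel. What remains contains
`K` contracted with `ζ`, which the two momentum constraints turn into lapse and scalar field terms
plus errors of size `σ`. The growth of `|ζ|²` at rate about `4/3` supplies the coercive term.

The wave equation contains `∂_t ν`, so the natural variable is `P - A ν`. With the weight `(1 -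
lam⁻¹)/2 · lam⁻¹` on `ν²`, the dangerous products of `ν` and `P` cancel once the Hamiltonian
constraint has replaced the scalar curvature in the lapse equation. The remaining quadratic form in
`φ` and `ν` is positive because `A² ≤ 2/3` and `lam ≥ 3`. The metric energy enters with a weight
`theta` so small that its cross terms are absorbed. This is `rateMod_ge`: the modified energy is
coercive up to `σ` times the energy.

The weight on `ν²` degenerates as `lam → ∞`, so the modified energy does not control the lapse
uniformly. The lapse equation, which is parabolic towards the singularity, repairs this: `ν²` and
`|ζ|²ν²` are damped at rate `lam` towards a source bounded by the modified energy (`ν_sq_le`,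
`zz_ν_sq_le`). Grönwall's inequality then yields the growth `t^{-cσ}`.

The norms with flat components differ from the Kasner energies by factors `t^{-6σ}`, since all
exponents lie within `σ` of `1/3`. The resulting bound is `C t^{-cσ}` without loss at `σ = 0`, which
implies both forms asserted for the norms. -/

instance : IsProbabilityMeasure dx := by unfold dx; infer_instance

instance : Measure.IsAddHaarMeasure dx := by unfold dx; infer_instance

/-! ### Trigonometric test functions -/

/-- Smoothness of a test function is defined through its lift to `ℝ³`; the quotient property carries
continuity back to the torus. -/
theorem isOpenQuotientMap_cover : IsOpenQuotientMap cover := by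
  have : cover = Pi.map fun (_ : Fin 3) (x : ℝ) => (x : UnitAddCircle) := rfl
  rw [this]
  exact IsOpenQuotientMap.piMap fun _ => QuotientAddGroup.isOpenQuotientMap_mk

theorem TestFn.continuous (ψ : TestFn) : Continuous ψ.1 :=
  isOpenQuotientMap_cover.isQuotientMap.continuous_iff.2 ψ.2.continuous

theorem cover_add_single (x : Fin 3 → ℝ) (i : Fin 3) (s : ℝ) :
    cover x + Pi.single i (s : UnitAddCircle) = cover (x + s • Pi.single i (1 : ℝ)) := by
  funext j
  by_cases hj : j = i
  · subst hj
    simp [cover]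
  · simp [cover, hj]

theorem TestFn.hasDerivAt_translate (ψ : TestFn) (i : Fin 3) (x : T3) (s : ℝ) :
    HasDerivAt (fun r : ℝ => ψ.1 (x + Pi.single i (r : UnitAddCircle)))
      (coordDeriv i ψ.1 (x + Pi.single i (s : UnitAddCircle))) s := by
  obtain ⟨y, rfl⟩ := isOpenQuotientMap_cover.surjective x
  rw [cover_add_single, coordDeriv_cover]
  simp_rw [cover_add_single]
  have hd : HasFDerivAt (fun y => ψ.1 (cover y)) _ (y + s • Pi.single i (1 : ℝ)) :=
    ((ψ.2.differentiable (by simp)) _).hasFDerivAt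
  have hl : HasDerivAt (fun r : ℝ => y + r • Pi.single i (1 : ℝ)) (Pi.single i (1 : ℝ)) s := by
    simpa using ((hasDerivAt_id s).smul_const (Pi.single i (1 : ℝ) : Fin 3 → ℝ)).const_add y
  exact hd.comp_hasDerivAt s hl

theorem mFourier_cover (k : Fin 3 → ℤ) (x : Fin 3 → ℝ) :
    mFourier k (cover x) = ∏ i, Complex.exp (2 * Real.pi * Complex.I * k i * x i / (1 : ℝ)) := by
  simp only [mFourier, ContinuousMap.coe_mk, cover]
  exact Finset.prod_congr rfl fun i _ => fourier_coe_apply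

theorem contDiff_mFourier_cover (k : Fin 3 → ℤ) :
    ContDiff ℝ ∞ fun x => mFourier k (cover x) := by
  simp_rw [mFourier_cover]
  refine contDiff_prod fun i _ => ContDiff.cexp ?_
  refine ContDiff.div_const (ContDiff.mul contDiff_const ?_) _
  exact Complex.ofRealCLM.contDiff.comp (contDiff_apply ℝ ℝ i)

/-- The test functions `cos (2π k·x)` (for `true`) and `sin (2π k·x)` (for `false`). -/
def trig (k : Fin 3 → ℤ) : Bool → TestFn
  | true => ⟨fun x => (mFourier k x).re,
      Complex.reCLM.contDiff.comp (contDiff_mFourier_cover k)⟩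
  | false => ⟨fun x => (mFourier k x).im,
      Complex.imCLM.contDiff.comp (contDiff_mFourier_cover k)⟩

/-- A character turns a translation into multiplication by a scalar. Combined with invariance of the
measure, this gives both the derivatives of the modes and integration by parts. -/
theorem mFourier_add_single (k : Fin 3 → ℤ) (x : T3) (i : Fin 3) (s : ℝ) :
    mFourier k (x + Pi.single i (s : UnitAddCircle))
      = Complex.exp ((2 * Real.pi * k i * s : ℝ) * Complex.I) * mFourier k x := by
  have h1 : Complex.exp ((2 * Real.pi * k i * s : ℝ) * Complex.I)
      = ∏ j, if j = i then fourier (k i) (s : UnitAddCircle) else 1 := by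
    rw [Finset.prod_ite_eq' Finset.univ i]
    simp only [Finset.mem_univ, if_true]
    rw [fourier_coe_apply]
    congr 1
    push_cast
    ring
  rw [h1]
  simp only [mFourier, ContinuousMap.coe_mk]
  rw [← Finset.prod_mul_distrib]
  refine Finset.prod_congr rfl fun j _ => ?_
  by_cases hj : j = i
  · subst hj
    simp only [Pi.add_apply, Pi.single_eq_same, if_true]
    rw [add_comm, fourier_apply, fourier_apply, fourier_apply, smul_add, AddCircle.toCircle_add]
    simp
  · simp [hj]

/-- The coefficient `2π k_i` of the frequency `k`. -/
def freq (k : Fin 3 → ℤ) (i : Fin 3) : ℝ := 2 * Real.pi * k i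

theorem hasDerivAt_mFourier_translate (k : Fin 3 → ℤ) (x : T3) (i : Fin 3) :
    HasDerivAt (fun s : ℝ => mFourier k (x + Pi.single i (s : UnitAddCircle)))
      (freq k i * Complex.I * mFourier k x) 0 := by
  simp_rw [mFourier_add_single]
  have h : HasDerivAt (fun s : ℝ => ((2 * Real.pi * k i * s : ℝ) : ℂ) * Complex.I)
      ((freq k i : ℝ) * Complex.I) 0 := by
    refine HasDerivAt.mul_const ?_ _
    refine HasDerivAt.ofReal_comp ?_
    simpa [freq] using (hasDerivAt_id (0 : ℝ)).const_mul (2 * Real.pi * k i)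
  simpa using (h.cexp).mul_const (mFourier k x)

theorem coordDeriv_cos (k : Fin 3 → ℤ) (i : Fin 3) (x : T3) :
    coordDeriv i (trig k true).1 x = -freq k i * (trig k false).1 x := by
  have h := (Complex.reCLM.hasFDerivAt.comp_hasDerivAt 0 (hasDerivAt_mFourier_translate k x i)).deriv
  refine h.trans ?_
  simp [trig]

theorem coordDeriv_sin (k : Fin 3 → ℤ) (i : Fin 3) (x : T3) :
    coordDeriv i (trig k false).1 x = freq k i * (trig k true).1 x := by
  have h := (Complex.imCLM.hasFDerivAt.comp_hasDerivAt 0 (hasDerivAt_mFourier_translate k x i)).deriv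
  refine h.trans ?_
  simp [trig]

/-- Integration by parts against `exp (2πi k·x)`. -/
theorem integral_partialD_mul_mFourier (ψ : TestFn) (i : Fin 3) (k : Fin 3 → ℤ) :
    ∫ x, ((ψ.partialD i).1 x : ℂ) * mFourier k x ∂dx
      = -(freq k i * Complex.I) * ∫ x, (ψ.1 x : ℂ) * mFourier k x ∂dx := by
  set e : ℝ → T3 := fun s => Pi.single i (s : UnitAddCircle) with he
  have hψ : Continuous ψ.1 := ψ.continuous
  have hψ' : Continuous (ψ.partialD i).1 := (ψ.partialD i).continuous
  obtain ⟨B, hB⟩ := (isCompact_range hψ').isBounded.exists_norm_le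
  have hm : Continuous (fun x : T3 => mFourier k x) := (mFourier k).continuous
  have hd : HasDerivAt (fun s : ℝ => ∫ x, (ψ.1 (x + e s) : ℂ) * mFourier k x ∂dx)
      (∫ x, ((ψ.partialD i).1 (x + e 0) : ℂ) * mFourier k x ∂dx) 0 := by
    refine (hasDerivAt_integral_of_dominated_loc_of_deriv_le (bound := fun _ => B)
      (F' := fun s x => ((ψ.partialD i).1 (x + e s) : ℂ) * mFourier k x)
      (s := univ) Filter.univ_mem ?_ ?_ ?_ ?_ ?_ ?_).2
    · refine Filter.Eventually.of_forall fun s => ?_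
      exact (Continuous.mul (Complex.continuous_ofReal.comp
        (hψ.comp (continuous_add_const _))) hm).aestronglyMeasurable
    · exact (Continuous.mul (Complex.continuous_ofReal.comp
        (hψ.comp (continuous_add_const _))) hm).integrable_of_hasCompactSupport
        (HasCompactSupport.of_compactSpace _)
    · exact (Continuous.mul (Complex.continuous_ofReal.comp
        (hψ'.comp (continuous_add_const _))) hm).aestronglyMeasurable
    · refine Filter.Eventually.of_forall fun x s _ => ?_
      rw [norm_mul, Complex.norm_real]
      have h1 : ‖mFourier k x‖ ≤ 1 := by
        simpa [mFourier_norm] using (mFourier k).norm_coe_le_norm x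
      have h2 := hB _ (mem_range_self (x + e s))
      calc _ ≤ B * 1 := mul_le_mul h2 h1 (norm_nonneg _) ((norm_nonneg _).trans h2)
        _ = B := mul_one B
    · exact integrable_const _
    · refine Filter.Eventually.of_forall fun x s _ => ?_
      exact (ψ.hasDerivAt_translate i x s).ofReal_comp.mul_const _
  -- By translation invariance the shift moves from `ψ` to the character. The same function of `s`
  -- is thus differentiated in two ways.
  have hs : (fun s : ℝ => ∫ x, (ψ.1 (x + e s) : ℂ) * mFourier k x ∂dx)
      = fun s : ℝ => Complex.exp ((2 * Real.pi * k i * (-s) : ℝ) * Complex.I)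
          * ∫ x, (ψ.1 x : ℂ) * mFourier k x ∂dx := by
    funext s
    have h1 := integral_add_right_eq_self (μ := dx)
      (fun x => (ψ.1 x : ℂ) * mFourier k (x + e (-s))) (e s)
    have h2 : ∀ x : T3, x + e s + e (-s) = x := by
      intro x
      have : e s + e (-s) = 0 := by
        simp only [he]
        rw [← Pi.single_add, ← AddCircle.coe_add]
        simp
      rw [add_assoc, this, add_zero]
    simp_rw [h2] at h1
    rw [h1, ← integral_const_mul]
    congr 1
    funext x
    simp only [he]
    rw [mFourier_add_single]
    ring
  rw [hs] at hd
  have hd2 : HasDerivAt (fun s : ℝ => Complex.exp ((2 * Real.pi * k i * (-s) : ℝ) * Complex.I)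
          * ∫ x, (ψ.1 x : ℂ) * mFourier k x ∂dx)
        (-(freq k i * Complex.I) * ∫ x, (ψ.1 x : ℂ) * mFourier k x ∂dx) 0 := by
    have h : HasDerivAt (fun s : ℝ => ((2 * Real.pi * k i * (-s) : ℝ) : ℂ) * Complex.I)
        (((-freq k i : ℝ) : ℂ) * Complex.I) 0 := by
      refine HasDerivAt.mul_const ?_ _
      refine HasDerivAt.ofReal_comp ?_
      simpa [freq] using ((hasDerivAt_id (0 : ℝ)).neg).const_mul (2 * Real.pi * k i)
    simpa using (h.cexp).mul_const (∫ x, (ψ.1 x : ℂ) * mFourier k x ∂dx)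
  have := hd.unique hd2
  simpa [he] using this

theorem integrable_mul_mFourier {f : T3 → ℝ} (hf : Integrable f dx) (k : Fin 3 → ℤ) :
    Integrable (fun x => (f x : ℂ) * mFourier k x) dx := by
  refine hf.ofReal.mul_bdd (c := 1) (mFourier k).continuous.aestronglyMeasurable ?_
  refine Filter.Eventually.of_forall fun x => ?_
  simpa [mFourier_norm] using (mFourier k).norm_coe_le_norm x

theorem integral_mul_mFourier {f : T3 → ℝ} (hf : Integrable f dx) (k : Fin 3 → ℤ) :
    ∫ x, (f x : ℂ) * mFourier k x ∂dx
      = (ofFun f (trig k true) : ℂ) + (ofFun f (trig k false) : ℂ) * Complex.I := by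
  have h := integrable_mul_mFourier hf k
  apply Complex.ext
  · have := integral_re h
    simp only [RCLike.re_to_complex] at this
    rw [← this]
    simp [ofFun, trig]
  · have := integral_im h
    simp only [RCLike.im_to_complex] at this
    rw [← this]
    simp [ofFun, trig]

theorem TestFn.integrable (ψ : TestFn) : Integrable ψ.1 dx :=
  ψ.continuous.integrable_of_hasCompactSupport (HasCompactSupport.of_compactSpace _)

theorem ofFun_partialD_cos (ψ : TestFn) (i : Fin 3) (k : Fin 3 → ℤ) :
    ofFun (ψ.partialD i).1 (trig k true) = freq k i * ofFun ψ.1 (trig k false) := by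
  have h := integral_partialD_mul_mFourier ψ i k
  rw [integral_mul_mFourier (TestFn.integrable _), integral_mul_mFourier (TestFn.integrable _)] at h
  simpa using congrArg Complex.re h

theorem ofFun_partialD_sin (ψ : TestFn) (i : Fin 3) (k : Fin 3 → ℤ) :
    ofFun (ψ.partialD i).1 (trig k false) = -freq k i * ofFun ψ.1 (trig k true) := by
  have h := integral_partialD_mul_mFourier ψ i k
  rw [integral_mul_mFourier (TestFn.integrable _), integral_mul_mFourier (TestFn.integrable _)] at h
  simpa using congrArg Complex.im h

/-! ### Parseval's identity -/

/-- The coefficient pairs `f` with the conjugate character, hence the minus sign; `f` is real, so it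
is the conjugate of the pairing with `mFourier k`. -/
theorem mFourierCoeff_eq_trig {f : T3 → ℝ} (F : T3 → ℂ)
    (h : F =ᵐ[dx] fun x => (f x : ℂ)) (hf : Integrable f dx) (k : Fin 3 → ℤ) :
    mFourierCoeff F k
      = (ofFun f (trig k true) : ℂ) - (ofFun f (trig k false) : ℂ) * Complex.I := by
  have h1 : mFourierCoeff F k = ∫ x, conj ((f x : ℂ) * mFourier k x) ∂dx := by
    refine integral_congr_ae (h.mono fun x hx => ?_)
    simp only [hx, mFourier_neg, smul_eq_mul, map_mul, Complex.conj_ofReal]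
    ring
  rw [h1, integral_conj, integral_mul_mFourier hf]
  simp [sub_eq_add_neg]

theorem hasSum_conj_mFourierCoeff_mul (F G : Lp ℂ 2 dx) :
    HasSum (fun k => conj (mFourierCoeff F k) * mFourierCoeff G k)
      (∫ x, conj (F x) * G x ∂dx) :=
  hasSum_prod_mFourierCoeff (d := Fin 3) F G

/-- The Riesz–Fischer theorem: surjectivity of the Fourier isometry onto `ℓ²`. -/
theorem exists_mFourierCoeff_eq (c : (Fin 3 → ℤ) → ℂ) (hc : Summable fun k => ‖c k‖ ^ 2) :
    ∃ F : Lp ℂ 2 dx, ∀ k, mFourierCoeff F k = c k := by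
  have hm : Memℓp c 2 := by
    refine memℓp_gen ?_
    simpa using hc
  let v : lp (fun _ : Fin 3 → ℤ => ℂ) 2 := ⟨c, hm⟩
  refine ⟨(mFourierBasis (d := Fin 3)).repr.symm v, fun k => ?_⟩
  have h := mFourierBasis_repr (d := Fin 3) ((mFourierBasis (d := Fin 3)).repr.symm v) k
  rw [LinearIsometryEquiv.apply_symm_apply] at h
  exact h.symm

theorem memLp_integrable {f : T3 → ℝ} (hf : MemLp f 2 dx) : Integrable f dx :=
  hf.integrable (by norm_num)

theorem exists_Lp_eq_ofReal {f : T3 → ℝ} (hf : MemLp f 2 dx) :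
    ∃ F : Lp ℂ 2 dx, F =ᵐ[dx] fun x => (f x : ℂ) :=
  ⟨MemLp.toLp _ (hf.ofReal (K := ℂ)), MemLp.coeFn_toLp _⟩

/-- Parseval's identity in real form. -/
theorem hasSum_ofFun_trig_mul {f g : T3 → ℝ} (hf : MemLp f 2 dx) (hg : MemLp g 2 dx) :
    HasSum (fun k => ∑ b, ofFun f (trig k b) * ofFun g (trig k b)) (∫ x, f x * g x ∂dx) := by
  obtain ⟨F, hF⟩ := exists_Lp_eq_ofReal hf
  obtain ⟨G, hG⟩ := exists_Lp_eq_ofReal hg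
  have h := hasSum_conj_mFourierCoeff_mul F G
  have h2 : ∫ x, conj (F x) * G x ∂dx
      = ((∫ x, f x * g x ∂dx : ℝ) : ℂ) := by
    rw [← integral_complex_ofReal]
    refine integral_congr_ae ?_
    filter_upwards [hF, hG] with x hx hy
    simp [hx, hy]
  rw [h2] at h
  have h3 := RCLike.hasSum_re ℂ h
  simp only [RCLike.re_to_complex, Complex.ofReal_re] at h3
  refine h3.congr_fun fun k => ?_
  rw [mFourierCoeff_eq_trig _ hF (memLp_integrable hf),
    mFourierCoeff_eq_trig _ hG (memLp_integrable hg)]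
  simp

theorem TestFn.memLp (ψ : TestFn) : MemLp ψ.1 2 dx := by
  obtain ⟨B, hB⟩ := (isCompact_range ψ.continuous).isBounded.exists_norm_le
  exact MemLp.of_bound ψ.continuous.aestronglyMeasurable B
    (Filter.Eventually.of_forall fun x => hB _ (mem_range_self x))

/-! ### Functionals that are given by their Fourier coefficients -/

/-- The functional `T` is the sum of its Fourier series on every test function. -/
def IsFourierSum (T : Distr) : Prop :=
  ∀ ψ, HasSum (fun k => ∑ b, T (trig k b) * ofFun ψ.1 (trig k b)) (T ψ)

theorem IsFourierSum.ofFun {f : T3 → ℝ} (hf : MemLp f 2 dx) : IsFourierSum (ofFun f) :=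
  fun ψ => hasSum_ofFun_trig_mul hf ψ.memLp

/-- A `Distr` is an arbitrary functional, not assumed linear. Homogeneity is recovered from the
series, whose terms depend linearly on the test function; this is what evaluates derivatives on the
modes. -/
theorem IsFourierSum.apply_of_smul {T : Distr} (hT : IsFourierSum T) {ψ χ : TestFn} {c : ℝ}
    (h : ∀ x, ψ.1 x = c * χ.1 x) : T ψ = c * T χ := by
  refine (hT ψ).unique (((hT χ).mul_left c).congr_fun fun k => ?_)
  rw [Finset.mul_sum]
  refine Finset.sum_congr rfl fun b _ => ?_
  have : ParabolicKasner.ofFun ψ.1 (trig k b) = c * ParabolicKasner.ofFun χ.1 (trig k b) := by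
    simp only [ParabolicKasner.ofFun, ← integral_const_mul, h, mul_assoc]
  rw [this]
  ring

theorem IsFourierSum.pD_cos {T : Distr} (hT : IsFourierSum T) (i : Fin 3) (k : Fin 3 → ℤ) :
    pD i T (trig k true) = freq k i * T (trig k false) := by
  have : T ((trig k true).partialD i) = -freq k i * T (trig k false) :=
    hT.apply_of_smul fun x => coordDeriv_cos k i x
  simp [pD, this]

theorem IsFourierSum.pD_sin {T : Distr} (hT : IsFourierSum T) (i : Fin 3) (k : Fin 3 → ℤ) :
    pD i T (trig k false) = -(freq k i * T (trig k true)) := by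
  have : T ((trig k false).partialD i) = freq k i * T (trig k true) :=
    hT.apply_of_smul fun x => coordDeriv_sin k i x
  simp [pD, this]

/-- Moving the derivative onto `ψ` or onto the modes exchanges sine and cosine with the same signs,
so the series for `ψ.partialD i` rearranges within each frequency. -/
theorem IsFourierSum.pD {T : Distr} (hT : IsFourierSum T) (i : Fin 3) : IsFourierSum (pD i T) := by
  intro ψ
  have h := (hT (ψ.partialD i)).neg
  refine h.congr_fun fun k => ?_
  simp only [Fintype.sum_bool, hT.pD_cos, hT.pD_sin, ofFun_partialD_cos, ofFun_partialD_sin]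
  ring

theorem IsFourierSum.smul {T : Distr} (hT : IsFourierSum T) (c : ℝ) : IsFourierSum (c • T) := by
  intro ψ
  refine ((hT ψ).mul_left c).congr_fun fun k => ?_
  simp only [Fintype.sum_bool, Pi.smul_apply, smul_eq_mul]
  ring

/-- Two derivatives act on a Fourier mode as multiplication by `-ξ_i ξ_j`. -/
theorem IsFourierSum.pD_pD_trig {T : Distr} (hT : IsFourierSum T) (i j : Fin 3) (k : Fin 3 → ℤ)
    (b : Bool) : ParabolicKasner.pD i (ParabolicKasner.pD j T) (trig k b)
      = -(freq k i * freq k j * T (trig k b)) := by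
  cases b
  · rw [(hT.pD j).pD_sin, hT.pD_cos]
    ring
  · rw [(hT.pD j).pD_cos, hT.pD_sin]
    ring

/-- The square of the `k`-th Fourier coefficient. -/
def mass (T : Distr) (k : Fin 3 → ℤ) : ℝ := ∑ b, T (trig k b) ^ 2

theorem mass_nonneg (T : Distr) (k : Fin 3 → ℤ) : 0 ≤ mass T k :=
  Finset.sum_nonneg fun _ _ => sq_nonneg _

theorem mass_smul (c : ℝ) (T : Distr) (k : Fin 3 → ℤ) : mass (c • T) k = c ^ 2 * mass T k := by
  simp only [mass, Pi.smul_apply, smul_eq_mul, mul_pow, Finset.mul_sum]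

theorem IsFourierSum.mass_pD {T : Distr} (hT : IsFourierSum T) (i : Fin 3) (k : Fin 3 → ℤ) :
    mass (ParabolicKasner.pD i T) k = freq k i ^ 2 * mass T k := by
  simp only [mass, Fintype.sum_bool, hT.pD_cos, hT.pD_sin]
  ring

theorem lintegral_sq_eq_tsum_mass {f : T3 → ℝ} (hf : MemLp f 2 dx) :
    ∫⁻ x, ENNReal.ofReal (f x ^ 2) ∂dx = ∑' k, ENNReal.ofReal (mass (ofFun f) k) := by
  have h := hasSum_ofFun_trig_mul hf hf
  simp_rw [← sq] at h
  change HasSum (mass (ofFun f)) _ at h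
  rw [← ofReal_integral_eq_lintegral_ofReal hf.integrable_sq
    (Filter.Eventually.of_forall fun x => sq_nonneg _), ← h.tsum_eq,
    ENNReal.ofReal_tsum_of_nonneg (fun k => mass_nonneg _ k) h.summable]

/-- Riesz–Fischer supplies a complex `L²` function with the coefficients of `T`. It need not be
known to be real: a real test function pairs with its real part to give the real part of the
pairing, and that series is the one defining `T ψ`. -/
theorem IsFourierSum.exists_ofFun {T : Distr} (hT : IsFourierSum T)
    (h : ∑' k, ENNReal.ofReal (mass T k) ≠ ⊤) :
    ∃ f : T3 → ℝ, MemLp f 2 dx ∧ T = ParabolicKasner.ofFun f := by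
  have hs : Summable (mass T) := by
    have := ENNReal.summable_toReal h
    refine this.congr fun k => ENNReal.toReal_ofReal (mass_nonneg T k)
  obtain ⟨F, hF⟩ := exists_mFourierCoeff_eq
    (fun k => (T (trig k true) : ℂ) - (T (trig k false) : ℂ) * Complex.I) (by
      refine hs.congr fun k => ?_
      rw [← Complex.normSq_eq_norm_sq, Complex.normSq_apply]
      simp [mass]
      ring)
  have hFm : MemLp F 2 dx := Lp.memLp F
  refine ⟨fun x => (F x).re, hFm.re, ?_⟩
  funext ψ
  obtain ⟨G, hG⟩ := exists_Lp_eq_ofReal ψ.memLp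
  have h1 := RCLike.hasSum_re ℂ (hasSum_conj_mFourierCoeff_mul F G)
  have h2 : ∫ x, conj (F x) * G x ∂dx
      = ∫ x, conj (F x) * (ψ.1 x : ℂ) ∂dx :=
    integral_congr_ae (hG.mono fun x hx => by simp [hx])
  have hi : Integrable (fun x => conj (F x) * (ψ.1 x : ℂ)) dx := by
    refine MemLp.integrable_mul (p := 2) (q := 2) ?_ (ψ.memLp.ofReal (K := ℂ))
    exact hFm.star
  rw [h2, ← integral_re hi] at h1
  refine (hT ψ).unique ?_
  have h3 : ParabolicKasner.ofFun (fun x => (F x).re) ψ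
      = ∫ x, RCLike.re (conj (F x) * (ψ.1 x : ℂ)) ∂dx := by
    simp [ParabolicKasner.ofFun]
  rw [h3]
  refine h1.congr_fun fun k => ?_
  rw [hF, mFourierCoeff_eq_trig _ hG (memLp_integrable ψ.memLp)]
  simp

/-- This is valid in `[0,∞]`: a divergent sum of masses means exactly that no `L²` representative
exists. All norms thereby become sums of nonnegative terms, with no separate regularity argument. -/
theorem IsFourierSum.l2sq_eq {T : Distr} (hT : IsFourierSum T) :
    l2sq T = ∑' k, ENNReal.ofReal (mass T k) := by
  refine le_antisymm ?_ ?_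
  · by_cases h : ∑' k, ENNReal.ofReal (mass T k) = ⊤
    · rw [h]; exact le_top
    · obtain ⟨f, hf, rfl⟩ := hT.exists_ofFun h
      rw [← lintegral_sq_eq_tsum_mass hf]
      exact iInf₂_le f ⟨hf, rfl⟩
  · refine le_iInf₂ fun f hf => ?_
    rw [lintegral_sq_eq_tsum_mass hf.1, hf.2]

/-- The symbol `∏ ξ_i^{2 I_i}` of `∂_I` on the level of squares. -/
def symb (I : Fin 3 → ℕ) (k : Fin 3 → ℤ) : ℝ := ∏ i, (freq k i ^ 2) ^ I i

theorem symb_nonneg (I : Fin 3 → ℕ) (k : Fin 3 → ℤ) : 0 ≤ symb I k :=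
  Finset.prod_nonneg fun _ _ => pow_nonneg (sq_nonneg _) _

theorem IsFourierSum.iterate_pD {T : Distr} (hT : IsFourierSum T) (i : Fin 3) (n : ℕ) :
    IsFourierSum ((ParabolicKasner.pD i)^[n] T)
      ∧ ∀ k, mass ((ParabolicKasner.pD i)^[n] T) k = (freq k i ^ 2) ^ n * mass T k := by
  induction n with
  | zero => exact ⟨hT, fun k => by simp⟩
  | succ n ih =>
    rw [Function.iterate_succ_apply']
    refine ⟨ih.1.pD i, fun k => ?_⟩
    rw [ih.1.mass_pD, ih.2]
    ring

theorem IsFourierSum.mD {T : Distr} (hT : IsFourierSum T) (I : Fin 3 → ℕ) :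
    IsFourierSum (mD I T) :=
  ((((hT.iterate_pD 2 _).1).iterate_pD 1 _).1.iterate_pD 0 _).1

theorem IsFourierSum.mass_mD {T : Distr} (hT : IsFourierSum T) (I : Fin 3 → ℕ) (k : Fin 3 → ℤ) :
    mass (ParabolicKasner.mD I T) k = symb I k * mass T k := by
  unfold ParabolicKasner.mD
  have h2 := hT.iterate_pD 2 (I 2)
  have h1 := h2.1.iterate_pD 1 (I 1)
  have h0 := h1.1.iterate_pD 0 (I 0)
  rw [h0.2, h1.2, h2.2, symb, Fin.prod_univ_three]
  ring

/-! ### A single Fourier mode in the orthonormal frame -/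

/-- The values of one Fourier mode at one time, in the orthonormal frame of the Kasner metric:
the rescaled frequency `ζ`, the metric perturbation `H`, the second fundamental form `K`, the scalar
field `φ`, its derivative `P = t ∂_t φ`, and the lapse `ν`. -/
structure Frame where
  ζ : Fin 3 → ℝ
  H : Fin 3 → Fin 3 → ℝ
  K : Fin 3 → Fin 3 → ℝ
  φ : ℝ
  P : ℝ
  ν : ℝ

namespace Frame

/-- `|ζ|²`. -/
def zz (x : Frame) : ℝ := ∑ e, x.ζ e ^ 2

/-- `|H|²`. -/
def hh (x : Frame) : ℝ := ∑ i, ∑ j, x.H i j ^ 2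

/-- `|K|²`. -/
def kk (x : Frame) : ℝ := ∑ i, ∑ j, x.K i j ^ 2

/-- The contracted Christoffel symbol. -/
def γ (x : Frame) (i : Fin 3) : ℝ := ∑ e, x.H i e * x.ζ e - 1 / 2 * x.ζ i * ∑ a, x.H a a

/-- The scalar curvature. -/
def scal (x : Frame) : ℝ := x.zz * ∑ a, x.H a a - ∑ a, ∑ b, x.ζ a * x.H a b * x.ζ b

/-- The rate `t ∂_t H`. -/
def rateH (q : Fin 3 → ℝ) (x : Frame) (i j : Fin 3) : ℝ :=
  (q j - q i) * x.H i j - 2 * x.K i j + 2 * (if i = j then q j * x.ν else 0)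

/-- The rate `t ∂_t K`. -/
def rateK (lam : ℝ) (q : Fin 3 → ℝ) (x : Frame) (i j : Fin 3) : ℝ :=
  (q i - q j) * x.K i j + x.ζ i * x.ζ j * x.ν + (1 - lam⁻¹) * (if i = j then q i * x.ν else 0)
    + 1 / 2 * (x.zz * x.H i j - x.ζ i * x.γ j - x.ζ j * x.γ i)

/-- The rate of `|ζ|²`. -/
def rateZ (q : Fin 3 → ℝ) (x : Frame) : ℝ := ∑ e, 2 * (1 - q e) * x.ζ e ^ 2

/-- The rate of the metric energy `|K|² + |ζ|²|H|²/4`. -/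
def rateMetric (lam : ℝ) (q : Fin 3 → ℝ) (x : Frame) : ℝ :=
  (∑ i, ∑ j, 2 * x.K i j * x.rateK lam q i j)
    + 1 / 4 * (x.rateZ q * x.hh + x.zz * ∑ i, ∑ j, 2 * x.H i j * x.rateH q i j)

/-- The constraint equations. -/
structure Constraints (lam κ A : ℝ) (q : Fin 3 → ℝ) (x : Frame) : Prop where
  symm : ∀ i j, x.H i j = x.H j i
  gauge : ∑ a, x.K a a = lam⁻¹ * x.ν
  hamiltonian : x.scal - 2 * (∑ a, (1 / 3 - q a) * x.K a a) - 2 * A * x.P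
    + 2 * (A ^ 2 - κ * lam⁻¹) * x.ν = 0
  momentum : ∀ i, ∑ a, x.ζ a * x.K a i
    = x.ζ i * (lam⁻¹ * x.ν - A * x.φ) + 1 / 2 * x.ζ i * ∑ a, (q i - q a) * x.H a a
  momentum' : ∀ i, ∑ a, x.K i a * x.ζ a
    = x.ζ i * (lam⁻¹ * x.ν - A * x.φ)
      + 1 / 2 * ∑ a, (q a - q i) * (2 * x.ζ a * x.H a i - x.ζ i * x.H a a)

theorem zz_nonneg (x : Frame) : 0 ≤ x.zz := Finset.sum_nonneg fun _ _ => sq_nonneg _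

theorem hh_nonneg (x : Frame) : 0 ≤ x.hh :=
  Finset.sum_nonneg fun _ _ => Finset.sum_nonneg fun _ _ => sq_nonneg _

theorem kk_nonneg (x : Frame) : 0 ≤ x.kk :=
  Finset.sum_nonneg fun _ _ => Finset.sum_nonneg fun _ _ => sq_nonneg _

theorem abs_ζ_le (x : Frame) (i : Fin 3) : |x.ζ i| ≤ √x.zz :=
  Real.abs_le_sqrt (Finset.single_le_sum (f := fun e => x.ζ e ^ 2)
    (fun _ _ => sq_nonneg _) (Finset.mem_univ i))

theorem sq_le_double_sum (f : Fin 3 → Fin 3 → ℝ) (i j : Fin 3) :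
    f i j ^ 2 ≤ ∑ i, ∑ j, f i j ^ 2 :=
  (Finset.single_le_sum (f := fun j => f i j ^ 2) (fun _ _ => sq_nonneg _)
    (Finset.mem_univ j)).trans
    (Finset.single_le_sum (f := fun i => ∑ j, f i j ^ 2)
      (fun _ _ => Finset.sum_nonneg fun _ _ => sq_nonneg _) (Finset.mem_univ i))

theorem abs_H_le (x : Frame) (i j : Fin 3) : |x.H i j| ≤ √x.hh :=
  Real.abs_le_sqrt (sq_le_double_sum x.H i j)

theorem abs_K_le (x : Frame) (i j : Fin 3) : |x.K i j| ≤ √x.kk :=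
  Real.abs_le_sqrt (sq_le_double_sum x.K i j)

theorem abs_sum_three_le {f : Fin 3 → ℝ} {B : ℝ} (h : ∀ i, |f i| ≤ B) : |∑ i, f i| ≤ 3 * B := by
  refine (Finset.abs_sum_le_sum_abs _ _).trans ?_
  refine (Finset.sum_le_card_nsmul _ _ B fun i _ => h i).trans (by simp)

theorem abs_γ_le (x : Frame) (i : Fin 3) : |x.γ i| ≤ 5 * (√x.hh * √x.zz) := by
  have h1 : |∑ e, x.H i e * x.ζ e| ≤ 3 * (√x.hh * √x.zz) := abs_sum_three_le fun e => by
    rw [abs_mul]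
    exact mul_le_mul (x.abs_H_le _ _) (x.abs_ζ_le _) (abs_nonneg _) (Real.sqrt_nonneg _)
  have h2 : |∑ a, x.H a a| ≤ 3 * √x.hh := abs_sum_three_le fun a => x.abs_H_le _ _
  have h3 : |1 / 2 * x.ζ i * ∑ a, x.H a a| ≤ 1 / 2 * √x.zz * (3 * √x.hh) := by
    rw [abs_mul, abs_mul, abs_of_pos (by norm_num : (0 : ℝ) < 1 / 2)]
    have := x.abs_ζ_le i
    gcongr
  have h4 := abs_sub (∑ e, x.H i e * x.ζ e) (1 / 2 * x.ζ i * ∑ a, x.H a a)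
  have : 0 ≤ √x.hh * √x.zz := by positivity
  unfold γ
  nlinarith

/-- The rate of the metric energy, after the second-order terms have been cancelled. -/
theorem rateMetric_eq {lam : ℝ} {q : Fin 3 → ℝ} {x : Frame} (hs : ∀ i j, x.H i j = x.H j i) :
    x.rateMetric lam q = 2 * (∑ i, ∑ j, (q i - q j) * x.K i j ^ 2)
      + 2 * x.ν * (∑ i, x.ζ i * ∑ a, x.ζ a * x.K a i)
      + 2 * (1 - lam⁻¹) * x.ν * (∑ i, q i * x.K i i)
      - (∑ i, x.γ i * ((∑ a, x.K i a * x.ζ a) + ∑ a, x.ζ a * x.K a i))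
      + 1 / 4 * x.rateZ q * x.hh + x.ν * x.zz * ∑ i, q i * x.H i i := by
  have h10 := hs 1 0
  have h20 := hs 2 0
  have h21 := hs 2 1
  have hne : (0 : Fin 3) ≠ 1 ∧ (0 : Fin 3) ≠ 2 ∧ (1 : Fin 3) ≠ 2 ∧ (1 : Fin 3) ≠ 0
    ∧ (2 : Fin 3) ≠ 0 ∧ (2 : Fin 3) ≠ 1 := by decide
  obtain ⟨a1, a2, a3, a4, a5, a6⟩ := hne
  simp only [rateMetric, rateK, rateH, Fin.sum_univ_three, if_neg a1, if_neg a2, if_neg a3,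
    if_neg a4, if_neg a5, if_neg a6, if_true]
  generalize x.γ 0 = g0, x.γ 1 = g1, x.γ 2 = g2, x.zz = Z, x.hh = hh, x.rateZ q = rz
  rw [h10, h20, h21]
  ring

variable {lam κ A σ : ℝ} {q : Fin 3 → ℝ} {x : Frame}

theorem abs_sub_le_two_mul (hq : ∀ i, |q i - 1 / 3| ≤ σ) (i j : Fin 3) : |q i - q j| ≤ 2 * σ := by
  have h1 := abs_le.1 (hq i)
  have h2 := abs_le.1 (hq j)
  rw [abs_le]
  constructor <;> linarith

/-- The source of decay for the gradient terms of `H` and `φ`: each `|ζ_e|²` has rate `2(1 - q_e)`,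
which is near `4/3`. -/
theorem rateZ_ge (hq : ∀ i, |q i - 1 / 3| ≤ σ) : (4 / 3 - 2 * σ) * x.zz ≤ x.rateZ q := by
  unfold zz rateZ
  rw [Finset.mul_sum]
  refine Finset.sum_le_sum fun e _ => ?_
  have h1 := (abs_le.1 (hq e)).2
  exact mul_le_mul_of_nonneg_right (by linarith) (sq_nonneg _)

theorem abs_sum_mul_diag_le (hq : ∀ i, |q i - 1 / 3| ≤ σ) (hσ : 0 ≤ σ) :
    |∑ a, (q a - 1 / 3) * x.K a a| ≤ 3 * (σ * √x.kk) :=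
  abs_sum_three_le fun a => by
    rw [abs_mul]
    exact mul_le_mul (hq a) (x.abs_K_le _ _) (abs_nonneg _) hσ

/-- Young's inequality with `z = |ζ|`, `η = |H|`, `u = |ν|`, `v = |φ|`. The gap between `1/3` and
`1/4` in front of `z²η²` pays for the cross terms, at the price of the large constant in front of
`u² + v²`. -/
theorem absorb_cross_terms {σ z η u v : ℝ} (hσ0 : 0 ≤ σ) (hσ : σ ≤ 1 / 10000)
    (hη : 0 ≤ η) (hu : 0 ≤ u) (hv : 0 ≤ v) :
    1 / 4 * (z ^ 2 * η ^ 2) - 10000 * (z ^ 2 * (u ^ 2 + v ^ 2)) - 7 * σ * u ^ 2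
      ≤ -(2 * (z ^ 2 * (u * v))) - 18 * σ * (z ^ 2 * (u * η)) - 3 * σ * u ^ 2
        - 30 * (z ^ 2 * (η * (u + v))) - 180 * σ * (z ^ 2 * η ^ 2)
        + (1 / 3 - 1 / 2 * σ) * (z ^ 2 * η ^ 2) - z ^ 2 * (η * u) := by
  -- The products in these squares have coefficient `2·95·16/95 = 32`, enough for the cross terms
  -- `31 ηu` and `30 ηv` with a small `σ` correction. The square `95² = 9025` stays below `10000`,
  -- and `2·(16/95)² < 0.06` fits in the gap.
  have s1 : 0 ≤ z ^ 2 * (95 * u - 16 / 95 * η) ^ 2 := by positivity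
  have s2 : 0 ≤ z ^ 2 * (95 * v - 16 / 95 * η) ^ 2 := by positivity
  have s3 : 0 ≤ z ^ 2 * (u - v) ^ 2 := by positivity
  have s4 : σ * (z ^ 2 * η ^ 2) ≤ 1 / 10000 * (z ^ 2 * η ^ 2) :=
    mul_le_mul_of_nonneg_right hσ (by positivity)
  have s5 : σ * (z ^ 2 * (u * η)) ≤ 1 / 10000 * (z ^ 2 * (u * η)) :=
    mul_le_mul_of_nonneg_right hσ (by positivity)
  have s6 : 0 ≤ σ * u ^ 2 := by positivity
  have s7 : 0 ≤ z ^ 2 * u ^ 2 := by positivity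
  have s8 : 0 ≤ z ^ 2 * v ^ 2 := by positivity
  have s9 : 0 ≤ z ^ 2 * η ^ 2 := by positivity
  have s10 : 0 ≤ z ^ 2 * (u * η) := by positivity
  have s11 : 0 ≤ z ^ 2 * (v * η) := by positivity
  linarith

/-- The metric energy estimate for a single mode. -/
theorem rateMetric_ge (hx : x.Constraints lam κ A q) (hlam : 3 ≤ lam) (hA0 : 0 ≤ A) (hA1 : A ≤ 1)
    (hq : ∀ i, |q i - 1 / 3| ≤ σ) (hq0 : ∀ i, 0 < q i) (hqs : ∑ i, q i = 1)
    (hσ : σ ≤ 1 / 10000) :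
    1 / 4 * (x.zz * x.hh) - 10000 * (x.zz * (x.ν ^ 2 + x.φ ^ 2)) - 7 * σ * (x.kk + x.ν ^ 2)
      ≤ x.rateMetric lam q := by
  have hσ0 : 0 ≤ σ := (abs_nonneg _).trans (hq 0)
  set z := √x.zz with hz
  set η := √x.hh with hη
  have hz0 : 0 ≤ z := Real.sqrt_nonneg _
  have hη0 : 0 ≤ η := Real.sqrt_nonneg _
  have hzz : x.zz = z ^ 2 := (Real.sq_sqrt x.zz_nonneg).symm
  have hhh : x.hh = η ^ 2 := (Real.sq_sqrt x.hh_nonneg).symm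
  have hl0 : 0 < lam⁻¹ := by positivity
  have hl1 : lam⁻¹ ≤ 1 / 3 := by
    rw [inv_le_comm₀ (by linarith) (by norm_num)]
    simpa using hlam
  set w := lam⁻¹ * x.ν - A * x.φ with hw
  have hwb : |w| ≤ |x.ν| + |x.φ| := by
    refine (abs_sub _ _).trans ?_
    rw [abs_mul, abs_mul, abs_of_pos hl0, abs_of_nonneg hA0]
    have := abs_nonneg x.ν
    have := abs_nonneg x.φ
    nlinarith
  -- The six estimates `t1` to `t6` treat the six terms of `rateMetric_eq` in order.
  have t1 : -(4 * σ * x.kk) ≤ 2 * ∑ i, ∑ j, (q i - q j) * x.K i j ^ 2 := by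
    have : -(2 * σ) * x.kk ≤ ∑ i, ∑ j, (q i - q j) * x.K i j ^ 2 := by
      simp only [kk, Finset.mul_sum]
      refine Finset.sum_le_sum fun i _ => Finset.sum_le_sum fun j _ => ?_
      exact mul_le_mul_of_nonneg_right (abs_le.1 (abs_sub_le_two_mul hq i j)).1 (sq_nonneg _)
    linarith
  have hdiag : ∀ i, |∑ a, (q i - q a) * x.H a a| ≤ 6 * σ * η := fun i => by
    have := abs_sum_three_le (f := fun a => (q i - q a) * x.H a a) (B := 2 * σ * η) fun a => by
      rw [abs_mul]
      exact mul_le_mul (abs_sub_le_two_mul hq i a) (x.abs_H_le _ _) (abs_nonneg _) (by positivity)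
    linarith
  have t2 : -(2 * (z ^ 2 * (|x.ν| * |x.φ|))) - 18 * σ * (z ^ 2 * (|x.ν| * η))
      ≤ 2 * x.ν * (∑ i, x.ζ i * ∑ a, x.ζ a * x.K a i) := by
    have e1 : ∑ i, x.ζ i * ∑ a, x.ζ a * x.K a i
        = x.zz * w + 1 / 2 * ∑ i, x.ζ i ^ 2 * ∑ a, (q i - q a) * x.H a a := by
      simp only [hx.momentum, zz, Finset.sum_mul, Finset.mul_sum, ← Finset.sum_add_distrib]
      refine Finset.sum_congr rfl fun i _ => ?_
      rw [mul_add, Finset.mul_sum]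
      congr 1
      · ring
      · exact Finset.sum_congr rfl fun a _ => by ring
    have e2 : |∑ i, x.ζ i ^ 2 * ∑ a, (q i - q a) * x.H a a| ≤ 3 * (z ^ 2 * (6 * σ * η)) :=
      abs_sum_three_le fun i => by
        rw [abs_mul, abs_pow]
        exact mul_le_mul (pow_le_pow_left₀ (abs_nonneg _) (x.abs_ζ_le i) 2) (hdiag i)
          (abs_nonneg _) (by positivity)
    rw [e1, hzz]
    have e3 : x.ν * (∑ i, x.ζ i ^ 2 * ∑ a, (q i - q a) * x.H a a)
        ≥ -(|x.ν| * (3 * (z ^ 2 * (6 * σ * η)))) := by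
      refine (neg_le_neg ?_).trans (neg_abs_le _)
      rw [abs_mul]
      exact mul_le_mul_of_nonneg_left e2 (abs_nonneg _)
    -- The part `lam⁻¹ ν²` has the good sign and is dropped.
    have e4 : -(|x.ν| * |x.φ|) ≤ x.ν * w := by
      have : x.ν * w = lam⁻¹ * x.ν ^ 2 - A * (x.ν * x.φ) := by rw [hw]; ring
      rw [this]
      have h1 : x.ν * x.φ ≤ |x.ν| * |x.φ| := (le_abs_self _).trans (abs_mul _ _).le
      have h2 : 0 ≤ |x.ν| * |x.φ| := by positivity
      have h3 : 0 ≤ lam⁻¹ * x.ν ^ 2 := by positivity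
      nlinarith
    have e5 : z ^ 2 * (-(|x.ν| * |x.φ|)) ≤ z ^ 2 * (x.ν * w) :=
      mul_le_mul_of_nonneg_left e4 (by positivity)
    nlinarith
  have t3 : -(3 * σ * (x.kk + x.ν ^ 2)) ≤ 2 * (1 - lam⁻¹) * x.ν * ∑ i, q i * x.K i i := by
    -- The gauge condition evaluates the isotropic part of the sum, which contributes with a good
    -- sign; only the deviation of `q` from `1/3` is an error.
    have e1 : ∑ i, q i * x.K i i = 1 / 3 * (lam⁻¹ * x.ν) + ∑ a, (q a - 1 / 3) * x.K a a := by
      rw [← hx.gauge]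
      simp only [Fin.sum_univ_three]
      ring
    have e2 := abs_sum_mul_diag_le (x := x) hq hσ0
    set s := ∑ a, (q a - 1 / 3) * x.K a a
    have e3 : |x.ν * s| ≤ |x.ν| * (3 * (σ * √x.kk)) := by
      rw [abs_mul]
      exact mul_le_mul_of_nonneg_left e2 (abs_nonneg _)
    have e4 : |x.ν| * √x.kk ≤ 1 / 2 * (x.kk + x.ν ^ 2) := by
      have := sq_nonneg (|x.ν| - √x.kk)
      have h1 := Real.sq_sqrt x.kk_nonneg
      have h2 := sq_abs x.ν
      nlinarith
    have e5 : |x.ν * s| ≤ 3 / 2 * (σ * (x.kk + x.ν ^ 2)) := by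
      refine e3.trans ?_
      have := mul_le_mul_of_nonneg_left e4 hσ0
      nlinarith
    have e6 : -(3 / 2 * (σ * (x.kk + x.ν ^ 2))) ≤ (1 - lam⁻¹) * (x.ν * s) := by
      have h1 : |(1 - lam⁻¹) * (x.ν * s)| ≤ |x.ν * s| := by
        rw [abs_mul, abs_of_nonneg (by linarith)]
        exact mul_le_of_le_one_left (abs_nonneg _) (by linarith)
      have := neg_abs_le ((1 - lam⁻¹) * (x.ν * s))
      linarith
    have e7 : 0 ≤ (1 - lam⁻¹) * (lam⁻¹ * x.ν ^ 2) :=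
      mul_nonneg (by linarith) (by positivity)
    rw [e1]
    nlinarith
  have t4 : -(30 * (z ^ 2 * (η * (|x.ν| + |x.φ|)))) - 180 * σ * (z ^ 2 * η ^ 2)
      ≤ -∑ i, x.γ i * ((∑ a, x.K i a * x.ζ a) + ∑ a, x.ζ a * x.K a i) := by
    -- `K` is not assumed symmetric, so both momentum constraints are used. Their sum contains `H`
    -- only through differences of exponents.
    have e1 : ∀ i, (∑ a, x.K i a * x.ζ a) + ∑ a, x.ζ a * x.K a i
        = 2 * (x.ζ i * w) + ∑ a, (q i - q a) * (x.ζ i * x.H a a - x.ζ a * x.H a i) := fun i => by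
      rw [hx.momentum, hx.momentum']
      simp only [Fin.sum_univ_three]
      ring
    have e2 : ∀ i, |∑ a, (q i - q a) * (x.ζ i * x.H a a - x.ζ a * x.H a i)|
        ≤ 3 * (2 * σ * (2 * (z * η))) := fun i => abs_sum_three_le fun a => by
      rw [abs_mul]
      refine mul_le_mul (abs_sub_le_two_mul hq i a) ?_ (abs_nonneg _) (by positivity)
      refine (abs_sub _ _).trans ?_
      rw [abs_mul, abs_mul]
      have h1 := mul_le_mul (x.abs_ζ_le i) (x.abs_H_le a a) (abs_nonneg _) hz0
      have h2 := mul_le_mul (x.abs_ζ_le a) (x.abs_H_le a i) (abs_nonneg _) hz0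
      linarith
    have e3 : ∀ i, |x.γ i * ((∑ a, x.K i a * x.ζ a) + ∑ a, x.ζ a * x.K a i)|
        ≤ 5 * (η * z) * (2 * (z * (|x.ν| + |x.φ|)) + 12 * σ * (z * η)) := fun i => by
      rw [abs_mul, e1]
      refine mul_le_mul (x.abs_γ_le i) ?_ (abs_nonneg _) (by positivity)
      refine (abs_add_le _ _).trans ?_
      rw [abs_mul, abs_mul, abs_of_pos (by norm_num : (0 : ℝ) < 2)]
      have h1 := mul_le_mul (x.abs_ζ_le i) hwb (abs_nonneg _) hz0
      have h2 := e2 i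
      linarith
    have e4 := (abs_le.1 (abs_sum_three_le e3)).2
    nlinarith
  have t5 : (1 / 3 - 1 / 2 * σ) * (z ^ 2 * η ^ 2) ≤ 1 / 4 * x.rateZ q * x.hh := by
    have := rateZ_ge (x := x) hq
    rw [hzz] at this
    rw [hhh]
    have h2 := mul_le_mul_of_nonneg_right this (sq_nonneg η)
    linarith
  have t6 : -(z ^ 2 * (η * |x.ν|)) ≤ x.ν * x.zz * ∑ i, q i * x.H i i := by
    -- The exponents are positive with sum one, so this is a convex combination of diagonal entries.
    have e1 : |∑ i, q i * x.H i i| ≤ η := by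
      refine (Finset.abs_sum_le_sum_abs _ _).trans ?_
      have : ∑ i, |q i * x.H i i| ≤ ∑ i, q i * η := Finset.sum_le_sum fun i _ => by
        rw [abs_mul, abs_of_pos (hq0 i)]
        exact mul_le_mul_of_nonneg_left (x.abs_H_le i i) (hq0 i).le
      rwa [← Finset.sum_mul, hqs, one_mul] at this
    refine (neg_le_neg ?_).trans (neg_abs_le _)
    rw [abs_mul, abs_mul, abs_of_nonneg x.zz_nonneg, hzz]
    have := mul_le_mul_of_nonneg_left e1 (by positivity : 0 ≤ |x.ν| * z ^ 2)
    linarith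
  rw [rateMetric_eq hx.symm, hzz, hhh]
  rw [hzz] at t6
  rw [hhh] at t5
  rw [← sq_abs x.ν] at t3
  rw [← sq_abs x.ν, ← sq_abs x.φ]
  linarith [absorb_cross_terms (z := z) hσ0 hσ hη0 (abs_nonneg x.ν) (abs_nonneg x.φ)]

end Frame

/-! ### Differential inequalities on `(0,1]` -/

/-- The integrating factor `s^p` makes `y s · s^p` increasing; comparison of the endpoints `t` and
`1` gives the bound. -/
theorem mul_rpow_le_of_rate {y r : ℝ → ℝ} {t p : ℝ} (ht : t ∈ Ioc (0 : ℝ) 1)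
    (hc : ContinuousOn y (Icc t 1)) (hy : ∀ s ∈ Ioo t 1, HasDerivAt y (s⁻¹ * r s) s)
    (hr : ∀ s ∈ Ioo t 1, 0 ≤ r s + p * y s) : y t * t ^ p ≤ y 1 := by
  have hpos : ∀ s ∈ Icc t 1, 0 < s := fun s hs => ht.1.trans_le hs.1
  have hm : MonotoneOn (fun s => y s * s ^ p) (Icc t 1) := by
    refine monotoneOn_of_hasDerivWithinAt_nonneg (convex_Icc t 1)
      (f' := fun s => s⁻¹ * r s * s ^ p + y s * (p * s ^ (p - 1))) ?_ ?_ ?_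
    · exact hc.mul (continuousOn_id.rpow_const fun s hs => Or.inl (hpos s hs).ne')
    · intro s hs
      rw [interior_Icc] at hs
      exact ((hy s hs).mul
        (Real.hasDerivAt_rpow_const (Or.inl (hpos s (Ioo_subset_Icc_self hs)).ne'))).hasDerivWithinAt
    · intro s hs
      rw [interior_Icc] at hs
      have h0 := hpos s (Ioo_subset_Icc_self hs)
      rw [Real.rpow_sub_one h0.ne']
      have : s⁻¹ * r s * s ^ p + y s * (p * (s ^ p / s)) = s⁻¹ * s ^ p * (r s + p * y s) := by
        field_simp
      rw [this]
      have := hr s hs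
      positivity
  have := hm (left_mem_Icc.2 ht.2) (right_mem_Icc.2 ht.2) ht.2
  simpa using this

theorem one_le_rpow_neg {t p : ℝ} (ht : t ∈ Ioc (0 : ℝ) 1) (hp : 0 ≤ p) : 1 ≤ t ^ (-p) :=
  Real.one_le_rpow_of_pos_of_le_one_of_nonpos ht.1 ht.2 (by linarith)

/-- The excess `y - S` is damped like `t^lam` as time decreases. Either it is nonpositive at `t`, or
it is at most its value at `1`. The bound does not depend on `lam`, which is the point. -/
theorem le_add_of_damped {y r : ℝ → ℝ} {t lam S : ℝ} (ht : t ∈ Ioc (0 : ℝ) 1) (hlam : 0 ≤ lam)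
    (hS : 0 ≤ S) (hy1 : 0 ≤ y 1)
    (hc : ContinuousOn y (Icc t 1)) (hy : ∀ s ∈ Ioo t 1, HasDerivAt y (s⁻¹ * r s) s)
    (hr : ∀ s ∈ Ioo t 1, lam * (y s - S) ≤ r s) : y t ≤ y 1 + S := by
  have h := mul_rpow_le_of_rate (y := fun s => y s - S) (r := r) (p := -lam) ht
    (hc.sub continuousOn_const) (fun s hs => (hy s hs).sub_const S)
    (fun s hs => by linarith [hr s hs])
  by_cases h0 : y t - S ≤ 0
  · linarith
  · have h1 := le_mul_of_one_le_right (not_le.1 h0).le (one_le_rpow_neg ht hlam)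
    linarith

/-- The majorant `B + m ∫ r⁻¹ E` has rate `-m E`, which is at least `-m` times the majorant.
Bounding the majorant instead of `E` lets the integral be reused in later estimates. -/
theorem gronwall_from_one {E : ℝ → ℝ} {t B m : ℝ} (ht : t ∈ Ioc (0 : ℝ) 1) (hm : 0 ≤ m)
    (hE : ContinuousOn E (Ioc 0 1))
    (h : ∀ s ∈ Ioc (0 : ℝ) 1, E s ≤ B + m * ∫ r in s..1, r⁻¹ * E r) :
    B + m * ∫ r in t..1, r⁻¹ * E r ≤ B * t ^ (-m) := by
  have hcont : ContinuousOn (fun r => r⁻¹ * E r) (Ioc 0 1) :=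
    (continuousOn_inv₀.mono fun s hs => hs.1.ne').mul hE
  have hsub : ∀ s ∈ Icc t 1, uIcc s 1 ⊆ Ioc (0 : ℝ) 1 := fun s hs r hr => by
    rw [uIcc_of_le hs.2] at hr
    exact ⟨ht.1.trans_le (hs.1.trans hr.1), hr.2⟩
  have hint : ∀ s ∈ Icc t 1, IntervalIntegrable (fun r => r⁻¹ * E r) volume s 1 := fun s hs =>
    (hcont.mono (hsub s hs)).intervalIntegrable
  have hd := mul_rpow_le_of_rate (y := fun s => B + m * ∫ r in s..1, r⁻¹ * E r)
    (r := fun s => -(m * E s)) (p := m) ht ?_ ?_ ?_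
  · simp only [intervalIntegral.integral_same, mul_zero, add_zero] at hd
    have h1 := mul_le_mul_of_nonneg_right hd (Real.rpow_nonneg ht.1.le (-m))
    rwa [mul_assoc, ← Real.rpow_add ht.1, add_neg_cancel, Real.rpow_zero, mul_one] at h1
  · refine continuousOn_const.add (continuousOn_const.mul ?_)
    have h2 := intervalIntegral.continuousOn_primitive_interval_left
      (f := fun r => r⁻¹ * E r) (μ := volume) (a := t) (b := 1)
      ((hcont.mono (hsub t ⟨le_rfl, ht.2⟩)).integrableOn_uIcc)
    rwa [uIcc_of_le ht.2] at h2
  · intro s hs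
    have hn : Ioc (0 : ℝ) 1 ∈ nhds s :=
      Ioc_mem_nhds (ht.1.trans hs.1) hs.2
    have h2 := intervalIntegral.integral_hasDerivAt_left (hint s (Ioo_subset_Icc_self hs))
      (ContinuousOn.stronglyMeasurableAtFilter_nhdsWithin hcont measurableSet_Ioc s |>.filter_mono
        (by rw [nhdsWithin_eq_nhds.2 hn])) (hcont.continuousAt hn)
    have h3 := (h2.const_mul m).const_add B
    exact h3.congr_deriv (by ring)
  · intro s hs
    have := h s ⟨ht.1.trans hs.1, hs.2.le⟩
    nlinarith

/-- An integrated form of `d - e ≤ r` that needs no integrability of `r`: only the lower bound for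
the derivative is integrated. -/
theorem add_integral_le_of_rate {F r d e : ℝ → ℝ} {t : ℝ} (ht : t ∈ Ioc (0 : ℝ) 1)
    (hF : ∀ s ∈ Ioc (0 : ℝ) 1, HasDerivWithinAt F (s⁻¹ * r s) (Ioc 0 1) s)
    (hd : ContinuousOn d (Ioc 0 1)) (he : ContinuousOn e (Ioc 0 1))
    (h : ∀ s ∈ Ioc (0 : ℝ) 1, d s - e s ≤ r s) :
    F t + ∫ s in t..1, s⁻¹ * d s ≤ F 1 + ∫ s in t..1, s⁻¹ * e s := by
  have hsub : Icc t 1 ⊆ Ioc (0 : ℝ) 1 := fun s hs => ⟨ht.1.trans_le hs.1, hs.2⟩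
  have hinv : ContinuousOn (fun s : ℝ => s⁻¹) (Icc t 1) :=
    continuousOn_inv₀.mono fun s hs => (hsub hs).1.ne'
  have hd' : ContinuousOn (fun s => s⁻¹ * d s) (Icc t 1) := hinv.mul (hd.mono hsub)
  have he' : ContinuousOn (fun s => s⁻¹ * e s) (Icc t 1) := hinv.mul (he.mono hsub)
  have h1 := intervalIntegral.integral_le_sub_of_hasDeriv_right_of_le (g := F)
    (g' := fun s => s⁻¹ * r s) (φ := fun s => s⁻¹ * d s - s⁻¹ * e s) ht.2
    (fun s hs => (hF s (hsub hs)).continuousWithinAt.mono hsub)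
    (fun s hs => ((hF s (hsub (Ioo_subset_Icc_self hs))).hasDerivAt
      (Ioc_mem_nhds (ht.1.trans hs.1) hs.2)).hasDerivWithinAt)
    ((hd'.sub he').integrableOn_Icc)
    (fun s hs => by
      have hs' := hsub (Ioo_subset_Icc_self hs)
      have := mul_le_mul_of_nonneg_left (h s hs') (inv_nonneg.2 hs'.1.le)
      linarith)
  rw [intervalIntegral.integral_sub (hd'.intervalIntegrable_of_Icc ht.2)
    (he'.intervalIntegrable_of_Icc ht.2)] at h1
  linarith

/-! ### The modified energy of a mode and its coercivity -/

namespace Frame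

/-- The weight of the metric energy. -/
def theta : ℝ := 1 / 1000000

/-- The almost total energy of a mode. -/
def energy (x : Frame) : ℝ :=
  theta * (x.kk + 1 / 4 * (x.zz * x.hh)) + (x.P ^ 2 + x.zz * x.φ ^ 2) + x.ν ^ 2

/-- The energy in which `P` is replaced by `P - A ν`; its rate is coercive up to terms of
size `σ`. -/
def modEnergy (lam A : ℝ) (x : Frame) : ℝ :=
  theta * (x.kk + 1 / 4 * (x.zz * x.hh)) + ((x.P - A * x.ν) ^ 2 + x.zz * x.φ ^ 2)
    + (1 - lam⁻¹) / 2 * lam⁻¹ * x.ν ^ 2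

/-- The dissipation terms. -/
def diss (x : Frame) : ℝ :=
  1 / 6 * theta * (x.zz * x.hh) + 1 / 12 * (x.zz * x.φ ^ 2) + 1 / 21 * (x.zz * x.ν ^ 2)
    + 2 / 9 * x.ν ^ 2

/-- The rate of the lapse. -/
def rateν (lam : ℝ) (x : Frame) : ℝ := lam * (x.zz * x.ν + (1 - lam⁻¹) * x.ν + x.scal)

/-- The rate of `P - A ν`. -/
def rateP (lam A : ℝ) (x : Frame) : ℝ := -(x.zz * x.φ) - A * (1 - lam⁻¹) * x.ν

/-- The rate of the modified energy. -/
def rateMod (lam A : ℝ) (q : Fin 3 → ℝ) (x : Frame) : ℝ :=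
  theta * x.rateMetric lam q
    + (2 * (x.P - A * x.ν) * x.rateP lam A + (x.rateZ q * x.φ ^ 2 + x.zz * (2 * x.φ * x.P)))
    + (1 - lam⁻¹) / 2 * lam⁻¹ * (2 * x.ν * x.rateν lam)

variable {lam κ A σ : ℝ} {q : Fin 3 → ℝ} {x : Frame}

/-- The parameters of a Kasner solution that is close to the isotropic one. -/
structure NearFLRW (lam κ A σ : ℝ) (q : Fin 3 → ℝ) : Prop where
  lam_ge : 3 ≤ lam
  κ_ge : 1 / 2 ≤ κ
  A_nonneg : 0 ≤ A
  A_sq_le : A ^ 2 ≤ 2 / 3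
  q_pos : ∀ i, 0 < q i
  q_sum : ∑ i, q i = 1
  q_near : ∀ i, |q i - 1 / 3| ≤ σ
  σ_le : σ ≤ 1 / 10000

theorem NearFLRW.σ_nonneg (h : NearFLRW lam κ A σ q) : 0 ≤ σ := (abs_nonneg _).trans (h.q_near 0)

theorem NearFLRW.A_le (h : NearFLRW lam κ A σ q) : A ≤ 1 := by
  nlinarith [h.A_sq_le, h.A_nonneg]

theorem NearFLRW.inv_pos (h : NearFLRW lam κ A σ q) : 0 < lam⁻¹ := by
  have := h.lam_ge
  positivity

theorem NearFLRW.inv_le (h : NearFLRW lam κ A σ q) : lam⁻¹ ≤ 1 / 3 := by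
  have := h.lam_ge
  rw [inv_le_comm₀ (by linarith) (by norm_num)]
  simpa using this

theorem energy_nonneg (x : Frame) : 0 ≤ x.energy := by
  have := x.kk_nonneg
  have := x.zz_nonneg
  have := x.hh_nonneg
  unfold energy theta
  positivity

/-- The Hamiltonian constraint removes the second derivatives of the metric from the lapse equation,
leaving `P`, `ν` and a term of size `σ`. -/
theorem scal_eq (hx : x.Constraints lam κ A q) :
    x.scal = -2 * (∑ a, (q a - 1 / 3) * x.K a a) + 2 * A * x.P
      - 2 * (A ^ 2 - κ * lam⁻¹) * x.ν := by
  have h1 := hx.hamiltonian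
  have h2 : ∑ a, (1 / 3 - q a) * x.K a a = -∑ a, (q a - 1 / 3) * x.K a a := by
    rw [← Finset.sum_neg_distrib]
    exact Finset.sum_congr rfl fun a _ => by ring
  rw [h2] at h1
  linarith

/-- The choice of variables and weights is made for these cancellations: `φP|ζ|²` between the two
scalar field terms, and `A νP`, `A² ν²` between the wave and lapse contributions. No `P` survives.
-/
theorem rateMod_eq (hx : x.Constraints lam κ A q) (hlam : lam ≠ 0) :
    x.rateMod lam A q = theta * x.rateMetric lam q + x.rateZ q * x.φ ^ 2
      + 2 * A * x.zz * x.ν * x.φ + (1 - lam⁻¹) * x.zz * x.ν ^ 2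
      + ((1 - lam⁻¹) ^ 2 + 2 * (1 - lam⁻¹) * κ * lam⁻¹) * x.ν ^ 2
      - 2 * (1 - lam⁻¹) * (x.ν * ∑ a, (q a - 1 / 3) * x.K a a) := by
  have h1 : lam⁻¹ * lam = 1 := inv_mul_cancel₀ hlam
  have h2 : (1 - lam⁻¹) / 2 * lam⁻¹ * (2 * x.ν * x.rateν lam)
      = (1 - lam⁻¹) * x.ν * (lam⁻¹ * lam) * (x.zz * x.ν + (1 - lam⁻¹) * x.ν + x.scal) := by
    unfold rateν; ring
  unfold rateMod rateP
  rw [h2, h1, scal_eq hx]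
  ring

theorem abs_mul_sum_diag_le (h : NearFLRW lam κ A σ q) (x : Frame) :
    |x.ν * ∑ a, (q a - 1 / 3) * x.K a a| ≤ 3 / 2 * σ * (x.kk + x.ν ^ 2) := by
  have e2 := abs_sum_mul_diag_le (x := x) h.q_near h.σ_nonneg
  rw [abs_mul]
  have e4 : |x.ν| * √x.kk ≤ 1 / 2 * (x.kk + x.ν ^ 2) := by
    have := sq_nonneg (|x.ν| - √x.kk)
    have h1 := Real.sq_sqrt x.kk_nonneg
    have h2 := sq_abs x.ν
    nlinarith
  have h1 := mul_le_mul_of_nonneg_left e2 (abs_nonneg x.ν)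
  have h2 := mul_le_mul_of_nonneg_left e4 h.σ_nonneg
  linarith

/-- The modified energy is coercive up to terms of size `σ`. -/
theorem rateMod_ge (h : NearFLRW lam κ A σ q) (hx : x.Constraints lam κ A q) :
    x.diss - 10000000 * σ * x.energy ≤ x.rateMod lam A q := by
  have hl0 := h.inv_pos
  have hl1 := h.inv_le
  have hσ0 := h.σ_nonneg
  have hσ1 := h.σ_le
  have hkk := x.kk_nonneg
  have hm := rateMetric_ge hx h.lam_ge h.A_nonneg h.A_le h.q_near h.q_pos h.q_sum h.σ_le
  have hz := rateZ_ge (x := x) h.q_near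
  rw [rateMod_eq hx (by linarith [h.lam_ge])]
  have hZ := x.zz_nonneg
  have hZh : 0 ≤ x.zz * x.hh := mul_nonneg hZ x.hh_nonneg
  have hZφ : 0 ≤ x.zz * x.φ ^ 2 := mul_nonneg hZ (sq_nonneg _)
  have hZν : 0 ≤ x.zz * x.ν ^ 2 := mul_nonneg hZ (sq_nonneg _)
  have k1 : (4 / 3 - 2 * σ) * (x.zz * x.φ ^ 2) ≤ x.rateZ q * x.φ ^ 2 := by
    rw [← mul_assoc]
    exact mul_le_mul_of_nonneg_right hz (sq_nonneg _)
  -- Since `7/6 · 4/7 = 2/3` bounds `A²`, the split leaves `4/3 - 7/6 = 1/6` for `φ` and `2/3 - 4/7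
  -- = 2/21` for `ν`. These are twice the dissipation coefficients `1/12` and `1/21`; the surplus
  -- absorbs `theta · 10000 = 1/100` and the `σ` terms.
  have k2 : -(7 / 6 * (x.zz * x.φ ^ 2)) - 4 / 7 * (x.zz * x.ν ^ 2)
      ≤ 2 * A * x.zz * x.ν * x.φ := by
    have s1 : 0 ≤ x.zz * (7 / 4 * A * x.φ + x.ν) ^ 2 := by positivity
    have s2 : A ^ 2 * (x.zz * x.φ ^ 2) ≤ 2 / 3 * (x.zz * x.φ ^ 2) :=
      mul_le_mul_of_nonneg_right h.A_sq_le hZφ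
    linarith
  have k3 : 2 / 3 * (x.zz * x.ν ^ 2) ≤ (1 - lam⁻¹) * x.zz * x.ν ^ 2 := by
    rw [mul_assoc]
    exact mul_le_mul_of_nonneg_right (by linarith) hZν
  have k4 : 4 / 9 * x.ν ^ 2
      ≤ ((1 - lam⁻¹) ^ 2 + 2 * (1 - lam⁻¹) * κ * lam⁻¹) * x.ν ^ 2 := by
    refine mul_le_mul_of_nonneg_right ?_ (sq_nonneg _)
    have s1 : 0 ≤ 2 * (1 - lam⁻¹) * κ * lam⁻¹ := by
      have := h.κ_ge
      have : 0 ≤ 1 - lam⁻¹ := by linarith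
      have : 0 ≤ κ := by linarith
      positivity
    nlinarith
  have k5 : 2 * (1 - lam⁻¹) * (x.ν * ∑ a, (q a - 1 / 3) * x.K a a)
      ≤ 3 * σ * (x.kk + x.ν ^ 2) := by
    have s1 := (le_abs_self _).trans (abs_mul_sum_diag_le h x)
    have s2 := (neg_le_of_abs_le (abs_mul_sum_diag_le h x))
    have s3 : 0 ≤ σ * (x.kk + x.ν ^ 2) := by positivity
    have s4 : 0 ≤ 1 - lam⁻¹ := by linarith
    have s5 := mul_le_mul_of_nonneg_left s1 s4
    nlinarith
  -- The factor is `1/theta`, because `|K|²` has weight `theta` in the energy.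
  have k6 : σ * (x.kk + x.ν ^ 2) ≤ 1000000 * (σ * x.energy) := by
    have : x.kk + x.ν ^ 2 ≤ 1000000 * x.energy := by
      unfold energy theta
      nlinarith [sq_nonneg x.P, sq_nonneg x.ν]
    nlinarith
  have k7 : σ * (x.zz * x.φ ^ 2) ≤ 1 / 10000 * (x.zz * x.φ ^ 2) :=
    mul_le_mul_of_nonneg_right hσ1 hZφ
  have k8 : 0 ≤ σ * (x.kk + x.ν ^ 2) := by positivity
  have k9 := mul_le_mul_of_nonneg_left hm (by norm_num [theta] : 0 ≤ theta)
  have k10 := sq_nonneg x.ν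
  unfold diss
  simp only [theta] at k9 ⊢
  linarith

theorem modEnergy_le (h : NearFLRW lam κ A σ q) (x : Frame) :
    x.modEnergy lam A ≤ 4 * x.energy := by
  have hl0 := h.inv_pos
  have hl1 := h.inv_le
  have hkk := x.kk_nonneg
  have hZφ : 0 ≤ x.zz * x.φ ^ 2 := mul_nonneg x.zz_nonneg (sq_nonneg _)
  have hZh : 0 ≤ x.zz * x.hh := mul_nonneg x.zz_nonneg x.hh_nonneg
  have s1 : (x.P - A * x.ν) ^ 2 ≤ 2 * x.P ^ 2 + 2 * x.ν ^ 2 := by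
    have := mul_le_mul_of_nonneg_right h.A_sq_le (sq_nonneg x.ν)
    nlinarith [sq_nonneg (x.P + A * x.ν), sq_nonneg x.ν]
  have s2 : (1 - lam⁻¹) / 2 * lam⁻¹ * x.ν ^ 2 ≤ 1 * x.ν ^ 2 := by
    refine mul_le_mul_of_nonneg_right ?_ (sq_nonneg _)
    nlinarith
  have := sq_nonneg x.P
  have := sq_nonneg x.ν
  unfold modEnergy energy theta
  linarith

/-- The weight of `ν²` in `modEnergy` tends to zero as `lam → ∞`, so a separate multiple of `ν²` is
needed for constants independent of `lam`. -/
theorem energy_le (h : NearFLRW lam κ A σ q) (x : Frame) :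
    x.energy ≤ 2 * x.modEnergy lam A + 3 * x.ν ^ 2 := by
  have hl0 := h.inv_pos
  have hl1 := h.inv_le
  have hkk := x.kk_nonneg
  have hZφ : 0 ≤ x.zz * x.φ ^ 2 := mul_nonneg x.zz_nonneg (sq_nonneg _)
  have hZh : 0 ≤ x.zz * x.hh := mul_nonneg x.zz_nonneg x.hh_nonneg
  have s1 : x.P ^ 2 ≤ 2 * (x.P - A * x.ν) ^ 2 + 2 * x.ν ^ 2 := by
    have := mul_le_mul_of_nonneg_right h.A_sq_le (sq_nonneg x.ν)
    nlinarith [sq_nonneg (x.P - 2 * A * x.ν), sq_nonneg x.ν]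
  have s2 : 0 ≤ (1 - lam⁻¹) / 2 * lam⁻¹ * x.ν ^ 2 := by
    have : 0 ≤ 1 - lam⁻¹ := by linarith
    positivity
  unfold modEnergy energy theta
  linarith

/-- The source of the lapse equation, after the Hamiltonian constraint has been used. -/
def source (A : ℝ) (q : Fin 3 → ℝ) (x : Frame) : ℝ :=
  2 * A * (x.P - A * x.ν) - 2 * ∑ a, (q a - 1 / 3) * x.K a a

/-- The constraint combines with `P` so that the source involves only `P - A ν` and `K`, both
controlled by `modEnergy`. The zeroth-order coefficient is at least one as soon as `κ ≥ 1/2`, which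
covers both values of `κ`. -/
theorem rateν_eq (hx : x.Constraints lam κ A q) :
    x.rateν lam = lam * ((x.zz + (1 + (2 * κ - 1) * lam⁻¹)) * x.ν + x.source A q) := by
  unfold rateν source
  rw [scal_eq hx]
  ring

theorem source_sq_le (h : NearFLRW lam κ A σ q) (x : Frame) :
    x.source A q ^ 2 ≤ 9 * x.modEnergy lam A := by
  have hl0 := h.inv_pos
  have hl1 := h.inv_le
  have hσ0 := h.σ_nonneg
  have hkk := x.kk_nonneg
  have hZφ : 0 ≤ x.zz * x.φ ^ 2 := mul_nonneg x.zz_nonneg (sq_nonneg _)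
  have hZh : 0 ≤ x.zz * x.hh := mul_nonneg x.zz_nonneg x.hh_nonneg
  have e2 := abs_sum_mul_diag_le (x := x) h.q_near h.σ_nonneg
  have e3 : (∑ a, (q a - 1 / 3) * x.K a a) ^ 2 ≤ 1 / 10000000 * x.kk := by
    have h1 := sq_le_sq' (neg_le_of_abs_le e2) ((le_abs_self _).trans e2)
    refine h1.trans ?_
    rw [mul_pow, mul_pow, Real.sq_sqrt hkk, ← mul_assoc]
    refine mul_le_mul_of_nonneg_right ?_ hkk
    have := h.σ_le
    nlinarith
  have s2 : 0 ≤ (1 - lam⁻¹) / 2 * lam⁻¹ * x.ν ^ 2 := by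
    have : 0 ≤ 1 - lam⁻¹ := by linarith
    positivity
  have s3 := mul_le_mul_of_nonneg_right h.A_sq_le (sq_nonneg (x.P - A * x.ν))
  have s4 := sq_nonneg (x.P - A * x.ν)
  unfold source modEnergy theta
  nlinarith [sq_nonneg (2 * A * (x.P - A * x.ν) + 2 * ∑ a, (q a - 1 / 3) * x.K a a)]

/-- One of the two copies of `ν²` absorbs the source by Young's inequality; the other is the
damping. -/
theorem rate_ν_sq_ge (h : NearFLRW lam κ A σ q) (hx : x.Constraints lam κ A q) {S : ℝ}
    (hS : x.source A q ^ 2 ≤ S) : lam * (x.ν ^ 2 - S) ≤ 2 * x.ν * x.rateν lam := by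
  rw [rateν_eq hx]
  have hl := h.lam_ge
  have hl0 := h.inv_pos
  have h1 : 0 ≤ (2 * κ - 1) * lam⁻¹ := mul_nonneg (by linarith [h.κ_ge]) hl0.le
  have h2 : x.ν ^ 2 - S
      ≤ 2 * x.ν * ((x.zz + (1 + (2 * κ - 1) * lam⁻¹)) * x.ν + x.source A q) := by
    have s1 : 0 ≤ (x.zz + (2 * κ - 1) * lam⁻¹) * x.ν ^ 2 :=
      mul_nonneg (add_nonneg x.zz_nonneg h1) (sq_nonneg _)
    nlinarith [sq_nonneg (x.ν + x.source A q)]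
  have := mul_le_mul_of_nonneg_left h2 (by linarith : 0 ≤ lam)
  linarith

/-- Here the source is paired with `|ζ|²ν` and absorbed by the parabolic term `|ζ|⁴ν²`, so no
gradient of the source is needed. -/
theorem rate_zz_ν_sq_ge (h : NearFLRW lam κ A σ q) (hx : x.Constraints lam κ A q) {S : ℝ}
    (hS : x.source A q ^ 2 ≤ S) :
    lam * (x.zz * x.ν ^ 2 - S) ≤ x.rateZ q * x.ν ^ 2 + x.zz * (2 * x.ν * x.rateν lam) := by
  rw [rateν_eq hx]
  have hl := h.lam_ge
  have hl0 := h.inv_pos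
  have hz := rateZ_ge (x := x) h.q_near
  have hZ := x.zz_nonneg
  have h0 : 0 ≤ x.rateZ q * x.ν ^ 2 := by
    refine mul_nonneg (le_trans (mul_nonneg ?_ hZ) hz) (sq_nonneg _)
    linarith [h.σ_le]
  have h1 : 0 ≤ (2 * κ - 1) * lam⁻¹ := mul_nonneg (by linarith [h.κ_ge]) hl0.le
  have h2 : x.zz * x.ν ^ 2 - S
      ≤ x.zz * (2 * x.ν * ((x.zz + (1 + (2 * κ - 1) * lam⁻¹)) * x.ν + x.source A q)) := by
    have s1 : 0 ≤ x.zz * ((2 * κ - 1) * lam⁻¹) * x.ν ^ 2 :=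
      mul_nonneg (mul_nonneg hZ h1) (sq_nonneg _)
    have s2 : 0 ≤ x.zz * x.ν ^ 2 := mul_nonneg hZ (sq_nonneg _)
    nlinarith [sq_nonneg (x.zz * x.ν + x.source A q), sq_nonneg (x.zz * x.ν)]
  have := mul_le_mul_of_nonneg_left h2 (by linarith : 0 ≤ lam)
  linarith

end Frame

/-! ### Rates and the mode equations -/

/-- `t ∂_t f = r` on `(0,1]`. -/
def HasRate (f r : ℝ → ℝ) : Prop :=
  ∀ t ∈ Ioc (0 : ℝ) 1, HasDerivWithinAt f (t⁻¹ * r t) (Ioc 0 1) t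

namespace HasRate

variable {f g r s : ℝ → ℝ}

theorem continuousOn (h : HasRate f r) : ContinuousOn f (Ioc 0 1) :=
  fun t ht => (h t ht).continuousWithinAt

theorem hasDerivAt (h : HasRate f r) {t : ℝ} (ht : t ∈ Ioo (0 : ℝ) 1) :
    HasDerivAt f (t⁻¹ * r t) t :=
  (h t (Ioo_subset_Ioc_self ht)).hasDerivAt (Ioc_mem_nhds ht.1 ht.2)

theorem add (hf : HasRate f r) (hg : HasRate g s) :
    HasRate (fun t => f t + g t) (fun t => r t + s t) := fun t ht =>
  ((hf t ht).add (hg t ht)).congr_deriv (by ring)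

theorem const_mul (c : ℝ) (hf : HasRate f r) : HasRate (fun t => c * f t) (fun t => c * r t) :=
  fun t ht => ((hf t ht).const_mul c).congr_deriv (by ring)

theorem mul_const (hf : HasRate f r) (c : ℝ) : HasRate (fun t => f t * c) (fun t => r t * c) :=
  fun t ht => ((hf t ht).mul_const c).congr_deriv (by ring)

theorem sub (hf : HasRate f r) (hg : HasRate g s) :
    HasRate (fun t => f t - g t) (fun t => r t - s t) := fun t ht =>
  ((hf t ht).sub (hg t ht)).congr_deriv (by ring)

theorem mul (hf : HasRate f r) (hg : HasRate g s) :
    HasRate (fun t => f t * g t) (fun t => r t * g t + f t * s t) := fun t ht =>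
  ((hf t ht).mul (hg t ht)).congr_deriv (by ring)

theorem sq (hf : HasRate f r) : HasRate (fun t => f t ^ 2) (fun t => 2 * f t * r t) :=
  fun t ht => ((hf t ht).pow 2).congr_deriv (by norm_num; ring)

theorem sum {ι : Type*} {u : Finset ι} {F R : ι → ℝ → ℝ} (h : ∀ i, HasRate (F i) (R i)) :
    HasRate (fun t => ∑ i ∈ u, F i t) (fun t => ∑ i ∈ u, R i t) := fun t ht =>
  (HasDerivWithinAt.fun_sum fun i _ => h i t ht).congr_deriv (by rw [Finset.mul_sum])

theorem congr_rate (hf : HasRate f r) (h : ∀ t ∈ Ioc (0 : ℝ) 1, r t = s t) : HasRate f s :=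
  fun t ht => (hf t ht).congr_deriv (by rw [h t ht])

end HasRate

/-- One Fourier mode of a solution, in the orthonormal frame. -/
structure IsModeSolution (lam κ A : ℝ) (q : Fin 3 → ℝ) (x : ℝ → Frame) : Prop where
  constraints : ∀ t ∈ Ioc (0 : ℝ) 1, (x t).Constraints lam κ A q
  rate_ζ : ∀ i, HasRate (fun t => (x t).ζ i) (fun t => (1 - q i) * (x t).ζ i)
  rate_H : ∀ i j, HasRate (fun t => (x t).H i j) (fun t => (x t).rateH q i j)
  rate_K : ∀ i j, HasRate (fun t => (x t).K i j) (fun t => (x t).rateK lam q i j)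
  rate_φ : HasRate (fun t => (x t).φ) (fun t => (x t).P)
  rate_P : HasRate (fun t => (x t).P - A * (x t).ν) (fun t => (x t).rateP lam A)
  rate_ν : HasRate (fun t => (x t).ν) (fun t => (x t).rateν lam)

namespace IsModeSolution

variable {lam κ A σ : ℝ} {q : Fin 3 → ℝ} {x : ℝ → Frame}

theorem rate_zz (h : IsModeSolution lam κ A q x) :
    HasRate (fun t => (x t).zz) (fun t => (x t).rateZ q) :=
  (HasRate.sum fun i => (h.rate_ζ i).sq).congr_rate fun t _ =>
    Finset.sum_congr rfl fun i _ => by ring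

theorem rate_hh (h : IsModeSolution lam κ A q x) :
    HasRate (fun t => (x t).hh) (fun t => ∑ i, ∑ j, 2 * (x t).H i j * (x t).rateH q i j) :=
  HasRate.sum fun i => HasRate.sum fun j => (h.rate_H i j).sq

theorem rate_kk (h : IsModeSolution lam κ A q x) :
    HasRate (fun t => (x t).kk) (fun t => ∑ i, ∑ j, 2 * (x t).K i j * (x t).rateK lam q i j) :=
  HasRate.sum fun i => HasRate.sum fun j => (h.rate_K i j).sq

theorem rate_modEnergy (h : IsModeSolution lam κ A q x) :
    HasRate (fun t => (x t).modEnergy lam A) (fun t => (x t).rateMod lam A q) := by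
  have h1 := (h.rate_kk.add ((h.rate_zz.mul h.rate_hh).const_mul (1 / 4))).const_mul Frame.theta
  have h2 := h.rate_P.sq.add (h.rate_zz.mul h.rate_φ.sq)
  have h3 := h.rate_ν.sq.const_mul ((1 - lam⁻¹) / 2 * lam⁻¹)
  exact (h1.add h2).add h3

/-- The wave equation prescribes the rate of `P - A ν` only; `P` is recovered from it. -/
theorem continuousOn_P (h : IsModeSolution lam κ A q x) :
    ContinuousOn (fun t => (x t).P) (Ioc 0 1) := by
  refine (h.rate_P.continuousOn.add (continuousOn_const (c := A) |>.mul
    h.rate_ν.continuousOn)).congr fun t _ => ?_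
  simp

theorem continuousOn_energy (h : IsModeSolution lam κ A q x) :
    ContinuousOn (fun t => (x t).energy) (Ioc 0 1) := by
  have h1 := (h.rate_kk.add ((h.rate_zz.mul h.rate_hh).const_mul (1 / 4))).const_mul Frame.theta
  exact (h1.continuousOn.add ((h.continuousOn_P.pow 2).add
    (h.rate_zz.mul h.rate_φ.sq).continuousOn)).add h.rate_ν.sq.continuousOn

theorem continuousOn_diss (h : IsModeSolution lam κ A q x) :
    ContinuousOn (fun t => (x t).diss) (Ioc 0 1) := by
  exact ((((h.rate_zz.mul h.rate_hh).const_mul (1 / 6 * Frame.theta)).add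
    ((h.rate_zz.mul h.rate_φ.sq).const_mul (1 / 12))).add
    ((h.rate_zz.mul h.rate_ν.sq).const_mul (1 / 21))).add
    (h.rate_ν.sq.const_mul (2 / 9)) |>.continuousOn

end IsModeSolution

/-! ### Energy estimates for a single mode -/

theorem integral_inv_mul_nonneg {f : ℝ → ℝ} {t : ℝ} (ht : t ∈ Ioc (0 : ℝ) 1)
    (hf : ∀ s, 0 ≤ f s) : 0 ≤ ∫ s in t..1, s⁻¹ * f s :=
  intervalIntegral.integral_nonneg ht.2 fun s hs =>
    mul_nonneg (inv_nonneg.2 (ht.1.le.trans hs.1)) (hf s)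

theorem integral_inv_mul_mono {f : ℝ → ℝ} {s t : ℝ} (ht : t ∈ Ioc (0 : ℝ) 1) (hs : s ∈ Icc t 1)
    (hf : ∀ s, 0 ≤ f s) (hc : ContinuousOn f (Ioc 0 1)) :
    ∫ r in s..1, r⁻¹ * f r ≤ ∫ r in t..1, r⁻¹ * f r := by
  have hcont : ContinuousOn (fun r => r⁻¹ * f r) (Icc t 1) :=
    ((continuousOn_inv₀.mono fun s hs => hs.1.ne').mul hc).mono
      fun r hr => ⟨ht.1.trans_le hr.1, hr.2⟩
  refine intervalIntegral.integral_mono_interval hs.1 hs.2 le_rfl ?_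
    (hcont.intervalIntegrable_of_Icc ht.2)
  refine (ae_restrict_iff' measurableSet_Ioc).2 (Filter.Eventually.of_forall fun r hr => ?_)
  exact mul_nonneg (inv_nonneg.2 (ht.1.le.trans hr.1.le)) (hf r)

namespace Frame

theorem diss_nonneg (x : Frame) : 0 ≤ x.diss := by
  have := x.zz_nonneg
  have := x.hh_nonneg
  unfold diss theta
  positivity

end Frame

namespace IsModeSolution

variable {lam κ A σ : ℝ} {q : Fin 3 → ℝ} {x : ℝ → Frame}

theorem modEnergy_add_integral_le (hx : IsModeSolution lam κ A q x)
    (h : Frame.NearFLRW lam κ A σ q) {t : ℝ} (ht : t ∈ Ioc (0 : ℝ) 1) :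
    (x t).modEnergy lam A + ∫ s in t..1, s⁻¹ * (x s).diss
      ≤ (x 1).modEnergy lam A + 10000000 * σ * ∫ s in t..1, s⁻¹ * (x s).energy := by
  have h1 := add_integral_le_of_rate (e := fun s => 10000000 * σ * (x s).energy) ht
    hx.rate_modEnergy hx.continuousOn_diss
    (continuousOn_const.mul hx.continuousOn_energy)
    (fun s hs => Frame.rateMod_ge h (hx.constraints s hs))
  have h2 : ∫ s in t..1, s⁻¹ * (10000000 * σ * (x s).energy)
      = 10000000 * σ * ∫ s in t..1, s⁻¹ * (x s).energy := by
    rw [← intervalIntegral.integral_const_mul]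
    congr 1
    funext s
    ring
  rwa [h2] at h1

/-- A bound, uniform on `[t,1]`, for the source of the lapse equation. -/
theorem source_sq_le (hx : IsModeSolution lam κ A q x)
    (h : Frame.NearFLRW lam κ A σ q) {t s : ℝ} (ht : t ∈ Ioc (0 : ℝ) 1) (hs : s ∈ Icc t 1) :
    (x s).source A q ^ 2 ≤ 9 * ((x 1).modEnergy lam A
      + 10000000 * σ * ∫ s in t..1, s⁻¹ * (x s).energy) := by
  have hs' : s ∈ Ioc (0 : ℝ) 1 := ⟨ht.1.trans_le hs.1, hs.2⟩
  have h1 := hx.modEnergy_add_integral_le h hs'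
  have h2 := integral_inv_mul_nonneg hs' fun s => (x s).diss_nonneg
  have h3 := integral_inv_mul_mono ht hs (fun s => (x s).energy_nonneg) hx.continuousOn_energy
  have h4 := mul_le_mul_of_nonneg_left h3 (mul_nonneg (by norm_num : (0 : ℝ) ≤ 10000000) h.σ_nonneg)
  have h5 := Frame.source_sq_le h (x s)
  linarith

theorem ν_sq_le (hx : IsModeSolution lam κ A q x)
    (h : Frame.NearFLRW lam κ A σ q) {t : ℝ} (ht : t ∈ Ioc (0 : ℝ) 1) :
    (x t).ν ^ 2 ≤ (x 1).ν ^ 2 + 9 * ((x 1).modEnergy lam A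
      + 10000000 * σ * ∫ s in t..1, s⁻¹ * (x s).energy) := by
  refine le_add_of_damped (y := fun t => (x t).ν ^ 2) (lam := lam) ht (by linarith [h.lam_ge]) ?_
    (sq_nonneg _)
    (hx.rate_ν.sq.continuousOn.mono fun s hs => ⟨ht.1.trans_le hs.1, hs.2⟩)
    (fun s hs => hx.rate_ν.sq.hasDerivAt ⟨ht.1.trans hs.1, hs.2⟩) ?_
  · exact (sq_nonneg _).trans (hx.source_sq_le h ht ⟨ht.2, le_rfl⟩)
  · intro s hs
    exact Frame.rate_ν_sq_ge h (hx.constraints s ⟨ht.1.trans hs.1, hs.2.le⟩)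
      (hx.source_sq_le h ht (Ioo_subset_Icc_self hs))

theorem zz_ν_sq_le (hx : IsModeSolution lam κ A q x)
    (h : Frame.NearFLRW lam κ A σ q) {t : ℝ} (ht : t ∈ Ioc (0 : ℝ) 1) :
    (x t).zz * (x t).ν ^ 2 ≤ (x 1).zz * (x 1).ν ^ 2 + 9 * ((x 1).modEnergy lam A
      + 10000000 * σ * ∫ s in t..1, s⁻¹ * (x s).energy) := by
  have hr := hx.rate_zz.mul hx.rate_ν.sq
  refine le_add_of_damped (y := fun t => (x t).zz * (x t).ν ^ 2) (lam := lam) ht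
    (by linarith [h.lam_ge]) ?_ (mul_nonneg (x 1).zz_nonneg (sq_nonneg _))
    (hr.continuousOn.mono fun s hs => ⟨ht.1.trans_le hs.1, hs.2⟩)
    (fun s hs => hr.hasDerivAt ⟨ht.1.trans hs.1, hs.2⟩) ?_
  · exact (sq_nonneg _).trans (hx.source_sq_le h ht ⟨ht.2, le_rfl⟩)
  · intro s hs
    exact Frame.rate_zz_ν_sq_ge h (hx.constraints s ⟨ht.1.trans hs.1, hs.2.le⟩)
      (hx.source_sq_le h ht (Ioo_subset_Icc_self hs))

/-- The energy inequality of a mode. -/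
theorem energy_add_integral_le (hx : IsModeSolution lam κ A q x)
    (h : Frame.NearFLRW lam κ A σ q) {t : ℝ} (ht : t ∈ Ioc (0 : ℝ) 1) :
    (x t).energy + ∫ s in t..1, s⁻¹ * (x s).diss
      ≤ 120 * (x 1).energy + 290000000 * σ * ∫ s in t..1, s⁻¹ * (x s).energy := by
  have h1 := hx.modEnergy_add_integral_le h ht
  have h2 := hx.ν_sq_le h ht
  have h3 := Frame.energy_le h (x t)
  have h4 := Frame.modEnergy_le h (x 1)
  have h5 := integral_inv_mul_nonneg ht fun s => (x s).diss_nonneg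
  have h6 : (x 1).ν ^ 2 ≤ (x 1).energy := by
    have := (x 1).kk_nonneg
    have := (x 1).zz_nonneg
    have := (x 1).hh_nonneg
    have : 0 ≤ Frame.theta * ((x 1).kk + 1 / 4 * ((x 1).zz * (x 1).hh))
        + ((x 1).P ^ 2 + (x 1).zz * (x 1).φ ^ 2) := by
      unfold Frame.theta
      positivity
    unfold Frame.energy
    linarith
  have h7 := (x 1).energy_nonneg
  -- With `energy ≤ 2 modEnergy + 3 ν²`, the modified energy at time `1` occurs `2 + 3·9 = 29`
  -- times, giving `29·4 + 3 ≤ 120` and `29 · 10⁷ σ`.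
  linarith

/-- The whole right-hand side is bounded, so that the integral of the energy is also available in
`total_le`. -/
theorem gronwall_bound (hx : IsModeSolution lam κ A q x)
    (h : Frame.NearFLRW lam κ A σ q) {t : ℝ} (ht : t ∈ Ioc (0 : ℝ) 1) :
    120 * (x 1).energy + 290000000 * σ * ∫ s in t..1, s⁻¹ * (x s).energy
      ≤ 120 * (x 1).energy * t ^ (-(290000000 * σ)) :=
  gronwall_from_one ht (mul_nonneg (by norm_num) h.σ_nonneg) hx.continuousOn_energy fun s hs => by
    have h1 := hx.energy_add_integral_le h hs
    have h2 := integral_inv_mul_nonneg hs fun s => (x s).diss_nonneg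
    linarith

/-- The energy of a mode grows at most like `t^{-cσ}`. -/
theorem energy_le (hx : IsModeSolution lam κ A q x)
    (h : Frame.NearFLRW lam κ A σ q) {t : ℝ} (ht : t ∈ Ioc (0 : ℝ) 1) :
    (x t).energy ≤ 120 * t ^ (-(290000000 * σ)) * (x 1).energy := by
  have h1 := hx.energy_add_integral_le h ht
  have h2 := integral_inv_mul_nonneg ht fun s => (x s).diss_nonneg
  have h3 := hx.gronwall_bound h ht
  linarith

/-- The total energy of a mode grows at most like `t^{-cσ}`. -/
theorem total_le (hx : IsModeSolution lam κ A q x)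
    (h : Frame.NearFLRW lam κ A σ q) {t : ℝ} (ht : t ∈ Ioc (0 : ℝ) 1) :
    (x t).energy + (x t).zz * (x t).ν ^ 2
      ≤ 300 * t ^ (-(290000000 * σ)) * ((x 1).energy + (x 1).zz * (x 1).ν ^ 2) := by
  have h1 := hx.energy_le h ht
  have h2 := hx.zz_ν_sq_le h ht
  have h3 := hx.gronwall_bound h ht
  have h4 := Frame.modEnergy_le h (x 1)
  have h5 := integral_inv_mul_nonneg ht fun s => (x s).energy_nonneg
  have h6 := mul_nonneg (mul_nonneg (by norm_num : (0 : ℝ) ≤ 10000000) h.σ_nonneg) h5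
  have h7 := one_le_rpow_neg ht (mul_nonneg (by norm_num : (0 : ℝ) ≤ 290000000) h.σ_nonneg)
  have h8 := (x 1).energy_nonneg
  have h9 : 0 ≤ (x 1).zz * (x 1).ν ^ 2 := mul_nonneg (x 1).zz_nonneg (sq_nonneg _)
  set T := t ^ (-(290000000 * σ))
  have h10 := mul_le_mul_of_nonneg_right h7 h9
  have h11 : 0 ≤ T * (x 1).energy := mul_nonneg (by linarith) h8
  have h12 : 0 ≤ T * ((x 1).zz * (x 1).ν ^ 2) := mul_nonneg (by linarith) h9
  linarith

theorem integral_diss_eq (hx : IsModeSolution lam κ A q x) {t : ℝ} (ht : t ∈ Ioc (0 : ℝ) 1) :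
    ∫ s in t..1, s⁻¹ * (x s).diss
      = 1 / 6 * Frame.theta * (∫ s in t..1, s⁻¹ * ((x s).zz * (x s).hh))
        + 1 / 12 * (∫ s in t..1, s⁻¹ * ((x s).zz * (x s).φ ^ 2))
        + 1 / 21 * (∫ s in t..1, s⁻¹ * ((x s).zz * (x s).ν ^ 2))
        + 2 / 9 * (∫ s in t..1, s⁻¹ * (x s).ν ^ 2) := by
  have hsub : Icc t 1 ⊆ Ioc (0 : ℝ) 1 := fun s hs => ⟨ht.1.trans_le hs.1, hs.2⟩
  have hinv : ContinuousOn (fun s : ℝ => s⁻¹) (Icc t 1) :=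
    continuousOn_inv₀.mono fun s hs => (hsub hs).1.ne'
  have int : ∀ {f : ℝ → ℝ}, ContinuousOn f (Ioc 0 1) →
      IntervalIntegrable (fun s => s⁻¹ * f s) volume t 1 := fun hf =>
    (hinv.mul (hf.mono hsub)).intervalIntegrable_of_Icc ht.2
  have i1 := int (hx.rate_zz.mul hx.rate_hh).continuousOn
  have i2 := int (hx.rate_zz.mul hx.rate_φ.sq).continuousOn
  have i3 := int (hx.rate_zz.mul hx.rate_ν.sq).continuousOn
  have i4 := int hx.rate_ν.sq.continuousOn
  rw [← intervalIntegral.integral_const_mul, ← intervalIntegral.integral_const_mul,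
    ← intervalIntegral.integral_const_mul, ← intervalIntegral.integral_const_mul,
    ← intervalIntegral.integral_add (i1.const_mul _) (i2.const_mul _),
    ← intervalIntegral.integral_add ((i1.const_mul _).add (i2.const_mul _)) (i3.const_mul _),
    ← intervalIntegral.integral_add (((i1.const_mul _).add (i2.const_mul _)).add
      (i3.const_mul _)) (i4.const_mul _)]
  congr 1
  funext s
  unfold Frame.diss
  ring

end IsModeSolution

/-! ### The Fourier modes of a solution -/

theorem pD_add (i : Fin 3) (S T : Distr) : pD i (S + T) = pD i S + pD i T := by
  funext ψ
  simp [pD]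
  ring

theorem pD_sub (i : Fin 3) (S T : Distr) : pD i (S - T) = pD i S - pD i T := by
  funext ψ
  simp [pD]
  ring

theorem pD_smul (i : Fin 3) (c : ℝ) (T : Distr) : pD i (c • T) = c • pD i T := by
  funext ψ
  simp [pD]

theorem sum_gK_smul (q : Fin 3 → ℝ) (t : ℝ) (i : Fin 3) (T : Fin 3 → Distr) :
    ∑ a, gK q t i a • T a = t ^ (2 * q i) • T i := by
  simp [gK, Matrix.diagonal_apply]

theorem sum_gKinv_smul (q : Fin 3 → ℝ) (t : ℝ) (i : Fin 3) (T : Fin 3 → Distr) :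
    ∑ a, gKinv q t i a • T a = t ^ (-(2 * q i)) • T i := by
  simp [gKinv, Matrix.diagonal_apply]

theorem christ_eq (q : Fin 3 → ℝ) (t : ℝ) (S : Slice) (a i b : Fin 3) :
    christ q t S a i b = (1 / 2 * t ^ (-(2 * q i))) •
      (pD a (S.g i b) + pD b (S.g a i) - pD i (S.g a b)) := by
  rw [christ, sum_gKinv_smul, smul_smul]

theorem lap_eq (q : Fin 3 → ℝ) (t : ℝ) (T : Distr) :
    lap q t T = ∑ a, t ^ (-(2 * q a)) • pD a (pD a T) := by
  simp only [lap, sum_gKinv_smul]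

theorem scalCurv_eq (q : Fin 3 → ℝ) (t : ℝ) (S : Slice) :
    scalCurv q t S = -((1 / 2 : ℝ) • ∑ a, ∑ e,
        (t ^ (-(2 * q a)) * t ^ (-(2 * q e))) • pD e (pD e (S.g a a)))
      + ∑ a, ∑ e, t ^ (-(2 * q e)) • pD a (christ q t S e a e) := by
  simp only [scalCurv, sum_gKinv_smul, mul_smul, ← Finset.smul_sum]

theorem ricci_eq (q : Fin 3 → ℝ) (t : ℝ) (S : Slice) (i j : Fin 3) :
    ricci q t S i j = -((1 / 2 : ℝ) • ∑ e,
        (t ^ (-(2 * q i)) * t ^ (-(2 * q e))) • pD e (pD e (S.g j i)))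
      + (1 / 2 : ℝ) • (∑ e, t ^ (-(2 * q e)) • pD j (christ q t S e i e))
      + (1 / 2 : ℝ) • (∑ e,
        (t ^ (-(2 * q i)) * t ^ (2 * q j) * t ^ (-(2 * q e))) • pD i (christ q t S e j e)) := by
  simp only [ricci, sum_gKinv_smul, sum_gK_smul, mul_smul, ← Finset.smul_sum]

/-- All components of a slice are sums of their Fourier series. -/
structure Slice.IsFourierSum (S : Slice) : Prop where
  g : ∀ i j, ParabolicKasner.IsFourierSum (S.g i j)
  K : ∀ i j, ParabolicKasner.IsFourierSum (S.K i j)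
  φ : ParabolicKasner.IsFourierSum S.φ
  dtφ : ParabolicKasner.IsFourierSum S.dtφ
  ν : ParabolicKasner.IsFourierSum S.ν

/-- The Fourier mode `(k, b)` of a slice, in the orthonormal frame of the Kasner metric. -/
def Slice.frame (q : Fin 3 → ℝ) (k : Fin 3 → ℤ) (b : Bool) (t : ℝ) (S : Slice) : Frame where
  ζ := fun i => t ^ (1 - q i) * freq k i
  H := fun i j => t ^ (-(q i + q j)) * S.g i j (trig k b)
  K := fun i j => t ^ (q i - q j) * S.K i j (trig k b)
  φ := S.φ (trig k b)
  P := t * S.dtφ (trig k b)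
  ν := S.ν (trig k b)

section

variable {q : Fin 3 → ℝ} {t : ℝ} {S : Slice} (k : Fin 3 → ℤ) (b : Bool)

theorem rpow_two_mul (ht : 0 < t) (p : ℝ) : t ^ (2 * p) = (t ^ p) ^ 2 := by
  rw [two_mul, Real.rpow_add ht, sq]

theorem rpow_neg_two_mul (ht : 0 < t) (p : ℝ) : t ^ (-(2 * p)) = ((t ^ p) ^ 2)⁻¹ := by
  rw [Real.rpow_neg ht.le, rpow_two_mul ht]

theorem freq_eq_frame (ht : 0 < t) (i : Fin 3) :
    freq k i = t⁻¹ * t ^ q i * (S.frame q k b t).ζ i := by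
  have := (Real.rpow_pos_of_pos ht (q i)).ne'
  simp only [Slice.frame, Real.rpow_sub ht, Real.rpow_one]
  field_simp

theorem g_eq_frame (ht : 0 < t) (i j : Fin 3) :
    S.g i j (trig k b) = t ^ q i * t ^ q j * (S.frame q k b t).H i j := by
  have h1 := (Real.rpow_pos_of_pos ht (q i)).ne'
  have h2 := (Real.rpow_pos_of_pos ht (q j)).ne'
  simp only [Slice.frame, Real.rpow_neg ht.le, Real.rpow_add ht]
  field_simp

theorem K_eq_frame (ht : 0 < t) (i j : Fin 3) :
    S.K i j (trig k b) = (t ^ q i)⁻¹ * t ^ q j * (S.frame q k b t).K i j := by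
  have h1 := (Real.rpow_pos_of_pos ht (q i)).ne'
  have h2 := (Real.rpow_pos_of_pos ht (q j)).ne'
  simp only [Slice.frame, Real.rpow_sub ht]
  field_simp

theorem lap_trig (ht : 0 < t) {T : Distr} (hT : IsFourierSum T) :
    t ^ 2 * lap q t T (trig k b) = -((S.frame q k b t).zz * T (trig k b)) := by
  rw [lap_eq, Frame.zz, Finset.sum_mul, Finset.sum_apply, Finset.mul_sum, ← Finset.sum_neg_distrib]
  refine Finset.sum_congr rfl fun a _ => ?_
  have h1 := (Real.rpow_pos_of_pos ht (q a)).ne'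
  rw [Pi.smul_apply, hT.pD_pD_trig, freq_eq_frame (q := q) (S := S) k b ht, rpow_neg_two_mul ht,
    smul_eq_mul]
  field_simp

theorem scalCurv_trig (ht : 0 < t) (hS : S.IsFourierSum) :
    t ^ 2 * scalCurv q t S (trig k b) = (S.frame q k b t).scal := by
  have hp : ∀ i, 0 < t ^ q i := fun i => Real.rpow_pos_of_pos ht (q i)
  simp only [scalCurv_eq, christ_eq, pD_smul, pD_add, pD_sub, Finset.sum_apply, Pi.add_apply,
    Pi.neg_apply, Pi.sub_apply, Pi.smul_apply, smul_eq_mul, (hS.g _ _).pD_pD_trig,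
    rpow_neg_two_mul ht, freq_eq_frame (q := q) (S := S) k b ht, g_eq_frame (q := q) k b ht,
    Frame.scal, Frame.zz]
  generalize S.frame q k b t = x
  have h0 := hp 0
  have h1 := hp 1
  have h2 := hp 2
  simp only [Fin.sum_univ_three]
  generalize t ^ q 0 = e0 at *
  generalize t ^ q 1 = e1 at *
  generalize t ^ q 2 = e2 at *
  field_simp
  ring

/-- The powers of `t` on both sides are those of the frame, which make the expression symmetric in
`i` and `j`. Symmetry of `H` is used to identify the contracted Christoffel symbols. -/
theorem ricci_trig (ht : 0 < t) (hS : S.IsFourierSum)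
    (hs : ∀ i j, (S.frame q k b t).H i j = (S.frame q k b t).H j i) (i j : Fin 3) :
    t ^ 2 * (t ^ q i * (t ^ q j)⁻¹ * ricci q t S i j (trig k b))
      = 1 / 2 * ((S.frame q k b t).zz * (S.frame q k b t).H i j
        - (S.frame q k b t).ζ i * (S.frame q k b t).γ j
        - (S.frame q k b t).ζ j * (S.frame q k b t).γ i) := by
  have hp : ∀ i, 0 < t ^ q i := fun i => Real.rpow_pos_of_pos ht (q i)
  simp only [ricci_eq, christ_eq, pD_smul, pD_add, pD_sub, Finset.sum_apply, Pi.add_apply,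
    Pi.neg_apply, Pi.sub_apply, Pi.smul_apply, smul_eq_mul, (hS.g _ _).pD_pD_trig,
    rpow_neg_two_mul ht, rpow_two_mul ht, freq_eq_frame (q := q) (S := S) k b ht,
    g_eq_frame (q := q) k b ht, Frame.γ, Frame.zz]
  generalize S.frame q k b t = x at *
  have h0 := hp 0
  have h1 := hp 1
  have h2 := hp 2
  have hi := hp i
  have hj := hp j
  simp only [Fin.sum_univ_three, hs 0 i, hs 1 i, hs 2 i, hs 0 j, hs 1 j, hs 2 j, hs j i]
  generalize t ^ q 0 = e0 at *
  generalize t ^ q 1 = e1 at *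
  generalize t ^ q 2 = e2 at *
  generalize t ^ q i = ei at *
  generalize t ^ q j = ej at *
  field_simp
  ring

end

theorem sum_bigKhat_smul (q : Fin 3 → ℝ) (i : Fin 3) (T : Fin 3 → Distr) :
    ∑ a, bigKhat q i a • T a = (1 / 3 - q i) • T i := by
  have : bigKhat q = Matrix.diagonal fun i => 1 / 3 - q i := by
    ext a b
    by_cases h : a = b
    · subst h
      simp [bigKhat, bigK]
      ring
    · simp [bigKhat, bigK, h]
  simp [this, Matrix.diagonal_apply]

theorem sum_bigKhat_smul' (q : Fin 3 → ℝ) (i : Fin 3) (T : Fin 3 → Distr) :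
    ∑ a, bigKhat q a i • T a = (1 / 3 - q i) • T i := by
  rw [← sum_bigKhat_smul]
  refine Finset.sum_congr rfl fun a _ => ?_
  by_cases h : a = i
  · rw [h]
  · simp [bigKhat, bigK, h, Ne.symm h]

theorem sum_bigK_smul (q : Fin 3 → ℝ) (i : Fin 3) (T : Fin 3 → Distr) :
    ∑ a, bigK q a i • T a = (-q i) • T i := by
  simp [bigK, Matrix.diagonal_apply]

/-- A first derivative exchanges sine and cosine. Tested against the opposite mode, a first-order
equation relates coefficients of one mode `b`, all with the same sign `s`. -/
theorem IsFourierSum.exists_sign (k : Fin 3 → ℤ) (b : Bool) : ∃ s : ℝ, s ≠ 0 ∧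
    ∀ T : Distr, IsFourierSum T → ∀ a,
      ParabolicKasner.pD a T (trig k !b) = s * freq k a * T (trig k b) := by
  cases b
  · exact ⟨1, one_ne_zero, fun T hT a => by rw [Bool.not_false, hT.pD_cos]; ring⟩
  · exact ⟨-1, by norm_num, fun T hT a => by rw [Bool.not_true, hT.pD_sin]; ring⟩

theorem hasRate_rpow (p : ℝ) : HasRate (fun t => t ^ p) (fun t => p * t ^ p) := fun t ht => by
  refine (Real.hasDerivAt_rpow_const (Or.inl ht.1.ne')).hasDerivWithinAt.congr_deriv ?_
  rw [Real.rpow_sub_one ht.1.ne']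
  ring

theorem hasRate_of_timeDiff {F : ℝ → Distr} (h : ∀ t ∈ Ioc (0 : ℝ) 1, TimeDiff F t) (ψ : TestFn) :
    HasRate (fun t => F t ψ) (fun t => t * dt F t ψ) := fun t ht => by
  refine (h t ht ψ).hasDerivWithinAt.congr_deriv ?_
  have := ht.1.ne'
  simp only [dt]
  field_simp

/-! ### From the field equations to the mode equations -/

namespace IsLinearizedSolution

variable {lam κ A : ℝ} {q : Fin 3 → ℝ} {u : Fields}

theorem isFourierSum (hu : IsLinearizedSolution lam κ q A u) {t : ℝ} (ht : t ∈ Ioc (0 : ℝ) 1) :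
    (u.slice t).IsFourierSum where
  g i j := IsFourierSum.ofFun (hu.memLp_g t ht i j)
  K i j := IsFourierSum.ofFun (hu.memLp_K t ht i j)
  φ := IsFourierSum.ofFun (hu.memLp_φ t ht)
  dtφ := IsFourierSum.ofFun (hu.memLp_dtφ t ht)
  ν := IsFourierSum.ofFun (hu.memLp_ν t ht)

theorem frame_symm (hu : IsLinearizedSolution lam κ q A u) {t : ℝ} (ht : t ∈ Ioc (0 : ℝ) 1)
    (k : Fin 3 → ℤ) (b : Bool) (i j : Fin 3) :
    ((u.slice t).frame q k b t).H i j = ((u.slice t).frame q k b t).H j i := by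
  simp only [Slice.frame, Fields.slice, add_comm (q i)]
  congr 1
  refine integral_congr_ae ?_
  filter_upwards [hu.symm t ht i j] with x hx
  rw [hx]

theorem frame_momentum (hu : IsLinearizedSolution lam κ q A u) {t : ℝ} (ht : t ∈ Ioc (0 : ℝ) 1)
    (k : Fin 3 → ℤ) (b : Bool) (i : Fin 3) :
    ∑ a, ((u.slice t).frame q k b t).ζ a * ((u.slice t).frame q k b t).K a i
      = ((u.slice t).frame q k b t).ζ i
          * (lam⁻¹ * ((u.slice t).frame q k b t).ν - A * ((u.slice t).frame q k b t).φ)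
        + 1 / 2 * ((u.slice t).frame q k b t).ζ i
          * ∑ a, (q i - q a) * ((u.slice t).frame q k b t).H a a := by
  obtain ⟨s, hs, hpD⟩ := IsFourierSum.exists_sign k b
  have hF := hu.isFourierSum ht
  have hp : ∀ i, 0 < t ^ q i := fun i => Real.rpow_pos_of_pos ht.1 (q i)
  have ht0 := ht.1
  -- Every term carries exactly one derivative, so the opposite mode is the right test function; the
  -- sign `s ≠ 0` is then divided out.
  have h := congrFun (hu.momentum t ht i) (trig k !b)
  simp only [sum_bigKhat_smul, sum_bigKhat_smul', christ_eq, Finset.sum_apply, Pi.add_apply,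
    Pi.sub_apply, Pi.smul_apply, smul_eq_mul, hpD _ (hF.g _ _), hpD _ (hF.K _ _),
    hpD _ hF.ν, hpD _ hF.φ, rpow_neg_two_mul ht.1,
    freq_eq_frame (q := q) (S := u.slice t) k b ht.1,
    g_eq_frame (q := q) k b ht.1, K_eq_frame (q := q) k b ht.1] at h
  have hν : (u.slice t).ν (trig k b) = ((u.slice t).frame q k b t).ν := rfl
  have hφ : (u.slice t).φ (trig k b) = ((u.slice t).frame q k b t).φ := rfl
  rw [hν, hφ] at h
  have hsymm := hu.frame_symm ht k b
  generalize (u.slice t).frame q k b t = x at *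
  have h0 := hp 0
  have h1 := hp 1
  have h2 := hp 2
  have hi := hp i
  simp only [Fin.sum_univ_three] at h ⊢
  generalize t ^ q 0 = e0 at *
  generalize t ^ q 1 = e1 at *
  generalize t ^ q 2 = e2 at *
  generalize t ^ q i = ei at *
  field_simp at h
  linear_combination (1 / 6) * h

theorem frame_momentum' (hu : IsLinearizedSolution lam κ q A u) {t : ℝ} (ht : t ∈ Ioc (0 : ℝ) 1)
    (k : Fin 3 → ℤ) (b : Bool) (i : Fin 3) :
    ∑ a, ((u.slice t).frame q k b t).K i a * ((u.slice t).frame q k b t).ζ a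
      = ((u.slice t).frame q k b t).ζ i
          * (lam⁻¹ * ((u.slice t).frame q k b t).ν - A * ((u.slice t).frame q k b t).φ)
        + 1 / 2 * ∑ a, (q a - q i) * (2 * ((u.slice t).frame q k b t).ζ a
          * ((u.slice t).frame q k b t).H a i
          - ((u.slice t).frame q k b t).ζ i * ((u.slice t).frame q k b t).H a a) := by
  obtain ⟨s, hs, hpD⟩ := IsFourierSum.exists_sign k b
  have hF := hu.isFourierSum ht
  have hp : ∀ i, 0 < t ^ q i := fun i => Real.rpow_pos_of_pos ht.1 (q i)
  have ht0 := ht.1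
  have e1 : ∀ T : Fin 3 → Fin 3 → Distr,
      ∑ a, ∑ b, ∑ c, (gKinv q t a b * bigKhat q c b) • T a c
        = ∑ a, t ^ (-(2 * q a)) • (1 / 3 - q a) • T a a := fun T => by
    simp only [mul_smul, ← Finset.smul_sum, sum_gKinv_smul, sum_bigKhat_smul']
  have h := congrFun (hu.momentum' t ht i) (trig k !b)
  rw [e1 fun a c => christ q t (u.slice t) a i c] at h
  simp only [mul_smul, ← Finset.smul_sum, sum_gKinv_smul, sum_bigKhat_smul] at h
  simp only [christ_eq, Finset.sum_apply, Pi.add_apply,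
    Pi.sub_apply, Pi.smul_apply, smul_eq_mul, hpD _ (hF.g _ _), hpD _ (hF.K _ _),
    hpD _ hF.ν, hpD _ hF.φ, rpow_neg_two_mul ht.1,
    freq_eq_frame (q := q) (S := u.slice t) k b ht.1,
    g_eq_frame (q := q) k b ht.1, K_eq_frame (q := q) k b ht.1] at h
  have hν : (u.slice t).ν (trig k b) = ((u.slice t).frame q k b t).ν := rfl
  have hφ : (u.slice t).φ (trig k b) = ((u.slice t).frame q k b t).φ := rfl
  rw [hν, hφ] at h
  have hsymm := hu.frame_symm ht k b
  generalize (u.slice t).frame q k b t = x at *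
  have h0 := hp 0
  have h1 := hp 1
  have h2 := hp 2
  have hi := hp i
  simp only [Fin.sum_univ_three, hsymm i 0, hsymm i 1, hsymm i 2] at h ⊢
  generalize t ^ q 0 = e0 at *
  generalize t ^ q 1 = e1 at *
  generalize t ^ q 2 = e2 at *
  generalize t ^ q i = ei at *
  field_simp at h
  linear_combination (1 / 6) * h

theorem frame_constraints (hu : IsLinearizedSolution lam κ q A u) {t : ℝ}
    (ht : t ∈ Ioc (0 : ℝ) 1) (k : Fin 3 → ℤ) (b : Bool) :
    ((u.slice t).frame q k b t).Constraints lam κ A q where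
  symm := hu.frame_symm ht k b
  gauge := by
    have h := congrFun (hu.gauge t ht) (trig k b)
    simpa [Slice.frame, Finset.sum_apply] using h
  hamiltonian := by
    have h := congrFun (hu.hamiltonian t ht) (trig k b)
    simp only [sum_bigKhat_smul, Pi.add_apply, Pi.sub_apply, Pi.smul_apply, smul_eq_mul,
      Finset.sum_apply, Pi.zero_apply, scalCurv_trig k b ht.1 (hu.isFourierSum ht)] at h
    have hd : ∀ a, ((u.slice t).frame q k b t).K a a = (u.slice t).K a a (trig k b) := fun a => by
      simp [Slice.frame]
    simp only [hd]
    have e1 : ((u.slice t).frame q k b t).P = t * (u.slice t).dtφ (trig k b) := rfl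
    have e2 : ((u.slice t).frame q k b t).ν = (u.slice t).ν (trig k b) := rfl
    rw [e1, e2]
    linarith
  momentum := hu.frame_momentum ht k b
  momentum' := hu.frame_momentum' ht k b

/-- The Fourier modes of a solution satisfy the mode equations. -/
theorem isModeSolution (hu : IsLinearizedSolution lam κ q A u) (hlam : lam ≠ 0)
    (k : Fin 3 → ℤ) (b : Bool) :
    IsModeSolution lam κ A q fun t => (u.slice t).frame q k b t where
  constraints t ht := hu.frame_constraints ht k b
  rate_ζ i := ((hasRate_rpow (1 - q i)).mul_const (freq k i)).congr_rate fun t ht => by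
    simp only [Slice.frame]
    ring
  rate_H i j := by
    refine ((hasRate_rpow (-(q i + q j))).mul
      (hasRate_of_timeDiff (F := fun s => (u.slice s).g i j)
        (fun t ht => hu.timeDiff_g t ht i j) (trig k b))).congr_rate fun t ht => ?_
    have ht0 := ht.1
    have hi := Real.rpow_pos_of_pos ht.1 (q i)
    have hj := Real.rpow_pos_of_pos ht.1 (q j)
    have h := congrFun (hu.evol_g t ht i j) (trig k b)
    simp only [mul_smul, sum_gK_smul, sum_bigK_smul] at h
    simp only [Pi.sub_apply, Pi.neg_apply, Pi.smul_apply, smul_eq_mul, rpow_two_mul ht.1,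
      g_eq_frame (q := q) k b ht.1, K_eq_frame (q := q) k b ht.1] at h
    have hν : (u.slice t).ν (trig k b) = ((u.slice t).frame q k b t).ν := rfl
    rw [hν] at h
    rw [h, g_eq_frame (q := q) k b ht.1, Real.rpow_neg ht.1.le, Real.rpow_add ht.1]
    unfold Frame.rateH
    generalize (u.slice t).frame q k b t = x
    by_cases hij : i = j
    · subst hij
      simp only [bigK, Matrix.diagonal_apply_eq, if_true]
      generalize t ^ q i = ei at *
      field_simp
      ring
    · simp only [bigK, Matrix.diagonal_apply_ne _ hij, if_neg hij]
      generalize t ^ q i = ei at *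
      generalize t ^ q j = ej at *
      field_simp
      ring
  rate_K i j := by
    refine ((hasRate_rpow (q i - q j)).mul
      (hasRate_of_timeDiff (F := fun s => (u.slice s).K i j)
        (fun t ht => hu.timeDiff_K t ht i j) (trig k b))).congr_rate fun t ht => ?_
    have ht0 := ht.1
    have hi := Real.rpow_pos_of_pos ht.1 (q i)
    have hj := Real.rpow_pos_of_pos ht.1 (q j)
    have hF := hu.isFourierSum ht
    have hR := ricci_trig (q := q) k b ht.1 hF (hu.frame_symm ht k b) i j
    have h := congrFun (hu.evol_K t ht i j) (trig k b)
    simp only [sum_gKinv_smul] at h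
    simp only [Pi.add_apply, Pi.sub_apply, Pi.neg_apply, Pi.smul_apply, smul_eq_mul,
      rpow_neg_two_mul ht.1, hF.ν.pD_pD_trig,
      freq_eq_frame (q := q) (S := u.slice t) k b ht.1] at h
    have hν : (u.slice t).ν (trig k b) = ((u.slice t).frame q k b t).ν := rfl
    rw [hν] at h
    rw [h, K_eq_frame (q := q) k b ht.1, Real.rpow_sub ht.1]
    unfold Frame.rateK
    rw [← hR]
    generalize (u.slice t).frame q k b t = x
    generalize ricci q t (u.slice t) i j (trig k b) = R
    by_cases hij : i = j
    · subst hij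
      simp only [bigK, Matrix.diagonal_apply_eq, if_true]
      generalize t ^ q i = ei at *
      field_simp
      ring
    · simp only [bigK, Matrix.diagonal_apply_ne _ hij, if_neg hij]
      generalize t ^ q i = ei at *
      generalize t ^ q j = ej at *
      field_simp
      ring
  rate_φ := (hasRate_of_timeDiff (F := fun s => (u.slice s).φ)
      (fun t ht => hu.timeDiff_φ t ht) (trig k b)).congr_rate fun t ht => by
    rw [hu.dtφ_eq t ht]
    rfl
  rate_P := by
    have h1 : ∀ t ∈ Ioc (0 : ℝ) 1, TimeDiff (fun s => s • (u.slice s).dtφ) t :=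
      fun t ht ψ => differentiableWithinAt_id.mul (hu.timeDiff_dtφ t ht ψ)
    -- Subtracting `A ν` cancels the time derivative of the lapse in the wave equation.
    refine ((hasRate_of_timeDiff h1 (trig k b)).sub
      ((hasRate_of_timeDiff (F := fun s => (u.slice s).ν)
        (fun t ht => hu.timeDiff_ν t ht) (trig k b)).const_mul A)).congr_rate fun t ht => ?_
    have ht0 := ht.1.ne'
    have hL := lap_trig (q := q) (S := u.slice t) k b ht.1 (hu.isFourierSum ht).φ
    have h := congrFun (hu.wave t ht) (trig k b)
    simp only [Pi.add_apply, Pi.neg_apply, Pi.smul_apply, smul_eq_mul] at h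
    have e1 : ((u.slice t).frame q k b t).φ = (u.slice t).φ (trig k b) := rfl
    have e2 : ((u.slice t).frame q k b t).ν = (u.slice t).ν (trig k b) := rfl
    unfold Frame.rateP
    rw [e1, e2, ← hL]
    have h3 := congrArg (fun y => t * y) h
    have h4 : t * (A * (1 - lam⁻¹) * t⁻¹ * (u.slice t).ν (trig k b))
        = A * (1 - lam⁻¹) * (u.slice t).ν (trig k b) := by
      field_simp
    linarith
  rate_ν := (hasRate_of_timeDiff (F := fun s => (u.slice s).ν)
      (fun t ht => hu.timeDiff_ν t ht) (trig k b)).congr_rate fun t ht => by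
    have hF := hu.isFourierSum ht
    have hL := lap_trig (q := q) (S := u.slice t) k b ht.1 hF.ν
    have h := congrFun (hu.lapse t ht) (trig k b)
    simp only [Pi.add_apply, Pi.sub_apply, Pi.smul_apply, smul_eq_mul, hL,
      scalCurv_trig k b ht.1 hF] at h
    have e2 : ((u.slice t).frame q k b t).ν = (u.slice t).ν (trig k b) := rfl
    have h3 : lam⁻¹ * t * dt (fun s => (u.slice s).ν) t (trig k b)
        = ((u.slice t).frame q k b t).zz * (u.slice t).ν (trig k b)
          + (1 - lam⁻¹) * (u.slice t).ν (trig k b) + ((u.slice t).frame q k b t).scal := by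
      linarith
    unfold Frame.rateν
    rw [e2, ← h3]
    field_simp

end IsLinearizedSolution

/-! ### Energies as sums over the Fourier modes -/

/-- The sum over all modes of `X`, with the weight that belongs to `∂_I`. -/
def modeSum (I : Fin 3 → ℕ) (X : (Fin 3 → ℤ) → ℝ) : ℝ≥0∞ :=
  ∑' k, ENNReal.ofReal (symb I k * X k)

theorem modeSum_add (I : Fin 3 → ℕ) {X Y : (Fin 3 → ℤ) → ℝ} (hX : ∀ k, 0 ≤ X k)
    (hY : ∀ k, 0 ≤ Y k) : modeSum I X + modeSum I Y = modeSum I fun k => X k + Y k := by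
  rw [modeSum, modeSum, modeSum, ← ENNReal.tsum_add]
  refine tsum_congr fun k => ?_
  rw [mul_add, ENNReal.ofReal_add (mul_nonneg (symb_nonneg I k) (hX k))
    (mul_nonneg (symb_nonneg I k) (hY k))]

theorem ofReal_mul_modeSum (I : Fin 3 → ℕ) {c : ℝ} (hc : 0 ≤ c) (X : (Fin 3 → ℤ) → ℝ) :
    ENNReal.ofReal c * modeSum I X = modeSum I fun k => c * X k := by
  rw [modeSum, modeSum, ← ENNReal.tsum_mul_left]
  refine tsum_congr fun k => ?_
  rw [← ENNReal.ofReal_mul hc]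
  ring_nf

theorem modeSum_mono (I : Fin 3 → ℕ) {X Y : (Fin 3 → ℤ) → ℝ} (h : ∀ k, X k ≤ Y k) :
    modeSum I X ≤ modeSum I Y :=
  ENNReal.tsum_le_tsum fun k =>
    ENNReal.ofReal_le_ofReal (mul_le_mul_of_nonneg_left (h k) (symb_nonneg I k))

theorem sum_ofReal_mul_l2sq {ι : Type*} [Fintype ι] {w : ι → ℝ} (hw : ∀ a, 0 ≤ w a)
    {T : ι → Distr} (hT : ∀ a, IsFourierSum (T a)) (I : Fin 3 → ℕ) {X : (Fin 3 → ℤ) → ℝ}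
    (hX : ∀ k, ∑ a, w a * mass (T a) k = symb I k * X k) :
    ∑ a, ENNReal.ofReal (w a) * l2sq (T a) = modeSum I X := by
  simp_rw [(hT _).l2sq_eq, ← ENNReal.tsum_mul_left]
  rw [← Summable.tsum_finsetSum fun _ _ => ENNReal.summable]
  refine tsum_congr fun k => ?_
  rw [← hX, ENNReal.ofReal_sum_of_nonneg fun a _ => mul_nonneg (hw a) (mass_nonneg _ _)]
  exact Finset.sum_congr rfl fun a _ => (ENNReal.ofReal_mul (hw a)).symm

theorem IsFourierSum.l2sq_eq_modeSum {T : Distr} (hT : IsFourierSum T) (I : Fin 3 → ℕ)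
    {X : (Fin 3 → ℤ) → ℝ} (hX : ∀ k, mass T k = symb I k * X k) : l2sq T = modeSum I X := by
  rw [hT.l2sq_eq, modeSum]
  exact tsum_congr fun k => by rw [hX]

theorem Slice.IsFourierSum.mD {S : Slice} (hS : S.IsFourierSum) (I : Fin 3 → ℕ) :
    (S.mD I).IsFourierSum where
  g i j := (hS.g i j).mD I
  K i j := (hS.K i j).mD I
  φ := hS.φ.mD I
  dtφ := hS.dtφ.mD I
  ν := hS.ν.mD I

/-- The sum of a quantity over the cosine and the sine mode with frequency `k`. -/
def Slice.pairSum (X : Frame → ℝ) (q : Fin 3 → ℝ) (t : ℝ) (S : Slice) (k : Fin 3 → ℤ) : ℝ :=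
  ∑ b, X (S.frame q k b t)

theorem Slice.pairSum_nonneg {X : Frame → ℝ} (hX : ∀ x, 0 ≤ X x) (q : Fin 3 → ℝ) (t : ℝ)
    (S : Slice) (k : Fin 3 → ℤ) : 0 ≤ S.pairSum X q t k :=
  Finset.sum_nonneg fun _ _ => hX _

section

variable {q : Fin 3 → ℝ} {t : ℝ} {S : Slice}

theorem gK_diag_nonneg (ht : 0 < t) (i : Fin 3) : 0 ≤ gK q t i i := by
  simp only [gK, Matrix.diagonal_apply_eq]
  positivity

theorem gKinv_diag_nonneg (ht : 0 < t) (i : Fin 3) : 0 ≤ gKinv q t i i := by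
  simp only [gKinv, Matrix.diagonal_apply_eq]
  positivity

theorem KSq_mD (ht : 0 < t) (hS : S.IsFourierSum) (I : Fin 3 → ℕ) :
    KSq q t (S.mD I) = modeSum I (S.pairSum Frame.kk q t) := by
  have : KSq q t (S.mD I) = ∑ p : Fin 3 × Fin 3,
      ENNReal.ofReal (gK q t p.1 p.1 * gKinv q t p.2 p.2) * l2sq (mD I (S.K p.1 p.2)) := by
    simp only [KSq, Fintype.sum_prod_type, Slice.mD]
  rw [this]
  refine sum_ofReal_mul_l2sq (fun p => mul_nonneg (gK_diag_nonneg ht _) (gKinv_diag_nonneg ht _))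
    (fun p => (hS.K _ _).mD I) I fun k => ?_
  simp only [(hS.K _ _).mass_mD]
  simp only [Slice.pairSum, Frame.kk, Fintype.sum_prod_type, mass,
    Fintype.sum_bool, ← Finset.sum_add_distrib, Finset.mul_sum]
  refine Finset.sum_congr rfl fun i _ => Finset.sum_congr rfl fun j _ => ?_
  have h1 := (Real.rpow_pos_of_pos ht (q i)).ne'
  have h2 := (Real.rpow_pos_of_pos ht (q j)).ne'
  simp only [gK, gKinv, Matrix.diagonal_apply_eq, Slice.frame, rpow_two_mul ht,
    rpow_neg_two_mul ht, Real.rpow_sub ht]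
  field_simp

theorem frame_ζ_eq (ht : 0 < t) (k : Fin 3 → ℤ) (b : Bool) (i : Fin 3) :
    (S.frame q k b t).ζ i = t * (t ^ q i)⁻¹ * freq k i := by
  simp only [Slice.frame, Real.rpow_sub ht, Real.rpow_one, div_eq_mul_inv]

/-- The observable `Y` makes one computation serve both `φ` and `ν`. -/
theorem dScalarSq_mD (ht : 0 < t) {T : Distr} (hT : IsFourierSum T) (I : Fin 3 → ℕ) (S : Slice)
    {Y : Frame → ℝ} (hY : ∀ k b, T (trig k b) = Y (S.frame q k b t)) :
    dScalarSq q t (mD I T) = modeSum I (S.pairSum (fun x => x.zz * Y x ^ 2) q t) := by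
  rw [dScalarSq]
  refine sum_ofReal_mul_l2sq (fun a => gKinv_diag_nonneg ht _)
    (fun a => ((hT.mD I).pD a).smul t) I fun k => ?_
  simp only [mass_smul, (hT.mD I).mass_pD, hT.mass_mD]
  simp only [Slice.pairSum, mass, hY, Fintype.sum_bool, Frame.zz, Finset.sum_mul,
    ← Finset.sum_add_distrib, Finset.mul_sum]
  refine Finset.sum_congr rfl fun i _ => ?_
  have h1 := (Real.rpow_pos_of_pos ht (q i)).ne'
  simp only [gKinv, Matrix.diagonal_apply_eq, frame_ζ_eq ht, rpow_neg_two_mul ht]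
  field_simp

theorem dgSq_mD (ht : 0 < t) (hS : S.IsFourierSum) (I : Fin 3 → ℕ) :
    dgSq q t (S.mD I) = modeSum I (S.pairSum (fun x => x.zz * x.hh) q t) := by
  have : dgSq q t (S.mD I) = ∑ p : Fin 3 × Fin 3 × Fin 3,
      ENNReal.ofReal (gKinv q t p.1 p.1 * gKinv q t p.2.1 p.2.1 * gKinv q t p.2.2 p.2.2)
        * l2sq (t • pD p.1 (mD I (S.g p.2.1 p.2.2))) := by
    simp only [dgSq, Fintype.sum_prod_type, Slice.mD]
  rw [this]
  refine sum_ofReal_mul_l2sq (fun p => mul_nonneg (mul_nonneg (gKinv_diag_nonneg ht _)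
    (gKinv_diag_nonneg ht _)) (gKinv_diag_nonneg ht _))
    (fun p => (((hS.g _ _).mD I).pD _).smul t) I fun k => ?_
  simp only [mass_smul, ((hS.g _ _).mD I).mass_pD, (hS.g _ _).mass_mD]
  simp only [Slice.pairSum, Frame.zz, Finset.sum_mul, Fintype.sum_bool,
    ← Finset.sum_add_distrib]
  simp only [Frame.hh, Fintype.sum_prod_type, mass, Fintype.sum_bool, Finset.mul_sum,
    ← Finset.sum_add_distrib]
  refine Finset.sum_congr rfl fun e _ => Finset.sum_congr rfl fun i _ =>
    Finset.sum_congr rfl fun j _ => ?_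
  have h0 := (Real.rpow_pos_of_pos ht (q e)).ne'
  have h1 := (Real.rpow_pos_of_pos ht (q i)).ne'
  have h2 := (Real.rpow_pos_of_pos ht (q j)).ne'
  simp only [gKinv, Matrix.diagonal_apply_eq, Slice.frame, rpow_neg_two_mul ht, Real.rpow_sub ht,
    Real.rpow_one, Real.rpow_neg ht.le, Real.rpow_add ht]
  field_simp

theorem l2sq_dtφ_mD (hS : S.IsFourierSum) (I : Fin 3 → ℕ) :
    l2sq (t • (S.mD I).dtφ) = modeSum I (S.pairSum (fun x => x.P ^ 2) q t) := by
  refine ((hS.mD I).dtφ.smul t).l2sq_eq_modeSum I fun k => ?_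
  have h : mass (S.mD I).dtφ k = symb I k * mass S.dtφ k := hS.dtφ.mass_mD I k
  rw [mass_smul, h]
  simp only [Slice.pairSum, mass, Fintype.sum_bool, Slice.frame]
  ring

theorem l2sq_ν_mD (hS : S.IsFourierSum) (I : Fin 3 → ℕ) :
    l2sq (S.mD I).ν = modeSum I (S.pairSum (fun x => x.ν ^ 2) q t) :=
  (hS.mD I).ν.l2sq_eq_modeSum I fun k => hS.ν.mass_mD I k

theorem almostTotalSq_mD (ht : 0 < t) (hS : S.IsFourierSum) (I : Fin 3 → ℕ) :
    almostTotalSq Frame.theta q t (S.mD I) = modeSum I (S.pairSum Frame.energy q t) := by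
  have hθ : (0 : ℝ) ≤ Frame.theta := by norm_num [Frame.theta]
  have h1 : ∀ x : Frame, 0 ≤ x.zz * x.hh := fun x => mul_nonneg x.zz_nonneg x.hh_nonneg
  have h2 : ∀ x : Frame, 0 ≤ x.zz * x.φ ^ 2 := fun x => mul_nonneg x.zz_nonneg (sq_nonneg _)
  have p1 := fun k => Slice.pairSum_nonneg Frame.kk_nonneg q t S k
  have p2 := fun k => Slice.pairSum_nonneg h1 q t S k
  have p3 := fun k => Slice.pairSum_nonneg h2 q t S k
  have p4 := fun k => Slice.pairSum_nonneg (fun x => sq_nonneg x.P) q t S k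
  have p5 := fun k => Slice.pairSum_nonneg (fun x => sq_nonneg x.ν) q t S k
  have hφ : (S.mD I).φ = mD I S.φ := rfl
  rw [almostTotalSq, metricEnergySq, scalarEnergySq, KSq_mD ht hS, dgSq_mD ht hS,
    l2sq_dtφ_mD (q := q) hS, hφ, dScalarSq_mD (q := q) ht hS.φ I S (Y := Frame.φ)
    (fun _ _ => rfl), l2sq_ν_mD (q := q) (t := t) hS,
    ofReal_mul_modeSum I (by norm_num), modeSum_add I p1 fun k => mul_nonneg (by norm_num) (p2 k),
    ofReal_mul_modeSum I hθ, modeSum_add I p4 p3, modeSum_add I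
    (fun k => mul_nonneg hθ (add_nonneg (p1 k) (mul_nonneg (by norm_num) (p2 k))))
    (fun k => add_nonneg (p4 k) (p3 k)),
    modeSum_add I (fun k => add_nonneg
      (mul_nonneg hθ (add_nonneg (p1 k) (mul_nonneg (by norm_num) (p2 k))))
      (add_nonneg (p4 k) (p3 k))) p5]
  congr 1
  funext k
  simp only [Slice.pairSum, Fintype.sum_bool, Frame.energy]
  ring

theorem totalSq_eq (θ : ℝ) (q : Fin 3 → ℝ) (t : ℝ) (S : Slice) :
    totalSq θ q t S = almostTotalSq θ q t S + dScalarSq q t S.ν := by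
  simp only [totalSq, almostTotalSq]
  ring

theorem totalSq_mD (ht : 0 < t) (hS : S.IsFourierSum) (I : Fin 3 → ℕ) :
    totalSq Frame.theta q t (S.mD I)
      = modeSum I (S.pairSum (fun x => x.energy + x.zz * x.ν ^ 2) q t) := by
  have h2 : ∀ x : Frame, 0 ≤ x.zz * x.ν ^ 2 := fun x => mul_nonneg x.zz_nonneg (sq_nonneg _)
  have hν : (S.mD I).ν = mD I S.ν := rfl
  rw [totalSq_eq, almostTotalSq_mD ht hS, hν, dScalarSq_mD (q := q) ht hS.ν I S (Y := Frame.ν)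
    (fun _ _ => rfl), modeSum_add I
    (fun k => Slice.pairSum_nonneg Frame.energy_nonneg q t S k)
    (fun k => Slice.pairSum_nonneg h2 q t S k)]
  congr 1
  funext k
  simp only [Slice.pairSum, Fintype.sum_bool]
  ring

end

/-- Tonelli exchanges the time integral with the sum over frequencies; for each mode the integrand
is continuous, so the lower integral is an ordinary one. -/
theorem timeInt_modeSum {F : ℝ → ℝ≥0∞} {Y : (Fin 3 → ℤ) → Bool → ℝ → ℝ} {t : ℝ}
    (ht : t ∈ Ioc (0 : ℝ) 1)
    (hF : ∀ s ∈ Ioc (0 : ℝ) 1, F s = modeSum 0 fun k => ∑ b, Y k b s)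
    (hY : ∀ k b s, 0 ≤ Y k b s) (hc : ∀ k b, ContinuousOn (Y k b) (Ioc 0 1)) :
    timeInt t F = modeSum 0 fun k => ∑ b, ∫ s in t..1, s⁻¹ * Y k b s := by
  have hsub : Icc t 1 ⊆ Ioc (0 : ℝ) 1 := fun s hs => ⟨ht.1.trans_le hs.1, hs.2⟩
  have hinv : ContinuousOn (fun s : ℝ => s⁻¹) (Icc t 1) :=
    continuousOn_inv₀.mono fun s hs => (hsub hs).1.ne'
  have hsymb : ∀ k, symb 0 k = 1 := fun k => by simp [symb]
  have hcont : ∀ k b, ContinuousOn (fun s => s⁻¹ * Y k b s) (Icc t 1) := fun k b =>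
    hinv.mul ((hc k b).mono hsub)
  have hcs : ∀ k, ContinuousOn (fun s => ∑ b, s⁻¹ * Y k b s) (Icc t 1) := fun k =>
    continuousOn_finsetSum _ fun b _ => hcont k b
  have h1 : timeInt t F
      = ∫⁻ s in Icc t 1, ∑' k, ENNReal.ofReal (∑ b, s⁻¹ * Y k b s) := by
    refine setLIntegral_congr_fun measurableSet_Icc fun s hs => ?_
    simp only [hF s (hsub hs), modeSum, hsymb, one_mul]
    rw [← ENNReal.tsum_mul_left]
    refine tsum_congr fun k => ?_
    rw [← ENNReal.ofReal_mul (inv_nonneg.2 (hsub hs).1.le), Finset.mul_sum]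
  rw [h1, lintegral_tsum fun k =>
    ((hcs k).aestronglyMeasurable measurableSet_Icc).aemeasurable.ennreal_ofReal, modeSum]
  refine tsum_congr fun k => ?_
  rw [hsymb, one_mul, ← ofReal_integral_eq_lintegral_ofReal ((hcs k).integrableOn_Icc) ?_]
  · rw [integral_finsetSum _ fun b _ => (hcont k b).integrableOn_Icc]
    congr 1
    refine Finset.sum_congr rfl fun b _ => ?_
    rw [intervalIntegral.integral_of_le ht.2, integral_Icc_eq_integral_Ioc]
  · refine (ae_restrict_iff' measurableSet_Icc).2 (Filter.Eventually.of_forall fun s hs => ?_)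
    exact Finset.sum_nonneg fun b _ => mul_nonneg (inv_nonneg.2 (hsub hs).1.le) (hY k b s)

/-! ### Summation of the mode estimates -/

namespace IsLinearizedSolution

variable {lam κ A σ : ℝ} {q : Fin 3 → ℝ} {u : Fields}

theorem timeInt_pairSum {t : ℝ} (ht : t ∈ Ioc (0 : ℝ) 1)
    {F : ℝ → Slice → ℝ≥0∞} {X : Frame → ℝ} (hX : ∀ x, 0 ≤ X x)
    (hF : ∀ s ∈ Ioc (0 : ℝ) 1, F s (u.slice s) = modeSum 0 ((u.slice s).pairSum X q s))
    (hc : ∀ k b, ContinuousOn (fun s => X ((u.slice s).frame q k b s)) (Ioc 0 1)) :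
    timeInt t (fun s => F s (u.slice s))
      = modeSum 0 fun k => ∑ b, ∫ s in t..1, s⁻¹ * X ((u.slice s).frame q k b s) :=
  timeInt_modeSum ht hF (fun _ _ _ => hX _) hc

/-- Once every term is a sum over modes, the claim is the mode inequality, term by term. Dissipation
stands on the left to avoid subtraction in `[0,∞]`. -/
theorem energy_inequality (hu : IsLinearizedSolution lam κ q A u)
    (h : Frame.NearFLRW lam κ A σ q) {t : ℝ} (ht : t ∈ Ioc (0 : ℝ) 1) :
    almostTotalSq Frame.theta q t (u.slice t)
        + ENNReal.ofReal (1 / 6 * Frame.theta) * timeInt t (fun s => dgSq q s (u.slice s))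
        + ENNReal.ofReal (1 / 12) * timeInt t (fun s => dScalarSq q s (u.slice s).φ)
        + ENNReal.ofReal (1 / 21) * timeInt t (fun s => dScalarSq q s (u.slice s).ν)
        + ENNReal.ofReal (2 / 9) * timeInt t (fun s => l2sq (u.slice s).ν)
      ≤ ENNReal.ofReal 120 * almostTotalSq Frame.theta q 1 (u.slice 1)
        + ENNReal.ofReal (290000000 * σ)
          * timeInt t (fun s => almostTotalSq Frame.theta q s (u.slice s)) := by
  have hlam : lam ≠ 0 := by linarith [h.lam_ge]
  have hm := fun k b => hu.isModeSolution hlam k b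
  have h1 : ∀ x : Frame, 0 ≤ x.zz * x.hh := fun x => mul_nonneg x.zz_nonneg x.hh_nonneg
  have h2 : ∀ x : Frame, 0 ≤ x.zz * x.φ ^ 2 := fun x => mul_nonneg x.zz_nonneg (sq_nonneg _)
  have h3 : ∀ x : Frame, 0 ≤ x.zz * x.ν ^ 2 := fun x => mul_nonneg x.zz_nonneg (sq_nonneg _)
  have h4 : ∀ x : Frame, 0 ≤ x.ν ^ 2 := fun x => sq_nonneg _
  have i1 := timeInt_pairSum (u := u) ht (F := fun s S => dgSq q s S) h1
    (fun s hs => dgSq_mD hs.1 (hu.isFourierSum hs) 0)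
    (fun k b => ((hm k b).rate_zz.mul (hm k b).rate_hh).continuousOn)
  have i2 := timeInt_pairSum (u := u) ht (F := fun s S => dScalarSq q s S.φ) h2
    (fun s hs => dScalarSq_mD (q := q) hs.1 (hu.isFourierSum hs).φ 0 (u.slice s) (Y := Frame.φ)
      (fun _ _ => rfl))
    (fun k b => ((hm k b).rate_zz.mul (hm k b).rate_φ.sq).continuousOn)
  have i3 := timeInt_pairSum (u := u) ht (F := fun s S => dScalarSq q s S.ν) h3
    (fun s hs => dScalarSq_mD (q := q) hs.1 (hu.isFourierSum hs).ν 0 (u.slice s) (Y := Frame.ν)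
      (fun _ _ => rfl))
    (fun k b => ((hm k b).rate_zz.mul (hm k b).rate_ν.sq).continuousOn)
  have i4 := timeInt_pairSum (u := u) ht (F := fun s S => l2sq S.ν) h4
    (fun s hs => l2sq_ν_mD (q := q) (hu.isFourierSum hs) 0)
    (fun k b => (hm k b).rate_ν.sq.continuousOn)
  have i5 := timeInt_pairSum (u := u) ht (F := fun s S => almostTotalSq Frame.theta q s S)
    Frame.energy_nonneg (fun s hs => almostTotalSq_mD hs.1 (hu.isFourierSum hs) 0)
    (fun k b => (hm k b).continuousOn_energy)
  have e1 := almostTotalSq_mD (q := q) ht.1 (hu.isFourierSum ht) 0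
  have e2 := almostTotalSq_mD (q := q) one_pos
    (hu.isFourierSum (t := 1) ⟨one_pos, le_rfl⟩) 0
  -- The multi-index `0` iterates no derivative, so `mD 0` is the identity by definition.
  change almostTotalSq Frame.theta q t (u.slice t) = _ at e1
  change almostTotalSq Frame.theta q 1 (u.slice 1) = _ at e2
  have hθ : (0 : ℝ) ≤ 1 / 6 * Frame.theta := by norm_num [Frame.theta]
  have hσ : (0 : ℝ) ≤ 290000000 * σ := mul_nonneg (by norm_num) h.σ_nonneg
  have pos : ∀ {X : Frame → ℝ}, (∀ x, 0 ≤ X x) → ∀ k,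
      0 ≤ ∑ b, ∫ s in t..1, s⁻¹ * X ((u.slice s).frame q k b s) := fun hX k =>
    Finset.sum_nonneg fun b _ => integral_inv_mul_nonneg ht fun s => hX _
  have posE := fun (t : ℝ) k => Slice.pairSum_nonneg Frame.energy_nonneg q t (u.slice t) k
  rw [i1, i2, i3, i4, i5, e1, e2, ofReal_mul_modeSum 0 hθ, ofReal_mul_modeSum 0 (by norm_num),
    ofReal_mul_modeSum 0 (by norm_num), ofReal_mul_modeSum 0 (by norm_num),
    ofReal_mul_modeSum 0 (by norm_num), ofReal_mul_modeSum 0 hσ,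
    modeSum_add 0 (fun k => posE t k) (fun k => mul_nonneg hθ (pos h1 k)),
    modeSum_add 0 (fun k => add_nonneg (posE t k) (mul_nonneg hθ (pos h1 k)))
      (fun k => mul_nonneg (by norm_num) (pos h2 k)),
    modeSum_add 0 (fun k => add_nonneg (add_nonneg (posE t k) (mul_nonneg hθ (pos h1 k)))
      (mul_nonneg (by norm_num) (pos h2 k))) (fun k => mul_nonneg (by norm_num) (pos h3 k)),
    modeSum_add 0 (fun k => add_nonneg (add_nonneg (add_nonneg (posE t k)
      (mul_nonneg hθ (pos h1 k))) (mul_nonneg (by norm_num) (pos h2 k)))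
      (mul_nonneg (by norm_num) (pos h3 k))) (fun k => mul_nonneg (by norm_num) (pos h4 k)),
    modeSum_add 0 (fun k => mul_nonneg (by norm_num) (posE 1 k))
      (fun k => mul_nonneg hσ (pos Frame.energy_nonneg k))]
  refine modeSum_mono 0 fun k => ?_
  have key : ∀ b, _ := fun b => (hm k b).integral_diss_eq ht
  have main := Finset.sum_le_sum fun b (_ : b ∈ Finset.univ) =>
    (hm k b).energy_add_integral_le h ht
  simp only [key, Finset.sum_add_distrib, ← Finset.mul_sum] at main
  simp only [Slice.pairSum]
  linarith

end IsLinearizedSolution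

/-- For `M ≥ 1` the root of `M` may be replaced by `M`, which keeps the constants free of roots. -/
theorem ENNReal_rpow_half_le {X Z : ℝ≥0∞} {M : ℝ} (hM : 1 ≤ M) (h : X ≤ ENNReal.ofReal M * Z) :
    X ^ (1 / 2 : ℝ) ≤ ENNReal.ofReal M * Z ^ (1 / 2 : ℝ) := by
  refine (ENNReal.rpow_le_rpow h (by norm_num)).trans ?_
  rw [ENNReal.mul_rpow_of_nonneg _ _ (by norm_num)]
  gcongr
  have h1 : (1 : ℝ≥0∞) ≤ ENNReal.ofReal M := by simpa using hM
  simpa using ENNReal.rpow_le_rpow_of_exponent_le h1 (by norm_num : (1 / 2 : ℝ) ≤ 1)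

theorem ENNReal_sum_rpow_half_le {ι : Type*} (s : Finset ι) (f : ι → ℝ≥0∞) :
    (∑ i ∈ s, f i) ^ (1 / 2 : ℝ) ≤ ∑ i ∈ s, f i ^ (1 / 2 : ℝ) := by
  classical
  induction s using Finset.induction_on with
  | empty => simp
  | insert a s ha ih =>
    rw [Finset.sum_insert ha, Finset.sum_insert ha]
    exact (ENNReal.rpow_add_le_add_rpow _ _ (by norm_num) (by norm_num)).trans
      (add_le_add_right ih _)

namespace IsLinearizedSolution

variable {lam κ A σ : ℝ} {q : Fin 3 → ℝ} {u : Fields}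

theorem one_le_mul_rpow {t C p : ℝ} (ht : t ∈ Ioc (0 : ℝ) 1) (hC : 1 ≤ C) (hp : 0 ≤ p) :
    1 ≤ C * t ^ (-p) := by
  have := one_le_rpow_neg ht hp
  nlinarith

theorem almostTotalEnergy_le (hu : IsLinearizedSolution lam κ q A u)
    (h : Frame.NearFLRW lam κ A σ q) {t : ℝ} (ht : t ∈ Ioc (0 : ℝ) 1) :
    almostTotalEnergy Frame.theta q u t
      ≤ ENNReal.ofReal (120 * t ^ (-(290000000 * σ))) * almostTotalEnergy Frame.theta q u 1 := by
  have hσ : (0 : ℝ) ≤ 290000000 * σ := mul_nonneg (by norm_num) h.σ_nonneg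
  have hM := one_le_mul_rpow ht (by norm_num : (1 : ℝ) ≤ 120) hσ
  refine ENNReal_rpow_half_le hM ?_
  have e1 := almostTotalSq_mD (q := q) ht.1 (hu.isFourierSum ht) 0
  have e2 := almostTotalSq_mD (q := q) one_pos
    (hu.isFourierSum (t := 1) ⟨one_pos, le_rfl⟩) 0
  change almostTotalSq Frame.theta q t (u.slice t) = _ at e1
  change almostTotalSq Frame.theta q 1 (u.slice 1) = _ at e2
  rw [e1, e2, ofReal_mul_modeSum 0 (by linarith)]
  refine modeSum_mono 0 fun k => ?_
  simp only [Slice.pairSum, Finset.mul_sum]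
  exact Finset.sum_le_sum fun b _ =>
    (hu.isModeSolution (by linarith [h.lam_ge]) k b).energy_le h ht

theorem sqrt_totalSq_le (hu : IsLinearizedSolution lam κ q A u)
    (h : Frame.NearFLRW lam κ A σ q) {t : ℝ} (ht : t ∈ Ioc (0 : ℝ) 1) (I : Fin 3 → ℕ) :
    totalSq Frame.theta q t ((u.slice t).mD I) ^ (1 / 2 : ℝ)
      ≤ ENNReal.ofReal (300 * t ^ (-(290000000 * σ)))
        * totalSq Frame.theta q 1 ((u.slice 1).mD I) ^ (1 / 2 : ℝ) := by
  have hσ : (0 : ℝ) ≤ 290000000 * σ := mul_nonneg (by norm_num) h.σ_nonneg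
  have hM := one_le_mul_rpow ht (by norm_num : (1 : ℝ) ≤ 300) hσ
  refine ENNReal_rpow_half_le hM ?_
  rw [totalSq_mD (q := q) ht.1 (hu.isFourierSum ht),
    totalSq_mD (q := q) one_pos (hu.isFourierSum (t := 1) ⟨one_pos, le_rfl⟩),
    ofReal_mul_modeSum I (by linarith)]
  refine modeSum_mono I fun k => ?_
  simp only [Slice.pairSum]
  rw [Finset.mul_sum]
  exact Finset.sum_le_sum fun b _ =>
    (hu.isModeSolution (by linarith [h.lam_ge]) k b).total_le h ht

end IsLinearizedSolution

/-! ### Comparison of the solution norm with the energies -/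

theorem mem_multiIdx {M : ℕ} {I : Fin 3 → ℕ} : I ∈ multiIdx M ↔ ∑ i, I i ≤ M := by
  simp only [multiIdx, Finset.mem_filter, Fintype.mem_piFinset, Finset.mem_range,
    and_iff_right_iff_imp]
  intro h i
  have := Finset.single_le_sum (f := I) (fun _ _ => Nat.zero_le _) (Finset.mem_univ i)
  omega

theorem sum_add_single (I : Fin 3 → ℕ) (a : Fin 3) :
    ∑ i, (I + Pi.single a 1 : Fin 3 → ℕ) i = (∑ i, I i) + 1 := by
  simp [Finset.sum_add_distrib]

theorem sum_shift_le (N : ℕ) (f : (Fin 3 → ℕ) → ℝ≥0∞) (a : Fin 3) :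
    ∑ I ∈ multiIdx N, f (I + Pi.single a 1) ≤ ∑ J ∈ multiIdx (N + 1), f J := by
  rw [← Finset.sum_image (g := fun I : Fin 3 → ℕ => I + Pi.single a 1) (f := f)
    fun I _ J _ h => add_right_cancel h]
  refine Finset.sum_le_sum_of_subset fun J hJ => ?_
  obtain ⟨I, hI, rfl⟩ := Finset.mem_image.1 hJ
  rw [mem_multiIdx] at hI ⊢
  rw [sum_add_single]
  omega

/-- A multi-index of order `N + 1` has a nonzero entry that can be lowered, so it is a shift of one
of order `N`. This reduces the extra derivative of the lapse to its gradient. -/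
theorem sum_multiIdx_succ_le (N : ℕ) (f : (Fin 3 → ℕ) → ℝ≥0∞) :
    ∑ J ∈ multiIdx (N + 1), f J
      ≤ ∑ I ∈ multiIdx N, (f I + ∑ a, f (I + Pi.single a 1)) := by
  classical
  have hsub : multiIdx (N + 1) ⊆ multiIdx N
      ∪ Finset.univ.biUnion fun a => (multiIdx N).image fun I => I + Pi.single a 1 := by
    intro J hJ
    rw [mem_multiIdx] at hJ
    rw [Finset.mem_union, mem_multiIdx]
    by_cases h : ∑ i, J i ≤ N
    · exact Or.inl h
    · right
      obtain ⟨a, ha⟩ : ∃ a, J a ≠ 0 := by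
        by_contra! h0
        simp [h0] at h
      have hJa : J - Pi.single a 1 + Pi.single a 1 = J := by
        funext i
        by_cases hi : i = a
        · subst hi
          simp
          omega
        · simp [hi]
      refine Finset.mem_biUnion.2 ⟨a, Finset.mem_univ a, Finset.mem_image.2 ⟨_, ?_, hJa⟩⟩
      rw [mem_multiIdx]
      have := sum_add_single (J - Pi.single a 1) a
      rw [hJa] at this
      omega
  refine (Finset.sum_le_sum_of_subset hsub).trans ?_
  have hunion : ∀ s t : Finset (Fin 3 → ℕ), ∑ J ∈ s ∪ t, f J ≤ ∑ J ∈ s, f J + ∑ J ∈ t, f J :=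
    fun s t => by rw [← Finset.sum_union_inter]; exact le_self_add
  refine (hunion _ _).trans ?_
  rw [Finset.sum_add_distrib, Finset.sum_comm]
  gcongr
  have hb : ∀ (s : Finset (Fin 3)) (F : Fin 3 → Finset (Fin 3 → ℕ)),
      ∑ J ∈ s.biUnion F, f J ≤ ∑ a ∈ s, ∑ J ∈ F a, f J := fun s F => by
    induction s using Finset.induction_on with
    | empty => simp
    | insert a s ha ih =>
      rw [Finset.biUnion_insert, Finset.sum_insert ha]
      exact (hunion _ _).trans (add_le_add_right ih _)
  refine (hb _ _).trans (Finset.sum_le_sum fun a _ => ?_)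
  rw [Finset.sum_image fun I _ J _ h => add_right_cancel h]

theorem symb_add_single (I : Fin 3 → ℕ) (a : Fin 3) (k : Fin 3 → ℤ) :
    symb (I + Pi.single a 1) k = freq k a ^ 2 * symb I k := by
  have h : ∀ i, (freq k i ^ 2) ^ (Pi.single a 1 : Fin 3 → ℕ) i
      = if i = a then freq k a ^ 2 else 1 := fun i => by
    by_cases hi : i = a
    · subst hi; simp
    · simp [hi]
  simp only [symb, Pi.add_apply, pow_add, Finset.prod_mul_distrib, h, Finset.prod_ite_eq',
    Finset.mem_univ, if_true]
  ring

theorem IsFourierSum.l2sq_smul {T : Distr} (hT : IsFourierSum T) (c : ℝ) :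
    l2sq (c • T) = ENNReal.ofReal (c ^ 2) * l2sq T := by
  rw [(hT.smul c).l2sq_eq, hT.l2sq_eq, ← ENNReal.tsum_mul_left]
  exact tsum_congr fun k => by rw [mass_smul, ENNReal.ofReal_mul (sq_nonneg c)]

theorem IsFourierSum.l2sq_congr {S T : Distr} (hS : IsFourierSum S) (hT : IsFourierSum T)
    (h : ∀ k, mass S k = mass T k) : l2sq S = l2sq T := by
  rw [hS.l2sq_eq, hT.l2sq_eq]
  exact tsum_congr fun k => by rw [h]

/-- Masses see only the product of the symbols, so the order of derivatives never has to be
exchanged on the functionals. -/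
theorem IsFourierSum.l2sq_mD_pD {T : Distr} (hT : IsFourierSum T) (I : Fin 3 → ℕ) (a : Fin 3) :
    l2sq (ParabolicKasner.mD I (ParabolicKasner.pD a T))
      = l2sq (ParabolicKasner.pD a (ParabolicKasner.mD I T)) :=
  ((hT.pD a).mD I).l2sq_congr ((hT.mD I).pD a) fun k => by
    rw [(hT.pD a).mass_mD, hT.mass_pD, (hT.mD I).mass_pD, hT.mass_mD]
    ring

theorem IsFourierSum.l2sq_mD_smul {T : Distr} (hT : IsFourierSum T) (I : Fin 3 → ℕ) (c : ℝ) :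
    l2sq (ParabolicKasner.mD I (c • T)) = l2sq (c • ParabolicKasner.mD I T) :=
  ((hT.smul c).mD I).l2sq_congr ((hT.mD I).smul c) fun k => by
    rw [(hT.smul c).mass_mD, mass_smul, mass_smul, hT.mass_mD]
    ring

theorem IsFourierSum.l2sq_mD_add_single {T : Distr} (hT : IsFourierSum T) (I : Fin 3 → ℕ)
    (a : Fin 3) : l2sq (ParabolicKasner.mD (I + Pi.single a 1) T)
      = l2sq (ParabolicKasner.pD a (ParabolicKasner.mD I T)) :=
  (hT.mD _).l2sq_congr ((hT.mD I).pD a) fun k => by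
    rw [hT.mass_mD, (hT.mD I).mass_pD, hT.mass_mD, symb_add_single]
    ring

theorem sum_le_ofReal_mul_sum {ι : Type*} (s : Finset ι) {c : ℝ} (hc : 0 ≤ c) {v w : ι → ℝ}
    (h : ∀ a, v a ≤ c * w a) (L : ι → ℝ≥0∞) :
    ∑ a ∈ s, ENNReal.ofReal (v a) * L a ≤ ENNReal.ofReal c * ∑ a ∈ s, ENNReal.ofReal (w a) * L a := by
  rw [Finset.mul_sum]
  refine Finset.sum_le_sum fun a _ => ?_
  rw [← mul_assoc, ← ENNReal.ofReal_mul hc]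
  gcongr
  exact h a

section Bounds

variable {q : Fin 3 → ℝ} {t σ : ℝ} {S : Slice}

theorem KSq_le_totalSq (S : Slice) :
    KSq q t S ≤ ENNReal.ofReal 1000000 * totalSq Frame.theta q t S := by
  have h1 : ENNReal.ofReal Frame.theta * KSq q t S ≤ totalSq Frame.theta q t S := by
    simp only [totalSq, metricEnergySq, mul_add, add_assoc]
    exact le_self_add
  calc KSq q t S = ENNReal.ofReal 1000000 * (ENNReal.ofReal Frame.theta * KSq q t S) := by
        rw [← mul_assoc, ← ENNReal.ofReal_mul (by norm_num)]
        norm_num [Frame.theta]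
    _ ≤ _ := by gcongr

theorem dgSq_le_totalSq (S : Slice) :
    dgSq q t S ≤ ENNReal.ofReal 4000000 * totalSq Frame.theta q t S := by
  have h1 : ENNReal.ofReal Frame.theta * (ENNReal.ofReal (1 / 4) * dgSq q t S)
      ≤ totalSq Frame.theta q t S := by
    simp only [totalSq, metricEnergySq, mul_add, add_assoc]
    exact le_add_self.trans (add_le_add_right le_self_add _)
  calc dgSq q t S = ENNReal.ofReal 4000000
        * (ENNReal.ofReal Frame.theta * (ENNReal.ofReal (1 / 4) * dgSq q t S)) := by
        rw [← mul_assoc, ← mul_assoc, ← ENNReal.ofReal_mul (by norm_num),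
          ← ENNReal.ofReal_mul (by norm_num [Frame.theta])]
        norm_num [Frame.theta]
    _ ≤ _ := by gcongr

theorem l2sq_dtφ_le_totalSq (S : Slice) : l2sq (t • S.dtφ) ≤ totalSq Frame.theta q t S := by
  simp only [totalSq, scalarEnergySq]
  calc l2sq (t • S.dtφ) ≤ l2sq (t • S.dtφ) + dScalarSq q t S.φ := le_self_add
    _ ≤ _ := le_add_self.trans (le_self_add.trans le_self_add)

theorem dScalarSq_φ_le_totalSq (S : Slice) : dScalarSq q t S.φ ≤ totalSq Frame.theta q t S := by
  simp only [totalSq, scalarEnergySq]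
  calc dScalarSq q t S.φ ≤ l2sq (t • S.dtφ) + dScalarSq q t S.φ := le_add_self
    _ ≤ _ := le_add_self.trans (le_self_add.trans le_self_add)

theorem dScalarSq_ν_le_totalSq (S : Slice) : dScalarSq q t S.ν ≤ totalSq Frame.theta q t S :=
  le_add_self.trans le_self_add

theorem l2sq_ν_le_totalSq (S : Slice) : l2sq S.ν ≤ totalSq Frame.theta q t S :=
  le_add_self

theorem one_le_rpow_of_nonpos {t p : ℝ} (ht : t ∈ Ioc (0 : ℝ) 1) (hp : p ≤ 0) : 1 ≤ t ^ p :=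
  Real.one_le_rpow_of_pos_of_le_one_of_nonpos ht.1 ht.2 hp

theorem sum_K_le (ht : t ∈ Ioc (0 : ℝ) 1) (hq : ∀ i, |q i - 1 / 3| ≤ σ) (S : Slice) :
    ∑ p : Fin 3 × Fin 3, l2sq (S.K p.1 p.2)
      ≤ ENNReal.ofReal (t ^ (-(6 * σ))) * KSq q t S := by
  have h := sum_le_ofReal_mul_sum (Finset.univ : Finset (Fin 3 × Fin 3))
    (Real.rpow_nonneg ht.1.le (-(6 * σ))) (v := fun _ => 1)
    (w := fun p => gK q t p.1 p.1 * gKinv q t p.2 p.2) (fun p => by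
      simp only [gK, gKinv, Matrix.diagonal_apply_eq, ← Real.rpow_add ht.1]
      have h1 := abs_le.1 (hq p.1)
      have h2 := abs_le.1 (hq p.2)
      exact one_le_rpow_of_nonpos ht (by linarith)) fun p => l2sq (S.K p.1 p.2)
  simp only [ENNReal.ofReal_one, one_mul] at h
  refine h.trans (le_of_eq ?_)
  rw [KSq, Fintype.sum_prod_type]

/-- The weight is `t^(2 - 2(q_e + q_a + q_b))`, with exponent at most `6σ`. This is the worst case
among the three comparisons and fixes the exponent `6σ` in them. -/
theorem sum_dg_le (ht : t ∈ Ioc (0 : ℝ) 1) (hq : ∀ i, |q i - 1 / 3| ≤ σ) (hS : S.IsFourierSum) :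
    ∑ p : Fin 3 × Fin 3 × Fin 3, l2sq (pD p.1 (S.g p.2.1 p.2.2))
      ≤ ENNReal.ofReal (t ^ (-(6 * σ))) * dgSq q t S := by
  have h := sum_le_ofReal_mul_sum (Finset.univ : Finset (Fin 3 × Fin 3 × Fin 3))
    (Real.rpow_nonneg ht.1.le (-(6 * σ))) (v := fun _ => 1)
    (w := fun p => gKinv q t p.1 p.1 * gKinv q t p.2.1 p.2.1 * gKinv q t p.2.2 p.2.2 * t ^ 2)
    (fun p => by
      simp only [gKinv, Matrix.diagonal_apply_eq, ← Real.rpow_add ht.1, ← Real.rpow_natCast t 2]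
      have h1 := abs_le.1 (hq p.1)
      have h2 := abs_le.1 (hq p.2.1)
      have h3 := abs_le.1 (hq p.2.2)
      exact one_le_rpow_of_nonpos ht (by push_cast; linarith))
    fun p => l2sq (pD p.1 (S.g p.2.1 p.2.2))
  simp only [ENNReal.ofReal_one, one_mul] at h
  refine h.trans (le_of_eq ?_)
  simp only [dgSq, Fintype.sum_prod_type, ((hS.g _ _).pD _).l2sq_smul]
  congr 1
  refine Finset.sum_congr rfl fun e _ => Finset.sum_congr rfl fun i _ =>
    Finset.sum_congr rfl fun j _ => ?_
  rw [← mul_assoc, ← ENNReal.ofReal_mul]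
  exact mul_nonneg (mul_nonneg (gKinv_diag_nonneg ht.1 _) (gKinv_diag_nonneg ht.1 _))
    (gKinv_diag_nonneg ht.1 _)

/-- In the isotropic case the weight is exactly `t^(4/3)`, the square of the factor `t^(2/3)` in the
solution norm; anisotropy costs at most `t^(-2σ)`. -/
theorem sum_dScalar_le (ht : t ∈ Ioc (0 : ℝ) 1) (hq : ∀ i, |q i - 1 / 3| ≤ σ) {T : Distr}
    (hT : IsFourierSum T) :
    ENNReal.ofReal (t ^ (4 / 3 : ℝ)) * ∑ a, l2sq (pD a T)
      ≤ ENNReal.ofReal (t ^ (-(6 * σ))) * dScalarSq q t T := by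
  have hσ : 0 ≤ σ := (abs_nonneg _).trans (hq 0)
  have h := sum_le_ofReal_mul_sum (Finset.univ : Finset (Fin 3))
    (Real.rpow_nonneg ht.1.le (-(6 * σ))) (v := fun _ => t ^ (4 / 3 : ℝ))
    (w := fun a => gKinv q t a a * t ^ 2)
    (fun a => by
      simp only [gKinv, Matrix.diagonal_apply_eq, ← Real.rpow_add ht.1, ← Real.rpow_natCast t 2]
      have h1 := abs_le.1 (hq a)
      exact Real.rpow_le_rpow_of_exponent_ge ht.1 ht.2 (by push_cast; linarith))
    fun a => l2sq (pD a T)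
  rw [Finset.mul_sum]
  refine h.trans (le_of_eq ?_)
  simp only [dScalarSq, (hT.pD _).l2sq_smul]
  congr 1
  refine Finset.sum_congr rfl fun a _ => ?_
  rw [← mul_assoc, ← ENNReal.ofReal_mul (gKinv_diag_nonneg ht.1 _)]

/-- The constant in the comparison of the solution norm with the energies. -/
def cmpConst (σ t : ℝ) : ℝ := 4000000 * t ^ (-(6 * σ))

theorem ofReal_rpow_two_thirds_mul {t : ℝ} (ht : 0 < t) (X : ℝ≥0∞) :
    ENNReal.ofReal (t ^ (2 / 3 : ℝ)) * X ^ (1 / 2 : ℝ)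
      = (ENNReal.ofReal (t ^ (4 / 3 : ℝ)) * X) ^ (1 / 2 : ℝ) := by
  rw [ENNReal.mul_rpow_of_nonneg _ _ (by norm_num),
    ENNReal.ofReal_rpow_of_pos (Real.rpow_pos_of_pos ht _), ← Real.rpow_mul ht.le]
  norm_num

theorem sqrt_le_of_le {X Y : ℝ≥0∞} {c : ℝ} (ht : t ∈ Ioc (0 : ℝ) 1) (hσ : 0 ≤ σ)
    (hc : c ≤ 4000000) {Z : ℝ≥0∞} (h1 : X ≤ ENNReal.ofReal (t ^ (-(6 * σ))) * Z)
    (h2 : Z ≤ ENNReal.ofReal c * Y) :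
    X ^ (1 / 2 : ℝ) ≤ ENNReal.ofReal (cmpConst σ t) * Y ^ (1 / 2 : ℝ) := by
  have h3 := one_le_rpow_neg ht (by linarith : 0 ≤ 6 * σ)
  refine ENNReal_rpow_half_le (by unfold cmpConst; linarith) ?_
  refine h1.trans ((mul_le_mul_right h2 _).trans ?_)
  rw [← mul_assoc, ← ENNReal.ofReal_mul (by linarith)]
  gcongr
  unfold cmpConst
  nlinarith

theorem le_ofReal_rpow_neg_mul (ht : t ∈ Ioc (0 : ℝ) 1) (hσ : 0 ≤ σ) (X : ℝ≥0∞) :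
    X ≤ ENNReal.ofReal (t ^ (-(6 * σ))) * X := by
  refine le_mul_of_one_le_left (zero_le) ?_
  have h3 := one_le_rpow_neg ht (by linarith : 0 ≤ 6 * σ)
  simpa using h3

theorem le_ofReal_one_mul (X : ℝ≥0∞) : X ≤ ENNReal.ofReal 1 * X := by simp

end Bounds

/-- Five groups of terms cost one unit each, and the lapse with `N + 1` derivatives costs four: one
for itself and three for its partial derivatives. This makes the factor `9`. -/
theorem solNorm_le (u : Fields) {q : Fin 3 → ℝ} {t σ : ℝ} (ht : t ∈ Ioc (0 : ℝ) 1)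
    (hq : ∀ i, |q i - 1 / 3| ≤ σ) (hS : (u.slice t).IsFourierSum) (N : ℕ) :
    solNorm N u t ≤ ENNReal.ofReal (9 * cmpConst σ t)
      * ∑ I ∈ multiIdx N, totalSq Frame.theta q t ((u.slice t).mD I) ^ (1 / 2 : ℝ) := by
  have hσ : 0 ≤ σ := (abs_nonneg _).trans (hq 0)
  set S := u.slice t with hSdef
  set Y : (Fin 3 → ℕ) → ℝ≥0∞ := fun I => totalSq Frame.theta q t (S.mD I) ^ (1 / 2 : ℝ) with hY
  set M := ENNReal.ofReal (cmpConst σ t) with hM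
  have bK : sobFrame N (fun p : Fin 3 × Fin 3 => S.K p.1 p.2) ≤ ∑ I ∈ multiIdx N, M * Y I :=
    Finset.sum_le_sum fun I _ => sqrt_le_of_le ht hσ (by norm_num)
      (sum_K_le ht hq (S.mD I)) (KSq_le_totalSq _)
  have bg : sobFrame N (fun p : Fin 3 × Fin 3 × Fin 3 => pD p.1 (S.g p.2.1 p.2.2))
      ≤ ∑ I ∈ multiIdx N, M * Y I := by
    refine Finset.sum_le_sum fun I _ => ?_
    have h1 : ∑ p : Fin 3 × Fin 3 × Fin 3, l2sq (mD I (pD p.1 (S.g p.2.1 p.2.2)))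
        = ∑ p : Fin 3 × Fin 3 × Fin 3, l2sq (pD p.1 ((S.mD I).g p.2.1 p.2.2)) :=
      Finset.sum_congr rfl fun p _ => (hS.g p.2.1 p.2.2).l2sq_mD_pD I p.1
    rw [h1]
    exact sqrt_le_of_le ht hσ le_rfl (sum_dg_le ht hq (hS.mD I)) (dgSq_le_totalSq _)
  have bP : sobFrame N (fun _ : Unit => t • S.dtφ) ≤ ∑ I ∈ multiIdx N, M * Y I := by
    refine Finset.sum_le_sum fun I _ => ?_
    simp only [Finset.univ_unique, Finset.sum_singleton, hS.dtφ.l2sq_mD_smul]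
    exact sqrt_le_of_le ht hσ (by norm_num) (le_ofReal_rpow_neg_mul ht hσ _)
      ((l2sq_dtφ_le_totalSq (S.mD I)).trans (le_ofReal_one_mul _))
  have bφ : ENNReal.ofReal (t ^ (2 / 3 : ℝ)) * sobFrame N (fun a : Fin 3 => pD a S.φ)
      ≤ ∑ I ∈ multiIdx N, M * Y I := by
    rw [sobFrame, Finset.mul_sum]
    refine Finset.sum_le_sum fun I _ => ?_
    rw [ofReal_rpow_two_thirds_mul ht.1]
    simp only [hS.φ.l2sq_mD_pD]
    exact sqrt_le_of_le ht hσ (by norm_num) (sum_dScalar_le ht hq (hS.φ.mD I))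
      ((dScalarSq_φ_le_totalSq (S.mD I)).trans (le_ofReal_one_mul _))
  have bν : ∀ I, l2sq (mD I S.ν) ^ (1 / 2 : ℝ) ≤ M * Y I := fun I =>
    sqrt_le_of_le ht hσ (by norm_num) (le_ofReal_rpow_neg_mul ht hσ _)
      ((l2sq_ν_le_totalSq (S.mD I)).trans (le_ofReal_one_mul _))
  have bν0 : sobFrame N (fun _ : Unit => S.ν) ≤ ∑ I ∈ multiIdx N, M * Y I := by
    refine Finset.sum_le_sum fun I _ => ?_
    simpa using bν I
  have bdν : ∀ I a, ENNReal.ofReal (t ^ (2 / 3 : ℝ))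
      * l2sq (mD (I + Pi.single a 1) S.ν) ^ (1 / 2 : ℝ) ≤ M * Y I := fun I a => by
    rw [ofReal_rpow_two_thirds_mul ht.1, hS.ν.l2sq_mD_add_single]
    refine sqrt_le_of_le ht hσ (by norm_num)
      (le_trans ?_ (sum_dScalar_le ht hq (hS.ν.mD I)))
      ((dScalarSq_ν_le_totalSq (S.mD I)).trans (le_ofReal_one_mul _))
    gcongr
    exact Finset.single_le_sum (f := fun a => l2sq (pD a (mD I S.ν))) (fun _ _ => zero_le)
      (Finset.mem_univ a)
  have bν1 : ENNReal.ofReal (t ^ (2 / 3 : ℝ)) * sobFrame (N + 1) (fun _ : Unit => S.ν)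
      ≤ ∑ I ∈ multiIdx N, 4 * (M * Y I) := by
    have h1 : sobFrame (N + 1) (fun _ : Unit => S.ν)
        = ∑ J ∈ multiIdx (N + 1), l2sq (mD J S.ν) ^ (1 / 2 : ℝ) := by simp [sobFrame]
    rw [h1]
    refine (mul_le_mul_right (sum_multiIdx_succ_le N _) _).trans ?_
    rw [Finset.mul_sum]
    refine Finset.sum_le_sum fun I _ => ?_
    rw [mul_add, Finset.mul_sum]
    have h2 : ENNReal.ofReal (t ^ (2 / 3 : ℝ)) * l2sq (mD I S.ν) ^ (1 / 2 : ℝ) ≤ M * Y I := by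
      refine le_trans (mul_le_of_le_one_left (zero_le) ?_) (bν I)
      simpa using Real.rpow_le_one ht.1.le ht.2 (by norm_num : (0 : ℝ) ≤ 2 / 3)
    refine (add_le_add h2 (Finset.sum_le_sum fun a _ => bdν I a)).trans (le_of_eq ?_)
    simp only [Finset.sum_const, Finset.card_univ, Fintype.card_fin, nsmul_eq_mul]
    push_cast
    ring
  have hsum : ∑ I ∈ multiIdx N, 4 * (M * Y I) = 4 * ∑ I ∈ multiIdx N, M * Y I :=
    (Finset.mul_sum _ _ _).symm
  rw [hsum] at bν1
  have hfin : ENNReal.ofReal (9 * cmpConst σ t) * ∑ I ∈ multiIdx N, Y I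
      = 9 * ∑ I ∈ multiIdx N, M * Y I := by
    rw [ENNReal.ofReal_mul (by norm_num), ← Finset.mul_sum, mul_assoc, ← hM]
    norm_num
  rw [hfin]
  simp only [solNorm, ← hSdef, Finset.sum_range_succ, Finset.range_zero, Finset.sum_empty,
    Nat.cast_zero, Nat.cast_one, mul_zero, mul_one, Real.rpow_zero, ENNReal.ofReal_one, one_mul,
    zero_add, add_zero]
  refine (add_le_add (add_le_add (add_le_add (add_le_add bK bg) bP) bφ)
    (add_le_add bν0 bν1)).trans (le_of_eq ?_)
  ring

/-- At `t = 1` the Kasner metric is Euclidean, so all weights are one. The factor `3` counts how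
often a multi-index can arise as a shift. -/
theorem sum_sqrt_totalSq_le (u : Fields) {q : Fin 3 → ℝ} (hS : (u.slice 1).IsFourierSum) (N : ℕ) :
    ∑ I ∈ multiIdx N, totalSq Frame.theta q 1 ((u.slice 1).mD I) ^ (1 / 2 : ℝ)
      ≤ 3 * solNorm N u 1 := by
  set S := u.slice 1 with hSdef
  have hθ : ENNReal.ofReal Frame.theta ≤ 1 := by norm_num [Frame.theta]
  have half : (0 : ℝ) ≤ 1 / 2 := by norm_num
  have sub : ∀ X Y : ℝ≥0∞, (X + Y) ^ (1 / 2 : ℝ) ≤ X ^ (1 / 2 : ℝ) + Y ^ (1 / 2 : ℝ) :=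
    fun X Y => ENNReal.rpow_add_le_add_rpow _ _ half (by norm_num)
  have hI : ∀ I, totalSq Frame.theta q 1 (S.mD I) ^ (1 / 2 : ℝ)
      ≤ (∑ p : Fin 3 × Fin 3, l2sq (mD I (S.K p.1 p.2))) ^ (1 / 2 : ℝ)
        + (∑ p : Fin 3 × Fin 3 × Fin 3, l2sq (mD I (pD p.1 (S.g p.2.1 p.2.2)))) ^ (1 / 2 : ℝ)
        + l2sq (mD I ((1 : ℝ) • S.dtφ)) ^ (1 / 2 : ℝ)
        + (∑ a, l2sq (mD I (pD a S.φ))) ^ (1 / 2 : ℝ)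
        + l2sq (mD I S.ν) ^ (1 / 2 : ℝ)
        + ∑ a, l2sq (mD (I + Pi.single a 1) S.ν) ^ (1 / 2 : ℝ) := fun I => by
    have eK : KSq q 1 (S.mD I) = ∑ p : Fin 3 × Fin 3, l2sq (mD I (S.K p.1 p.2)) := by
      simp [KSq, gK, gKinv, Fintype.sum_prod_type, Slice.mD]
    have eg : dgSq q 1 (S.mD I)
        = ∑ p : Fin 3 × Fin 3 × Fin 3, l2sq (mD I (pD p.1 (S.g p.2.1 p.2.2))) := by
      simp [dgSq, gKinv, Fintype.sum_prod_type, Slice.mD, (hS.g _ _).l2sq_mD_pD]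
    have eP : l2sq ((1 : ℝ) • (S.mD I).dtφ) = l2sq (mD I ((1 : ℝ) • S.dtφ)) :=
      (hS.dtφ.l2sq_mD_smul I 1).symm
    have eφ : dScalarSq q 1 (S.mD I).φ = ∑ a, l2sq (mD I (pD a S.φ)) := by
      simp [dScalarSq, gKinv, Slice.mD, hS.φ.l2sq_mD_pD]
    have eν : dScalarSq q 1 (S.mD I).ν = ∑ a, l2sq (mD (I + Pi.single a 1) S.ν) := by
      simp [dScalarSq, gKinv, Slice.mD, hS.ν.l2sq_mD_add_single]
    have hle : totalSq Frame.theta q 1 (S.mD I)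
        ≤ KSq q 1 (S.mD I) + dgSq q 1 (S.mD I) + l2sq ((1 : ℝ) • (S.mD I).dtφ)
          + dScalarSq q 1 (S.mD I).φ + l2sq (S.mD I).ν + dScalarSq q 1 (S.mD I).ν := by
      have h1 : ENNReal.ofReal Frame.theta * metricEnergySq q 1 (S.mD I)
          ≤ KSq q 1 (S.mD I) + dgSq q 1 (S.mD I) := by
        refine (mul_le_of_le_one_left (zero_le) hθ).trans ?_
        refine add_le_add_right (mul_le_of_le_one_left (zero_le) ?_) _
        norm_num
      calc totalSq Frame.theta q 1 (S.mD I)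
          ≤ KSq q 1 (S.mD I) + dgSq q 1 (S.mD I) + scalarEnergySq q 1 (S.mD I)
            + dScalarSq q 1 (S.mD I).ν + l2sq (S.mD I).ν := by
            unfold totalSq
            gcongr
        _ = _ := by
            unfold scalarEnergySq
            ring
    rw [eK, eg, eP, eφ, eν] at hle
    refine (ENNReal.rpow_le_rpow hle half).trans ?_
    refine (sub _ _).trans (add_le_add ?_ (ENNReal_sum_rpow_half_le _ _))
    refine (sub _ _).trans (add_le_add ?_ le_rfl)
    refine (sub _ _).trans (add_le_add ?_ le_rfl)
    refine (sub _ _).trans (add_le_add ?_ le_rfl)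
    exact sub _ _
  have hshift : ∑ I ∈ multiIdx N, ∑ a, l2sq (mD (I + Pi.single a 1) S.ν) ^ (1 / 2 : ℝ)
      ≤ 3 * sobFrame (N + 1) (fun _ : Unit => S.ν) := by
    rw [Finset.sum_comm]
    refine (Finset.sum_le_sum fun a _ =>
      sum_shift_le N (fun J => l2sq (mD J S.ν) ^ (1 / 2 : ℝ)) a).trans (le_of_eq ?_)
    simp [sobFrame]
  refine (Finset.sum_le_sum fun I _ => hI I).trans ?_
  simp only [Finset.sum_add_distrib]
  simp only [solNorm, ← hSdef, Finset.sum_range_succ, Finset.range_zero, Finset.sum_empty,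
    Real.one_rpow, ENNReal.ofReal_one, one_mul, zero_add, add_zero, mul_add]
  have tri : ∀ X : ℝ≥0∞, X ≤ 3 * X := fun X =>
    le_mul_of_one_le_left (zero_le) (by norm_num)
  rw [← add_assoc]
  refine add_le_add (add_le_add (add_le_add (add_le_add (add_le_add ?_ ?_) ?_) ?_) ?_) hshift
  · exact tri _
  · exact tri _
  · refine le_trans (le_of_eq ?_) (tri _)
    simp [sobFrame]
  · exact tri _
  · refine le_trans (le_of_eq ?_) (tri _)
    simp [sobFrame]

/-! ### The main estimates -/

/-- Since the exponents sum to one, `σ² = ∑ (q_i - 1/3)²`. This bounds each deviation by `σ` and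
gives `A² = 2/3 - σ² ≤ 2/3`. -/
theorem IsKasner.nearFLRW {lam κ A : ℝ} {q : Fin 3 → ℝ} (hK : IsKasner q A) (hlam : 3 ≤ lam)
    (hκ : κ = 2 / 3 ∨ κ = 1) (hσ : traceFreeParam q ≤ 1 / 10000) :
    Frame.NearFLRW lam κ A (traceFreeParam q) q := by
  have h1 := hK.sum_eq
  have h2 := hK.sum_sq_eq
  have h3 : ∑ i, (q i - 1 / 3) ^ 2 = ∑ i, q i ^ 2 - 1 / 3 := by
    simp only [Fin.sum_univ_three] at h1 ⊢
    linear_combination (-2 / 3) * h1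
  have h4 : 0 ≤ ∑ i, (q i - 1 / 3) ^ 2 := Finset.sum_nonneg fun _ _ => sq_nonneg _
  refine ⟨hlam, ?_, hK.A_nonneg, by linarith, hK.pos, h1, fun i => ?_, hσ⟩
  · rcases hκ with rfl | rfl <;> norm_num
  · unfold traceFreeParam
    rw [← h3]
    exact Real.abs_le_sqrt (Finset.single_le_sum (f := fun i => (q i - 1 / 3) ^ 2)
      (fun _ _ => sq_nonneg _) (Finset.mem_univ i))

namespace IsLinearizedSolution

variable {lam κ A σ : ℝ} {q : Fin 3 → ℝ} {u : Fields}

theorem sum_sqrt_totalSq_le (hu : IsLinearizedSolution lam κ q A u)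
    (h : Frame.NearFLRW lam κ A σ q) {t : ℝ} (ht : t ∈ Ioc (0 : ℝ) 1) (N : ℕ) :
    ∑ I ∈ multiIdx N, totalSq Frame.theta q t ((u.slice t).mD I) ^ (1 / 2 : ℝ)
      ≤ ENNReal.ofReal (900 * t ^ (-(290000000 * σ))) * solNorm N u 1 := by
  refine (Finset.sum_le_sum fun I _ => hu.sqrt_totalSq_le h ht I).trans ?_
  rw [← Finset.mul_sum]
  refine (mul_le_mul_right (ParabolicKasner.sum_sqrt_totalSq_le u
    (hu.isFourierSum (t := 1) ⟨one_pos, le_rfl⟩) N) _).trans (le_of_eq ?_)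
  have : (3 : ℝ≥0∞) = ENNReal.ofReal 3 := by norm_num
  rw [← mul_assoc, this, ← ENNReal.ofReal_mul (by have := ht.1; positivity)]
  ring_nf

theorem solNorm_le (hu : IsLinearizedSolution lam κ q A u)
    (h : Frame.NearFLRW lam κ A σ q) {t : ℝ} (ht : t ∈ Ioc (0 : ℝ) 1) (N : ℕ) :
    solNorm N u t
      ≤ ENNReal.ofReal (32400000000 * t ^ (-(290000006 * σ))) * solNorm N u 1 := by
  refine (ParabolicKasner.solNorm_le u ht h.q_near (hu.isFourierSum ht) N).trans ?_
  -- The constant is `9 · 4000000 · 900`, and the exponents `6σ` and `290000000σ` add.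
  refine (mul_le_mul_right (hu.sum_sqrt_totalSq_le h ht N) _).trans (le_of_eq ?_)
  have h0 : 0 ≤ 9 * cmpConst σ t := by
    have := ht.1
    unfold cmpConst
    positivity
  rw [← mul_assoc, ← ENNReal.ofReal_mul h0]
  congr 2
  have : -(290000006 * σ) = -(6 * σ) + -(290000000 * σ) := by ring
  rw [this, Real.rpow_add ht.1, cmpConst]
  ring

theorem totalEnergy_le (hu : IsLinearizedSolution lam κ q A u)
    (h : Frame.NearFLRW lam κ A σ q) {t : ℝ} (ht : t ∈ Ioc (0 : ℝ) 1) (N : ℕ) :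
    totalEnergy Frame.theta q N u t
      ≤ ENNReal.ofReal (900 * t ^ (-(290000000 * σ))) * solNorm N u 1 :=
  (ENNReal_sum_rpow_half_le _ _).trans (hu.sum_sqrt_totalSq_le h ht N)

end IsLinearizedSolution

theorem mul_rpow_neg_le {t σ c c' C C' : ℝ} (ht : t ∈ Ioc (0 : ℝ) 1) (hσ : 0 ≤ σ) (hc : c ≤ c')
    (hC0 : 0 ≤ C) (hC : C ≤ C') : C * t ^ (-(c * σ)) ≤ C' * t ^ (-(c' * σ)) := by
  have h1 : t ^ (-(c * σ)) ≤ t ^ (-(c' * σ)) :=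
    Real.rpow_le_rpow_of_exponent_ge ht.1 ht.2 (by nlinarith)
  exact mul_le_mul hC h1 (Real.rpow_nonneg ht.1.le _) (hC0.trans hC)

end ParabolicKasner

end

/-! ### The theorem -/

open ParabolicKasner in
theorem theorem7p1 :
    ∃ θ C c σ₀ : ℝ, 0 < θ ∧ 0 < C ∧ 0 < c ∧ 0 < σ₀ ∧
      ∀ (lam κ A : ℝ) (q : Fin 3 → ℝ) (u : Fields),
        3 ≤ lam → (κ = 2 / 3 ∨ κ = 1) → IsKasner q A → traceFreeParam q ≤ σ₀ →
        IsLinearizedSolution lam κ q A u →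
        (solNorm 0 u 1 < ⊤ →
          (∀ t ∈ Set.Ioc (0 : ℝ) 1,
            almostTotalSq θ q t (u.slice t)
                + ENNReal.ofReal (1 / 6 * θ) * timeInt t (fun s => dgSq q s (u.slice s))
                + ENNReal.ofReal (1 / 12) * timeInt t (fun s => dScalarSq q s (u.slice s).φ)
                + ENNReal.ofReal (1 / 21) * timeInt t (fun s => dScalarSq q s (u.slice s).ν)
                + ENNReal.ofReal (2 / 9) * timeInt t (fun s => l2sq (u.slice s).ν)
              ≤ ENNReal.ofReal C * almostTotalSq θ q 1 (u.slice 1)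
                + ENNReal.ofReal (c * traceFreeParam q)
                    * timeInt t (fun s => almostTotalSq θ q s (u.slice s))) ∧
          (∀ t ∈ Set.Ioc (0 : ℝ) 1,
            almostTotalEnergy θ q u t
              ≤ ENNReal.ofReal (C * t ^ (-(c * traceFreeParam q)))
                  * almostTotalEnergy θ q u 1)) ∧
        (∀ N : ℕ, solNorm N u 1 < ⊤ → ∀ t ∈ Set.Ioc (0 : ℝ) 1,
          (traceFreeParam q ≠ 0 →
            totalEnergy θ q N u t
                ≤ ENNReal.ofReal (C / traceFreeParam q * t ^ (-(c * traceFreeParam q)))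
                    * solNorm N u 1 ∧
            solNorm N u t
                ≤ ENNReal.ofReal (C / traceFreeParam q * t ^ (-(c * traceFreeParam q)))
                    * solNorm N u 1) ∧
          (traceFreeParam q = 0 →
            totalEnergy θ q N u t
                ≤ ENNReal.ofReal (C * (1 + |Real.log t|)) * solNorm N u 1 ∧
            solNorm N u t
                ≤ ENNReal.ofReal (C * (1 + |Real.log t|)) * solNorm N u 1)) := by
  refine ⟨Frame.theta, 100000000000, 300000000, 1 / 10000, by norm_num [Frame.theta],
    by norm_num, by norm_num, by norm_num, ?_⟩
  intro lam κ A q u hlam hκ hK hσ hu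
  have h := hK.nearFLRW hlam hκ hσ
  have hσ0 := h.σ_nonneg
  refine ⟨fun _ => ⟨fun t ht => ?_, fun t ht => ?_⟩, fun N _ t ht => ⟨fun hne => ?_, fun h0 => ?_⟩⟩
  · refine (hu.energy_inequality h ht).trans ?_
    gcongr <;> norm_num
  · refine (hu.almostTotalEnergy_le h ht).trans ?_
    gcongr ENNReal.ofReal ?_ * _
    exact mul_rpow_neg_le ht hσ0 (by norm_num) (by norm_num) (by norm_num)
  · have hpos : 0 < traceFreeParam q := lt_of_le_of_ne hσ0 (Ne.symm hne)
    -- The mode estimates lose no power of `σ`; since `σ ≤ 1`, dividing by it only weakens the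
    -- bound.
    have hC : (100000000000 : ℝ) ≤ 100000000000 / traceFreeParam q := by
      rw [le_div_iff₀ hpos]
      linarith
    constructor
    · refine (hu.totalEnergy_le h ht N).trans ?_
      gcongr ENNReal.ofReal ?_ * _
      exact mul_rpow_neg_le ht hσ0 (by norm_num) (by norm_num) (by linarith)
    · refine (hu.solNorm_le h ht N).trans ?_
      gcongr ENNReal.ofReal ?_ * _
      exact mul_rpow_neg_le ht hσ0 (by norm_num) (by norm_num) (by linarith)
  -- At `σ = 0` the power of `t` equals one, so a constant bound holds and the logarithm is only
  -- added slack.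
  · have habs := abs_nonneg (Real.log t)
    constructor
    · refine (hu.totalEnergy_le h ht N).trans ?_
      gcongr ENNReal.ofReal ?_ * _
      rw [h0, mul_zero, neg_zero, Real.rpow_zero]
      linarith
    · refine (hu.solNorm_le h ht N).trans ?_
      gcongr ENNReal.ofReal ?_ * _
      rw [h0, mul_zero, neg_zero, Real.rpow_zero]
      linarith
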